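/- Let $r,d\ge 1$ and $n\ge 0$ be integers, let $R$ be a commutative ring in which $r$ is invertible, and let $q,v_1,\dots,v_d\in R$ be invertible (for instance $R=\mathbb{Z}[\frac1r][q^{\pm1},\zeta,v_1^{\pm1},\dots,v_d^{\pm1}]$ with $\zeta=e^{2\pi i/r}$ and indeterminates $q,v_1,\dots,v_d$). For $m\ge 1$ let $\widehat Y_{r,m}$ be the associative unital $R$-algebra with generators $t_1,\dots,t_m,g_1,\dots,g_{m-1},X_1^{\pm1}$ and relations $$\begin{aligned} &g_ig_j=g_jg_i\ (|i-j|\ge2),\quad g_ig_{i+1}g_i=g_{i+1}g_ig_{i+1},\quad t_it_j=t_jt_i,\quad g_it_j=t_{s_i(j)}g_i,\quad t_i^r=1,\\ &g_i^2=1+(q-q^{-1})e_ig_i\ \text{ with } e_i=\tfrac1r\textstyle\sum_{s=0}^{r-1}t_i^st_{i+1}^{-s},\quad X_1X_1^{-1}=X_1^{-1}X_1=1,\\ &g_1X_1g_1X_1=X_1g_1X_1g_1,\quad g_iX_1=X_1g_i\ (i\ge2),\quad t_jX_1=X_1t_j, \end{aligned}$$ where $s_i=(i,i+1)$. Let $Y_{r,m}^d$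 be the quotient of $\widehat Y_{r,m}$ by the two-sided ideal generated by $(X_1-v_1)\cdots(X_1-v_d)$, and put $Y_{r,0}^d=R$. Put $X_{i+1}=g_iX_ig_i$. Let $\iota:Y_{r,n}^d\to Y_{r,n+1}^d$ be the algebra homomorphism sending each generator to the generator of the same name; through it $Y_{r,n+1}^d$ is a $(Y_{r,n}^d,Y_{r,n}^d)$-bimodule. Then there is an $R$-linear $(Y_{r,n}^d,Y_{r,n}^d)$-bimodule homomorphism $\theta:Y_{r,n+1}^d\to Y_{r,n}^d$ with $\theta\circ\iota=\mathrm{id}$ that vanishes on $X_{n+1}^at_{n+1}^b\,\iota(Y_{r,n}^d)$ for all $0\le a<d$, $0\le b<r$ with $(a,b)\ne(0,0)$ and, if $n\ge1$, on $\iota(Y_{r,n}^d)\,g_n\,\iota(Y_{r,n}^d)$, such that $\ker\theta$ contains no nonzero left ideal of $Y_{r,n+1}^d$. Moreover, for every left $Y_{r,n}^d$-module $M$ there is an isomorphism of left $Y_{r,n+1}^d$-modules $$Y_{r,n+1}^d\otimes_{Y_{r,n}^d}M\;\cong\;\mathrm{Hom}_{Y_{r,n}^d}(Y_{r,n+1}^d,M),\qquad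 h\otimes m\mapsto\bigl(x\mapsto\theta(xh)\,m\bigr),$$ natural in $M$, where $Y_{r,n+1}^d$ acts on the right-hand side by $(bf)(x)=f(xb)$. Thus induction from $Y_{r,n}^d$ to $Y_{r,n+1}^d$ is isomorphic to coinduction. -/

import Mathlib

open scoped TensorProduct

universe u w

namespace YokonumaHecke

/-! ## Induction and coinduction along a homomorphism of noncommutative rings -/

section IndCoind

variable {A B : Type u} [Ring A] [Ring B] (φ : A →+* B)

/-- The `B`-submodule of `B ⊗[ℤ] M` generated by the elements `b φ(a) ⊗ m - b ⊗ a m`. This set of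
generators is stable under left multiplication by `B`, so the submodule is also the additive
subgroup generated by them. -/
def balancingRelations (M : Type w) [AddCommGroup M] [Module A M] : Submodule B (B ⊗[ℤ] M) :=
  Submodule.span B {z | ∃ (b : B) (a : A) (m : M), z = (b * φ a) ⊗ₜ[ℤ] m - b ⊗ₜ[ℤ] (a • m)}

/-- The induced left `B`-module `B ⊗_A M` of a left `A`-module `M`. (Tensor products in Mathlib are
over commutative rings.) -/
abbrev Ind (M : Type w) [AddCommGroup M] [Module A M] : Type (max u w) :=
  (B ⊗[ℤ] M) ⧸ balancingRelations φ M

namespace Ind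

variable {M : Type w} [AddCommGroup M] [Module A M] {N : Type w} [AddCommGroup N] [Module A N]

/-- The pure tensor `b ⊗ m` in `B ⊗_A M`. -/
def tmul (b : B) (m : M) : Ind φ M := Submodule.Quotient.mk (b ⊗ₜ[ℤ] m)

/-- Functoriality of induction, `b ⊗ m ↦ b ⊗ f m`. -/
def map (f : M →ₗ[A] N) : Ind φ M →ₗ[B] Ind φ N :=
  Submodule.mapQ (balancingRelations φ M) (balancingRelations φ N)
    (TensorProduct.AlgebraTensorModule.map LinearMap.id f.toAddMonoidHom.toIntLinearMap) (by
      rw [balancingRelations, Submodule.span_le]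
      rintro z ⟨b, a, m, rfl⟩
      refine Submodule.subset_span ⟨b, a, f m, ?_⟩
      simp)

theorem map_tmul (f : M →ₗ[A] N) (b : B) (m : M) : map φ f (tmul φ b m) = tmul φ b (f m) := rfl

theorem tmul_balanced (b : B) (a : A) (m : M) : tmul φ (b * φ a) m = tmul φ b (a • m) :=
  (Submodule.Quotient.eq _).2 (Submodule.subset_span ⟨b, a, m, rfl⟩)

theorem smul_tmul (c b : B) (m : M) : c • tmul φ b m = tmul φ (c * b) m := rfl

end Ind

/-- The ring `B`, regarded as a left `A`-module through `φ`. -/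
def Res (_φ : A →+* B) : Type u := B

instance : AddCommGroup (Res φ) := inferInstanceAs (AddCommGroup B)

instance : Module A (Res φ) := Module.compHom B φ

/-- `Hom_A(B, M)`, where `B` is a left `A`-module through `φ`. -/
def Coind (M : Type w) [AddCommGroup M] [Module A M] : Type (max u w) := Res φ →ₗ[A] M

namespace Coind

variable {M : Type w} [AddCommGroup M] [Module A M] {N : Type w} [AddCommGroup N] [Module A N]

instance : AddCommGroup (Coind φ M) := inferInstanceAs (AddCommGroup (Res φ →ₗ[A] M))

instance : FunLike (Coind φ M) B M where
  coe f := DFunLike.coe (F := Res φ →ₗ[A] M) f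
  coe_injective _ _ h := LinearMap.ext (congrFun h)

variable {φ} in
@[ext] theorem ext {f g : Coind φ M} (h : ∀ x : B, f x = g x) : f = g := DFunLike.ext f g h

@[simp] theorem add_apply (f g : Coind φ M) (x : B) : (f + g) x = f x + g x := rfl

@[simp] theorem zero_apply (x : B) : (0 : Coind φ M) x = 0 := rfl

@[simp] theorem apply_add (f : Coind φ M) (x y : B) : f (x + y) = f x + f y :=
  LinearMap.map_add (show Res φ →ₗ[A] M from f) x y

@[simp] theorem apply_zero (f : Coind φ M) : f (0 : B) = 0 :=
  LinearMap.map_zero (show Res φ →ₗ[A] M from f)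

@[simp] theorem apply_left (f : Coind φ M) (a : A) (x : B) : f (φ a * x) = a • f x :=
  LinearMap.map_smul (show Res φ →ₗ[A] M from f) a x

/-- Build an element of `Hom_A(B, M)` from an additive map with `f (φ a * x) = a • f x`. -/
def mk (f : B → M) (hadd : ∀ x y, f (x + y) = f x + f y) (hsmul : ∀ a x, f (φ a * x) = a • f x) :
    Coind φ M :=
  show Res φ →ₗ[A] M from { toFun := f, map_add' := hadd, map_smul' := hsmul }

@[simp] theorem mk_apply (f : B → M) (hadd : ∀ x y, f (x + y) = f x + f y)
    (hsmul : ∀ a x, f (φ a * x) = a • f x) (x : B) : mk φ f hadd hsmul x = f x := rfl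

/-- The left `B`-module structure `(b f)(x) = f (x b)` on `Hom_A(B, M)`. -/
instance : Module B (Coind φ M) where
  smul b f := mk φ (fun x => f (x * b)) (fun x y => by rw [add_mul, apply_add])
    (fun a x => by rw [mul_assoc, apply_left])
  one_smul f := ext fun x => congrArg f (mul_one x)
  mul_smul b c f := ext fun x => congrArg f (mul_assoc x b c).symm
  smul_zero _ := rfl
  smul_add _ _ _ := rfl
  add_smul b c f := ext fun x => (congrArg f (mul_add x b c)).trans (apply_add φ f _ _)
  zero_smul f := ext fun x => (congrArg f (mul_zero x)).trans (apply_zero φ f)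

@[simp] theorem smul_apply (b : B) (f : Coind φ M) (x : B) : (b • f) x = f (x * b) := rfl

/-- Functoriality of coinduction, `h ↦ f ∘ h`. -/
def map (f : M →ₗ[A] N) : Coind φ M →ₗ[B] Coind φ N where
  toFun h := mk φ (fun x => f (h x)) (fun x y => by simp) (fun a x => by simp)
  map_add' h k := ext fun x => by simp
  map_smul' b h := ext fun x => by simp

@[simp] theorem map_apply (f : M →ₗ[A] N) (h : Coind φ M) (x : B) : map φ f h x = f (h x) := rfl

end Coind

end IndCoind

/-! ## The affine and cyclotomic Yokonuma-Hecke algebras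

Indices start at `0` in the code: `t i`, `g i`, `x` below are the generators usually written
`t_{i+1}`, `g_{i+1}`, `X_1`. -/

/-- The generators `t_1, …, t_n`, `g_1, …, g_{n-1}`, `X_1`, `X_1⁻¹`. (For `n = 0` there are none.) -/
inductive Gen (n : ℕ) : Type
  | t (i : Fin n)
  | g (i : ℕ) (h : i + 1 < n)
  | x (h : 0 < n)
  | xinv (h : 0 < n)

section Algebras

variable {R : Type u} [CommRing R]

/-- `(1/r) ∑_{s=0}^{r-1} a^s b^{-s}`, for elements with `a^r = b^r = 1`; here `b^{-s}` is written as
`b^{r-s}`. -/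
def avg (r : ℕ) [Invertible (r : R)] {S : Type u} [Ring S] [Algebra R S] (a b : S) : S :=
  ⅟(r : R) • ∑ s ∈ Finset.range r, a ^ s * b ^ (r - s)

theorem map_avg (r : ℕ) [Invertible (r : R)] {S T : Type u} [Ring S] [Algebra R S] [Ring T]
    [Algebra R T] (f : S →ₐ[R] T) (a b : S) :
    f (avg (R := R) r a b) = avg (R := R) r (f a) (f b) := by
  simp [avg, map_sum, map_mul, map_pow]

variable (R) in
/-- The generators as elements of the free algebra. -/
abbrev FreeGen (n : ℕ) : Gen n → FreeAlgebra R (Gen n) := FreeAlgebra.ι R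

/-- The transposition `s_i`, exchanging `i` and `i + 1`. -/
def swapAt {n : ℕ} (i : ℕ) (h : i + 1 < n) : Equiv.Perm (Fin n) :=
  Equiv.swap ⟨i, Nat.lt_of_succ_lt h⟩ ⟨i + 1, h⟩

open Gen in
/-- The defining relations of the affine Yokonuma-Hecke algebra. -/
inductive AffRel (r n : ℕ) [Invertible (r : R)] (q : Rˣ) :
    FreeAlgebra R (Gen n) → FreeAlgebra R (Gen n) → Prop
  | g_g (i : ℕ) (hi : i + 1 < n) (j : ℕ) (hj : j + 1 < n) (hij : i + 2 ≤ j ∨ j + 2 ≤ i) :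
      AffRel r n q (FreeGen R n (g i hi) * FreeGen R n (g j hj))
        (FreeGen R n (g j hj) * FreeGen R n (g i hi))
  | g_g_g (i : ℕ) (hi : i + 1 < n) (hi' : i + 1 + 1 < n) :
      AffRel r n q
        (FreeGen R n (g i hi) * FreeGen R n (g (i + 1) hi') * FreeGen R n (g i hi))
        (FreeGen R n (g (i + 1) hi') * FreeGen R n (g i hi) * FreeGen R n (g (i + 1) hi'))
  | t_t (i j : Fin n) :
      AffRel r n q (FreeGen R n (t i) * FreeGen R n (t j)) (FreeGen R n (t j) * FreeGen R n (t i))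
  | g_t (i : ℕ) (hi : i + 1 < n) (j : Fin n) :
      AffRel r n q (FreeGen R n (g i hi) * FreeGen R n (t j))
        (FreeGen R n (t (swapAt i hi j)) * FreeGen R n (g i hi))
  | t_pow (i : Fin n) : AffRel r n q (FreeGen R n (t i) ^ r) 1
  | g_sq (i : ℕ) (hi : i + 1 < n) :
      AffRel r n q (FreeGen R n (g i hi) ^ 2)
        (1 + ((q : R) - ((q⁻¹ : Rˣ) : R)) •
          (avg (R := R) r (FreeGen R n (t ⟨i, Nat.lt_of_succ_lt hi⟩)) (FreeGen R n (t ⟨i + 1, hi⟩)) *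
            FreeGen R n (g i hi)))
  | x_xinv (h : 0 < n) : AffRel r n q (FreeGen R n (x h) * FreeGen R n (xinv h)) 1
  | xinv_x (h : 0 < n) : AffRel r n q (FreeGen R n (xinv h) * FreeGen R n (x h)) 1
  | g_x_g_x (h : 0 < n) (h' : 0 + 1 < n) :
      AffRel r n q
        (FreeGen R n (g 0 h') * FreeGen R n (x h) * FreeGen R n (g 0 h') * FreeGen R n (x h))
        (FreeGen R n (x h) * FreeGen R n (g 0 h') * FreeGen R n (x h) * FreeGen R n (g 0 h'))
  | g_x (h : 0 < n) (i : ℕ) (hi : i + 1 < n) (hi' : 1 ≤ i) :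
      AffRel r n q (FreeGen R n (g i hi) * FreeGen R n (x h))
        (FreeGen R n (x h) * FreeGen R n (g i hi))
  | t_x (h : 0 < n) (j : Fin n) :
      AffRel r n q (FreeGen R n (t j) * FreeGen R n (x h)) (FreeGen R n (x h) * FreeGen R n (t j))

/-- The affine Yokonuma-Hecke algebra `Ŷ_{r,n}(q)` over `R`. -/
def Aff (r n : ℕ) [Invertible (r : R)] (q : Rˣ) : Type u := RingQuot (AffRel r n q)

section

variable (r n : ℕ) [Invertible (r : R)] (q : Rˣ)

noncomputable instance : Ring (Aff r n q) := inferInstanceAs (Ring (RingQuot (AffRel r n q)))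

noncomputable instance : Algebra R (Aff r n q) :=
  inferInstanceAs (Algebra R (RingQuot (AffRel r n q)))

/-- The quotient map from the free algebra. -/
noncomputable def Aff.mk : FreeAlgebra R (Gen n) →ₐ[R] Aff r n q :=
  RingQuot.mkAlgHom R (AffRel r n q)

variable {d : ℕ} (v : Fin d → Rˣ)

/-- The element `f_1 = (X_1 - v_1) ⋯ (X_1 - v_d)`. -/
noncomputable def cycPoly (h : 0 < n) : Aff r n q :=
  (List.ofFn fun k : Fin d =>
    Aff.mk r n q (FreeGen R n (Gen.x h)) - algebraMap R (Aff r n q) (v k : R)).prod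

/-- The relation `f_1 = 0`. -/
inductive CycRel : Aff r n q → Aff r n q → Prop
  | mk (h : 0 < n) : CycRel (cycPoly r n q v h) 0

/-- The cyclotomic Yokonuma-Hecke algebra `Y_{r,n}^d(q)` over `R` with parameters `v_1, …, v_d`: the
quotient of the affine one by the two-sided ideal generated by `f_1`. (It is `R` if `n = 0`.) -/
def Cyc : Type u := RingQuot (CycRel r n q v)

noncomputable instance : Ring (Cyc r n q v) := inferInstanceAs (Ring (RingQuot (CycRel r n q v)))

noncomputable instance : Algebra R (Cyc r n q v) :=
  inferInstanceAs (Algebra R (RingQuot (CycRel r n q v)))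

/-- The quotient map from the affine algebra to the cyclotomic one. -/
noncomputable def Cyc.ofAff : Aff r n q →ₐ[R] Cyc r n q v := RingQuot.mkAlgHom R (CycRel r n q v)

/-- The image of a generator in the cyclotomic algebra. -/
noncomputable def Cyc.gen (z : Gen n) : Cyc r n q v :=
  Cyc.ofAff r n q v (Aff.mk r n q (FreeGen R n z))

/-- The elements `X_1` (index `0`) and `X_{k+1} = g_k X_k g_k`. -/
noncomputable def Cyc.X : (k : ℕ) → k < n → Cyc r n q v
  | 0, h => Cyc.gen r n q v (Gen.x h)
  | k + 1, h =>
      Cyc.gen r n q v (Gen.g k h) * Cyc.X k (Nat.lt_of_succ_lt h) * Cyc.gen r n q v (Gen.g k h)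

/-- The inclusion of generators. -/
def Gen.incl {n : ℕ} : Gen n → Gen (n + 1)
  | .t i => .t i.castSucc
  | .g i h => .g i (Nat.lt_succ_of_lt h)
  | .x h => .x (Nat.lt_succ_of_lt h)
  | .xinv h => .xinv (Nat.lt_succ_of_lt h)

theorem castSucc_swapAt {n : ℕ} (i : ℕ) (h : i + 1 < n) (j : Fin n) :
    (swapAt i h j).castSucc = swapAt i (Nat.lt_succ_of_lt h) j.castSucc := by
  simp only [swapAt, Equiv.swap_apply_def, Fin.ext_iff]
  split_ifs <;> simp_all

theorem Aff.mk_rel {a b : FreeAlgebra R (Gen n)} (h : AffRel r n q a b) :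
    Aff.mk r n q a = Aff.mk r n q b := RingQuot.mkAlgHom_rel R h

/-- The algebra map `Ŷ_{r,n} → Ŷ_{r,n+1}` that is the identity on generators. -/
noncomputable def Aff.incl : Aff r n q →ₐ[R] Aff r (n + 1) q :=
  RingQuot.liftAlgHom R
    ⟨(Aff.mk r (n + 1) q).comp (FreeAlgebra.lift R fun z => FreeGen R (n + 1) z.incl), by
      intro a b h
      simp only [AlgHom.comp_apply]
      cases h with
      | g_g i hi j hj hij =>
        simpa [Gen.incl] using Aff.mk_rel r (n + 1) q (.g_g i (by omega) j (by omega) hij)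
      | g_g_g i hi hi' =>
        simpa [Gen.incl] using Aff.mk_rel r (n + 1) q (.g_g_g i (by omega) (by omega))
      | t_t i j => simpa [Gen.incl] using Aff.mk_rel r (n + 1) q (.t_t i.castSucc j.castSucc)
      | g_t i hi j =>
        simpa [Gen.incl, castSucc_swapAt] using
          Aff.mk_rel r (n + 1) q (.g_t i (by omega) j.castSucc)
      | t_pow i => simpa [Gen.incl] using Aff.mk_rel r (n + 1) q (.t_pow i.castSucc)
      | g_sq i hi =>
        simpa [Gen.incl, map_avg] using Aff.mk_rel r (n + 1) q (.g_sq i (by omega))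
      | x_xinv h => simpa [Gen.incl] using Aff.mk_rel r (n + 1) q (.x_xinv (by omega))
      | xinv_x h => simpa [Gen.incl] using Aff.mk_rel r (n + 1) q (.xinv_x (by omega))
      | g_x_g_x h h' =>
        simpa [Gen.incl] using Aff.mk_rel r (n + 1) q (.g_x_g_x (by omega) (by omega))
      | g_x h i hi hi' =>
        simpa [Gen.incl] using Aff.mk_rel r (n + 1) q (.g_x (by omega) i (by omega) hi')
      | t_x h j => simpa [Gen.incl] using Aff.mk_rel r (n + 1) q (.t_x (by omega) j.castSucc)⟩

theorem Aff.incl_gen (z : Gen n) :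
    Aff.incl r n q (Aff.mk r n q (FreeGen R n z)) =
      Aff.mk r (n + 1) q (FreeGen R (n + 1) z.incl) := by
  refine (RingQuot.liftAlgHom_mkAlgHom_apply _ _ _ _).trans ?_
  simp

/-- The algebra map `Y_{r,n}^d → Y_{r,n+1}^d` that is the identity on generators. -/
noncomputable def Cyc.incl : Cyc r n q v →ₐ[R] Cyc r (n + 1) q v :=
  RingQuot.liftAlgHom R
    ⟨(Cyc.ofAff r (n + 1) q v).comp (Aff.incl r n q), by
      rintro _ _ ⟨h⟩
      have h1 : Aff.incl r n q (cycPoly r n q v h) =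
          cycPoly r (n + 1) q v (Nat.lt_succ_of_lt h) := by
        simp only [cycPoly, map_list_prod, List.map_ofFn]
        congr 2
        funext k
        simp only [Function.comp_apply, map_sub, AlgHom.commutes, Aff.incl_gen, Gen.incl]
      rw [AlgHom.comp_apply, AlgHom.comp_apply, h1, map_zero, map_zero]
      exact (RingQuot.mkAlgHom_rel R (CycRel.mk (Nat.lt_succ_of_lt h))).trans (map_zero _)⟩

theorem Cyc.incl_gen (z : Gen n) :
    Cyc.incl r n q v (Cyc.gen r n q v z) = Cyc.gen r (n + 1) q v z.incl := by
  refine (RingQuot.liftAlgHom_mkAlgHom_apply _ _ _ _).trans ?_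
  simp only [AlgHom.comp_apply, Aff.incl_gen]
  rfl

/-- `Cyc.incl` as a ring homomorphism; it makes `Y_{r,n+1}^d` a bimodule over `Y_{r,n}^d`. -/
noncomputable def Cyc.inclHom : Cyc r n q v →+* Cyc r (n + 1) q v := (Cyc.incl r n q v : _ →+* _)

/-- The element `X_{n+1}` of `Y_{r,n+1}^d`. -/
noncomputable def Cyc.lastX : Cyc r (n + 1) q v := Cyc.X r (n + 1) q v n (Nat.lt_succ_self n)

/-- The element `t_{n+1}` of `Y_{r,n+1}^d`. -/
noncomputable def Cyc.lastT : Cyc r (n + 1) q v := Cyc.gen r (n + 1) q v (.t (Fin.last n))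

/-- `θ` is the `(Y, Y)`-bimodule projection of `Y' = Y_{r,n+1}^d` onto `Y = Y_{r,n}^d` that kills
the summands `X_{n+1}^a t_{n+1}^b Y` (`0 ≤ a < d`, `0 ≤ b < r`, `(a, b) ≠ (0, 0)`) and
`Y g_n Y` (the latter being present only if `1 ≤ n`). -/
structure IsFirstProjection (θ : Cyc r (n + 1) q v →ₗ[R] Cyc r n q v) : Prop where
  map_left_right (a b : Cyc r n q v) (y : Cyc r (n + 1) q v) :
    θ (Cyc.incl r n q v a * y * Cyc.incl r n q v b) = a * θ y * b
  map_incl (y : Cyc r n q v) : θ (Cyc.incl r n q v y) = y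
  map_X_t (a b : ℕ) (ha : a < d) (hb : b < r) (hab : (a, b) ≠ (0, 0)) (y : Cyc r n q v) :
    θ (Cyc.lastX r n q v ^ a * Cyc.lastT r n q v ^ b * Cyc.incl r n q v y) = 0
  map_g (i : ℕ) (hi : i + 1 = n) (y z : Cyc r n q v) :
    θ (Cyc.incl r n q v y * Cyc.gen r (n + 1) q v (.g i (by omega)) * Cyc.incl r n q v z) = 0

end

end Algebras

end YokonumaHecke

/-!
Write `Y_n` for `Y_{r,n}^d`, `ι : Y_n → Y_{n+1}` for the map of the statement, and `g`, `X`, `t`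
for the last generators of `Y_{n+1}` and its last Jucys-Murphy element. The theorem says that
`Y_{n+1}` is a Frobenius extension of `Y_n`, and this is what is proved: there are a bimodule map
`θ : Y_{n+1} → Y_n` and finite families `x_i`, `y_i` (dual bases) with
`∑ x_i ι(θ(y_i z)) = z = ∑ ι(θ(z x_i)) y_i` for all `z` (`Cyc.exists_frobeniusForm`). Then
`f ↦ ∑ x_i ⊗ f(y_i)` is inverse to the map from induction to coinduction (`Ind.equivCoind`), and a
left ideal in the kernel of `θ` is zero by the first identity.

The form is constructed by induction on `n`. For `n = 0` the algebra `Y_1` maps onto a quotient of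
a polynomial ring in two variables, and `θ` is the constant coefficient of remainders
(`Cyc.exists_functional`). In general, `Y_{n+1}` is spanned by the `X^a t^b ι(y)` with `a < d` and
the `ι(y) g ι(z)` (`Cyc.span_spanSet`). That nothing more collapses, so that a coefficient of `1`
makes sense, is shown without a basis theorem: with `A = Y_n` and `B = Y_{n-1}`, the bimodule
`Q = A ⊗_B A ⊕ A^{dr}` (`ExtModel`) is made into a left `Y_{n+1}`-module. Since `A` is a Frobenius
extension of `B`, the first summand can be taken to be the endomorphisms of the right `B`-module
`A` (`RightEnd`). The operator `G` of left multiplication by `g` (`ExtOp`) is determined by the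
elements that stand for `g a g` with `a ∈ A`, which exist by the universal property of `A` as a
`B`-bimodule; this property is carried along in the induction (`Cyc.FrobeniusForm`). The relations
of `G`, namely `ExtOp.G_mul_G`, `ExtOp.reflection` and `ExtOp.braid`, all follow the same pattern:
the defect `P` of the relation satisfies `P f = f' P` for enough operators `f`, with suitable `f'`,
so that its kernel is stable under them, and the kernel contains generators of `Q`. By the
presentation of `Y_{n+1}` (`Cyc.exists_extend`, `Cyc.exists_action`) it then acts on `Q`, and
`θ(y)` is the coefficient of `1` in `y · 1`.

Dual bases for `θ` are `x_i g` and `g y_i`, where `x_i`, `y_i` are dual bases for `Y_n` over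
`Y_{n-1}`, together with the monomials `X^a t^b`, whose Gram matrix is triangular after a
permutation of its rows, with diagonal entries `1` and `± v_1 ⋯ v_d` (`FormOnPowers.exists_dual`).
This is where the invertibility of the `v_i` enters.
-/

namespace YokonumaHecke

/-! ### Averages of powers of two elements -/

section Avg

variable {R : Type u} [CommRing R] {r : ℕ} [Invertible (r : R)] {S : Type u} [Ring S] [Algebra R S]

theorem mul_avg_of_semiconj {g a a' b b' : S} (ha : g * a = a' * g) (hb : g * b = b' * g) :
    g * avg (R := R) r a b = avg (R := R) r a' b' * g := by
  have h : ∀ s, g * (a ^ s * b ^ (r - s)) = (a' ^ s * b' ^ (r - s)) * g := fun s =>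
    (SemiconjBy.mul_right (SemiconjBy.pow_right ha s) (SemiconjBy.pow_right hb (r - s)) :)
  simp only [avg, mul_smul_comm, smul_mul_assoc, Finset.mul_sum, Finset.sum_mul, h]

theorem Commute.avg_right {g a b : S} (ha : Commute g a) (hb : Commute g b) :
    Commute g (avg (R := R) r a b) :=
  mul_avg_of_semiconj ha hb

/-- Both sums consist of the same terms, shifted by one; the boundary terms agree since
`a^r = b^r`. -/
theorem avg_mul_left_eq_mul_right {a b : S} (h : Commute a b) (ha : a ^ r = 1) (hb : b ^ r = 1) :
    avg (R := R) r a b * a = avg (R := R) r a b * b := by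
  have h1 : ∑ s ∈ Finset.range r, a ^ s * b ^ (r - s) * a
      = ∑ s ∈ Finset.range r, a ^ s * b ^ (r - s) * b := by
    let f : ℕ → S := fun s => a ^ s * b ^ (r + 1 - s)
    have hf : ∑ s ∈ Finset.range r, f (s + 1) + f 0 = ∑ s ∈ Finset.range r, f s + f r := by
      rw [← Finset.sum_range_succ' f, Finset.sum_range_succ]
    have h0 : f 0 = f r := by simp [f, ha, pow_succ, hb]
    rw [h0, add_left_inj] at hf
    refine (Finset.sum_congr rfl fun s _ => ?_).trans
      (hf.trans (Finset.sum_congr rfl fun s hs => ?_))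
    · simp only [f, Nat.add_sub_add_right]
      rw [mul_assoc, ← (h.pow_right (r - s)).eq, ← mul_assoc, ← pow_succ]
    · have : s < r := Finset.mem_range.1 hs
      simp only [f]
      rw [mul_assoc, ← pow_succ, Nat.succ_sub this.le]
  simp only [avg, smul_mul_assoc, Finset.sum_mul, h1]

theorem avg_symm {a b : S} (h : Commute a b) (ha : a ^ r = 1) (hb : b ^ r = 1) :
    avg (R := R) r a b = avg (R := R) r b a := by
  have h1 : ∑ s ∈ Finset.range r, a ^ s * b ^ (r - s)
      = ∑ s ∈ Finset.range r, b ^ s * a ^ (r - s) := by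
    let f : ℕ → S := fun s => a ^ s * b ^ (r - s)
    have hf : ∑ s ∈ Finset.range r, f (s + 1) + f 0 = ∑ s ∈ Finset.range r, f s + f r := by
      rw [← Finset.sum_range_succ' f, Finset.sum_range_succ]
    have h0 : f 0 = f r := by simp [f, ha, hb]
    rw [h0, add_left_inj] at hf
    refine hf.symm.trans ?_
    rw [← Finset.sum_range_reflect]
    refine Finset.sum_congr rfl fun s hs => ?_
    have : s < r := Finset.mem_range.1 hs
    simp only [f]
    rw [show r - 1 - s + 1 = r - s by omega, show r - (r - s) = s by omega,
      (h.pow_pow _ _).eq]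
  simp only [avg, h1]

theorem avg_mul_pow {a b : S} (h : Commute a b) (ha : a ^ r = 1) (hb : b ^ r = 1) (k : ℕ) :
    avg (R := R) r a b * b ^ k = avg (R := R) r a b * a ^ k := by
  induction k with
  | zero => simp
  | succ k ih =>
    have h1 : Commute b (a ^ k) := (h.symm.pow_right k)
    rw [pow_succ, ← mul_assoc, ih, mul_assoc, ← h1.eq, ← mul_assoc,
      ← avg_mul_left_eq_mul_right h ha hb, mul_assoc, ← pow_succ']

/-- In terms of the idempotents `e_{ij}` attached to pairs of indices:
`e_{ab} e_{bc} = e_{ab} e_{ac}`. -/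
theorem avg_mul_avg {a b c : S} (h : Commute a b) (ha : a ^ r = 1) (hb : b ^ r = 1) :
    avg (R := R) r a b * avg (R := R) r b c = avg (R := R) r a b * avg (R := R) r a c := by
  have h1 (x : S) : avg (R := R) r a b * avg (R := R) r x c =
      ⅟(r : R) • ∑ s ∈ Finset.range r, avg (R := R) r a b * x ^ s * c ^ (r - s) := by
    rw [avg, avg, mul_smul_comm, Finset.mul_sum]
    simp only [mul_assoc]
  simp only [h1, avg_mul_pow h ha hb]

end Avg

/-! ### Relations and universal property of the cyclotomic algebra -/

namespace Cyc

variable {R : Type u} [CommRing R] {r n d : ℕ} [Invertible (r : R)] {q : Rˣ} {v : Fin d → Rˣ}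

theorem rel {a b : FreeAlgebra R (Gen n)} (h : AffRel r n q a b) :
    ofAff r n q v (Aff.mk r n q a) = ofAff r n q v (Aff.mk r n q b) :=
  congrArg _ (Aff.mk_rel r n q h)

theorem ofAff_mk_ι (z : Gen n) :
    ofAff r n q v (Aff.mk r n q (FreeAlgebra.ι R z)) = gen r n q v z := rfl

theorem mk_surjective : Function.Surjective ((ofAff r n q v).comp (Aff.mk r n q)) :=
  (RingQuot.mkAlgHom_surjective R (CycRel r n q v)).comp
    (RingQuot.mkAlgHom_surjective R (AffRel r n q))

@[elab_as_elim]
theorem induction {motive : Cyc r n q v → Prop} (hc : ∀ c, motive (algebraMap R _ c))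
    (hg : ∀ z, motive (gen r n q v z)) (hm : ∀ a b, motive a → motive b → motive (a * b))
    (ha : ∀ a b, motive a → motive b → motive (a + b)) (y : Cyc r n q v) : motive y := by
  obtain ⟨y, rfl⟩ := mk_surjective y
  induction y using FreeAlgebra.induction with
  | grade0 c => rw [AlgHom.commutes]; exact hc c
  | grade1 z => exact hg z
  | mul a b h1 h2 => rw [map_mul]; exact hm _ _ h1 h2
  | add a b h1 h2 => rw [map_add]; exact ha _ _ h1 h2

/-- A submodule containing `1` and stable under left multiplication by the generators is
everything. -/
theorem eq_top_of_gen_mul_mem (S : Submodule R (Cyc r n q v)) (h1 : 1 ∈ S)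
    (hg : ∀ z, ∀ y ∈ S, gen r n q v z * y ∈ S) : S = ⊤ := by
  have key : ∀ a : Cyc r n q v, ∀ y ∈ S, a * y ∈ S := by
    intro a
    induction a using induction with
    | hc c => intro y hy; rw [← Algebra.smul_def]; exact S.smul_mem c hy
    | hg z => exact hg z
    | hm a b iha ihb => intro y hy; rw [mul_assoc]; exact iha _ (ihb y hy)
    | ha a b iha ihb => intro y hy; rw [add_mul]; exact S.add_mem (iha y hy) (ihb y hy)
  exact eq_top_iff.2 fun y _ => by simpa using key y 1 h1

theorem commute_of_gen {S : Type*} [Ring S] [Algebra R S] (f : Cyc r n q v →ₐ[R] S) (s : S)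
    (h : ∀ z, Commute s (f (gen r n q v z))) (y : Cyc r n q v) : Commute s (f y) := by
  induction y using induction with
  | hc c => rw [AlgHom.commutes]; exact (Algebra.commutes c s).symm
  | hg z => exact h z
  | hm a b iha ihb => rw [map_mul]; exact iha.mul_right ihb
  | ha a b iha ihb => rw [map_add]; exact iha.add_right ihb

theorem algHom_ext {S : Type*} [Ring S] [Algebra R S] {f g : Cyc r n q v →ₐ[R] S}
    (h : ∀ z, f (gen r n q v z) = g (gen r n q v z)) : f = g := by
  ext y
  induction y using induction with
  | hc c => simp
  | hg z => exact h z
  | hm a b iha ihb => simp [iha, ihb]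
  | ha a b iha ihb => simp [iha, ihb]

theorem gen_g_g (i : ℕ) (hi : i + 1 < n) (j : ℕ) (hj : j + 1 < n) (hij : i + 2 ≤ j ∨ j + 2 ≤ i) :
    Commute (gen r n q v (.g i hi)) (gen r n q v (.g j hj)) := by
  simpa [ofAff_mk_ι, commute_iff_eq] using rel (v := v) (AffRel.g_g (q := q) i hi j hj hij)

theorem gen_braid (i : ℕ) (hi : i + 1 < n) (hi' : i + 1 + 1 < n) :
    gen r n q v (.g i hi) * gen r n q v (.g (i + 1) hi') * gen r n q v (.g i hi)
      = gen r n q v (.g (i + 1) hi') * gen r n q v (.g i hi) * gen r n q v (.g (i + 1) hi') := by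
  simpa [ofAff_mk_ι] using rel (v := v) (AffRel.g_g_g (q := q) i hi hi')

theorem gen_t_t (i j : Fin n) : Commute (gen r n q v (.t i)) (gen r n q v (.t j)) := by
  simpa [ofAff_mk_ι, commute_iff_eq] using rel (v := v) (AffRel.t_t (q := q) i j)

theorem gen_g_t (i : ℕ) (hi : i + 1 < n) (j : Fin n) :
    gen r n q v (.g i hi) * gen r n q v (.t j)
      = gen r n q v (.t (swapAt i hi j)) * gen r n q v (.g i hi) := by
  simpa [ofAff_mk_ι] using rel (v := v) (AffRel.g_t (q := q) i hi j)

theorem gen_t_pow (i : Fin n) : gen r n q v (.t i) ^ r = 1 := by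
  simpa [ofAff_mk_ι] using rel (v := v) (AffRel.t_pow (q := q) i)

theorem gen_g_sq (i : ℕ) (hi : i + 1 < n) :
    gen r n q v (.g i hi) * gen r n q v (.g i hi)
      = 1 + ((q : R) - ((q⁻¹ : Rˣ) : R)) • (avg (R := R) r (gen r n q v (.t ⟨i, by omega⟩))
          (gen r n q v (.t ⟨i + 1, hi⟩)) * gen r n q v (.g i hi)) := by
  simpa [ofAff_mk_ι, map_avg, pow_two] using rel (v := v) (AffRel.g_sq (q := q) i hi)

theorem gen_x_xinv (h : 0 < n) : gen r n q v (.x h) * gen r n q v (.xinv h) = 1 := by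
  simpa [ofAff_mk_ι] using rel (v := v) (AffRel.x_xinv (q := q) h)

theorem gen_xinv_x (h : 0 < n) : gen r n q v (.xinv h) * gen r n q v (.x h) = 1 := by
  simpa [ofAff_mk_ι] using rel (v := v) (AffRel.xinv_x (q := q) h)

theorem gen_g_x_g_x (h : 0 < n) (h' : 0 + 1 < n) :
    gen r n q v (.g 0 h') * gen r n q v (.x h) * gen r n q v (.g 0 h') * gen r n q v (.x h)
      = gen r n q v (.x h) * gen r n q v (.g 0 h') * gen r n q v (.x h) *
        gen r n q v (.g 0 h') := by
  simpa [ofAff_mk_ι] using rel (v := v) (AffRel.g_x_g_x (q := q) h h')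

theorem gen_g_x (h : 0 < n) (i : ℕ) (hi : i + 1 < n) (hi' : 1 ≤ i) :
    Commute (gen r n q v (.g i hi)) (gen r n q v (.x h)) := by
  simpa [ofAff_mk_ι, commute_iff_eq] using rel (v := v) (AffRel.g_x (q := q) h i hi hi')

theorem gen_t_x (h : 0 < n) (j : Fin n) :
    Commute (gen r n q v (.t j)) (gen r n q v (.x h)) := by
  simpa [ofAff_mk_ι, commute_iff_eq] using rel (v := v) (AffRel.t_x (q := q) h j)

theorem commute_xinv {h : 0 < n} {y : Cyc r n q v} (hy : Commute y (gen r n q v (.x h))) :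
    Commute y (gen r n q v (.xinv h)) :=
  Commute.units_inv_right (u := ⟨_, _, gen_x_xinv h, gen_xinv_x h⟩) hy

theorem prod_x_sub (h : 0 < n) :
    (List.ofFn fun k : Fin d => gen r n q v (.x h) - algebraMap R _ (v k : R)).prod = 0 := by
  have := RingQuot.mkAlgHom_rel R (CycRel.mk (r := r) (n := n) (q := q) (v := v) h)
  rw [map_zero, cycPoly, map_list_prod, List.map_ofFn] at this
  refine Eq.trans ?_ this
  congr 2
  funext k
  simp only [Function.comp_apply, map_sub, AlgHom.commutes]
  rfl

/-- The universal property of the cyclotomic algebra. -/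
theorem exists_lift {S : Type*} [Ring S] [Algebra R S] (f : Gen n → S)
    (hrel : ∀ a b, AffRel r n q a b → FreeAlgebra.lift R f a = FreeAlgebra.lift R f b)
    (hcyc : ∀ h : 0 < n,
      (List.ofFn fun k : Fin d => f (.x h) - algebraMap R S (v k : R)).prod = 0) :
    ∃ F : Cyc r n q v →ₐ[R] S, ∀ z, F (gen r n q v z) = f z := by
  let f₁ : Aff r n q →ₐ[R] S := RingQuot.liftAlgHom R ⟨FreeAlgebra.lift R f, fun {a b} => hrel a b⟩
  have h₁ : ∀ z, f₁ (Aff.mk r n q (FreeGen R n z)) = f z := fun z =>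
    (RingQuot.liftAlgHom_mkAlgHom_apply _ _ _ _).trans (by simp)
  refine ⟨RingQuot.liftAlgHom R ⟨f₁, ?_⟩, fun z => ?_⟩
  · rintro _ _ ⟨h⟩
    rw [map_zero, cycPoly, map_list_prod, List.map_ofFn, ← hcyc h]
    congr 2
    funext k
    simp only [Function.comp_apply, map_sub, AlgHom.commutes, h₁]
  · exact (RingQuot.liftAlgHom_mkAlgHom_apply _ _ _ _).trans (h₁ z)

end Cyc

/-! ### The last generators and the Jucys-Murphy elements -/

/-- A generator of `Y_{r,m+1}^d` comes from `Y_{r,m}^d`, or is the last `t` or `g`, or `m = 0` and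
it is `X_1` or its inverse. -/
theorem Gen.eq_incl_or_last {m : ℕ} (z : Gen (m + 1)) :
    (∃ w : Gen m, z = w.incl) ∨ z = .t (Fin.last m) ∨
      (∃ i, ∃ hi : i + 1 = m, z = .g i (by omega)) ∨
      (m = 0 ∧ (z = .x (by omega) ∨ z = .xinv (by omega))) := by
  cases z with
  | t i =>
    rcases Fin.eq_castSucc_or_eq_last i with ⟨j, rfl⟩ | rfl
    · exact .inl ⟨.t j, rfl⟩
    · exact .inr (.inl rfl)
  | g i h =>
    by_cases hi : i + 1 = m
    · exact .inr (.inr (.inl ⟨i, hi, rfl⟩))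
    · exact .inl ⟨.g i (by omega), rfl⟩
  | x h =>
    by_cases hm : m = 0
    · exact .inr (.inr (.inr ⟨hm, .inl rfl⟩))
    · exact .inl ⟨.x (by omega), rfl⟩
  | xinv h =>
    by_cases hm : m = 0
    · exact .inr (.inr (.inr ⟨hm, .inr rfl⟩))
    · exact .inl ⟨.xinv (by omega), rfl⟩

theorem swapAt_of_ne {n i : ℕ} (h : i + 1 < n) {j : Fin n} (h1 : (j : ℕ) ≠ i)
    (h2 : (j : ℕ) ≠ i + 1) : swapAt i h j = j :=
  Equiv.swap_apply_of_ne_of_ne (fun hj => h1 (congrArg Fin.val hj))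
    (fun hj => h2 (congrArg Fin.val hj))

theorem Gen.elim_zero (z : Gen 0) : False := by
  cases z with
  | t i => exact i.elim0
  | g i h => omega
  | x h => omega
  | xinv h => omega

namespace Cyc

variable {R : Type u} [CommRing R] {d : ℕ}

/-- The generator `g_{m+1}` of `Y_{r,m+2}^d`, the one that is not in the image of `Y_{r,m+1}^d`. -/
noncomputable def lastG (r m : ℕ) [Invertible (r : R)] (q : Rˣ) (v : Fin d → Rˣ) :
    Cyc r (m + 1 + 1) q v :=
  gen r (m + 1 + 1) q v (.g m (by omega))

variable {r m : ℕ} [Invertible (r : R)] {q : Rˣ} {v : Fin d → Rˣ}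

theorem incl_X (k : ℕ) (h : k < m) :
    incl r m q v (X r m q v k h) = X r (m + 1) q v k (by omega) := by
  induction k with
  | zero => simp [X, incl_gen, Gen.incl]
  | succ k ih => simp [X, incl_gen, ih (by omega), Gen.incl]

theorem lastX_zero : lastX r 0 q v = gen r 1 q v (.x one_pos) := rfl

theorem lastX_succ : lastX r (m + 1) q v
    = lastG r m q v * incl r (m + 1) q v (lastX r m q v) * lastG r m q v := by
  rw [lastX, X, lastX, incl_X]; rfl

theorem incl_lastT : incl r (m + 1) q v (lastT r m q v)
    = gen r (m + 1 + 1) q v (.t (Fin.last m).castSucc) := incl_gen ..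

theorem lastG_mul_incl_lastT : lastG r m q v * incl r (m + 1) q v (lastT r m q v)
    = lastT r (m + 1) q v * lastG r m q v := by
  rw [incl_lastT, lastG, gen_g_t, lastT]
  congr 3
  simp [swapAt, Equiv.swap_apply_def, Fin.ext_iff]

theorem lastG_mul_lastT : lastG r m q v * lastT r (m + 1) q v
    = incl r (m + 1) q v (lastT r m q v) * lastG r m q v := by
  rw [incl_lastT, lastG, lastT, gen_g_t]
  congr 3
  simp [swapAt, Equiv.swap_apply_def, Fin.ext_iff]

theorem lastG_mul_self : lastG r m q v * lastG r m q v
    = 1 + ((q : R) - ((q⁻¹ : Rˣ) : R)) • (avg (R := R) r (incl r (m + 1) q v (lastT r m q v))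
        (lastT r (m + 1) q v) * lastG r m q v) := by
  rw [incl_lastT, lastG, gen_g_sq, lastT]; rfl

theorem lastT_pow : lastT r m q v ^ r = 1 := gen_t_pow _

/-- The generator `g_{m+1}` centralizes `Y_{r,m}^d`. -/
theorem commute_lastG_incl_incl (y : Cyc r m q v) :
    Commute (lastG r m q v) (incl r (m + 1) q v (incl r m q v y)) := by
  refine commute_of_gen ((incl r (m + 1) q v).comp (incl r m q v)) _ (fun z => ?_) y
  rw [AlgHom.comp_apply, incl_gen, incl_gen]
  cases z with
  | t i =>
    rw [lastG, commute_iff_eq]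
    simp only [Gen.incl]
    have := i.2
    rw [gen_g_t, swapAt_of_ne _ (by simp; omega) (by simp; omega)]
  | g i h => exact gen_g_g _ _ _ _ (.inr (by omega))
  | x h => exact gen_g_x _ _ _ h
  | xinv h => exact commute_xinv (gen_g_x _ _ _ h)

theorem lastG_braid : lastG r (m + 1) q v * incl r (m + 1 + 1) q v (lastG r m q v) *
      lastG r (m + 1) q v
    = incl r (m + 1 + 1) q v (lastG r m q v) * lastG r (m + 1) q v *
      incl r (m + 1 + 1) q v (lastG r m q v) := by
  have h : incl r (m + 1 + 1) q v (lastG r m q v) = gen r (m + 1 + 1 + 1) q v (.g m (by omega)) :=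
    incl_gen ..
  rw [h]
  exact (gen_braid m (by omega) (by omega)).symm

/-- The reflection equation between `g_1` and `X_1`. -/
theorem lastG_reflection : lastG r 0 q v * incl r 1 q v (lastX r 0 q v) * lastG r 0 q v *
      incl r 1 q v (lastX r 0 q v)
    = incl r 1 q v (lastX r 0 q v) * lastG r 0 q v * incl r 1 q v (lastX r 0 q v) *
      lastG r 0 q v := by
  have h : incl r 1 q v (lastX r 0 q v) = gen r 2 q v (.x (by omega)) := incl_gen ..
  rw [h]
  exact gen_g_x_g_x _ _

theorem commute_lastT_incl (y : Cyc r m q v) :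
    Commute (lastT r m q v) (incl r m q v y) := by
  refine commute_of_gen (incl r m q v) _ (fun z => ?_) y
  rw [incl_gen]
  cases z with
  | t i => exact gen_t_t _ _
  | g i h =>
    simp only [Gen.incl]
    rw [lastT, commute_iff_eq, gen_g_t, swapAt_of_ne _ (by simp; omega) (by simp; omega)]
  | x h => exact gen_t_x _ _
  | xinv h => exact commute_xinv (gen_t_x _ _)

theorem commute_lastT_lastX : Commute (lastT r m q v) (lastX r m q v) := by
  induction m with
  | zero => exact gen_t_x _ _
  | succ m ih =>
    rw [lastX_succ, commute_iff_eq, ← mul_assoc, ← mul_assoc, ← lastG_mul_incl_lastT,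
      mul_assoc (lastG r m q v), ← map_mul, ih.eq, map_mul,
      mul_assoc, mul_assoc, ← lastG_mul_lastT]
    simp only [mul_assoc]

/-- The Jucys-Murphy element `X_{m+1}` centralizes `Y_{r,m}^d`. -/
theorem commute_lastX_incl (y : Cyc r m q v) :
    Commute (lastX r m q v) (incl r m q v y) := by
  induction m with
  | zero => exact commute_of_gen (incl r 0 q v) _ (fun z => z.elim_zero.elim) y
  | succ m ih =>
    have hlow (b : Cyc r m q v) :
        Commute (lastX r (m + 1) q v) (incl r (m + 1) q v (incl r m q v b)) := by
      rw [lastX_succ]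
      exact ((commute_lastG_incl_incl b).mul_left ((ih b).map (incl r (m + 1) q v))).mul_left
        (commute_lastG_incl_incl b)
    refine commute_of_gen (incl r (m + 1) q v) _ (fun z => ?_) y
    rcases z.eq_incl_or_last with ⟨w, rfl⟩ | rfl | ⟨i, rfl, rfl⟩ | ⟨rfl, h⟩
    · rw [← incl_gen]; exact hlow _
    · change Commute _ (incl r (m + 1) q v (lastT r m q v))
      rw [lastX_succ, commute_iff_eq, mul_assoc, lastG_mul_incl_lastT, mul_assoc,
        ← mul_assoc _ _ (lastG r m q v), ← (commute_lastT_incl _).eq, mul_assoc, ← mul_assoc,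
          lastG_mul_lastT]
      simp only [mul_assoc]
    · change Commute _ (incl r (i + 1 + 1) q v (lastG r i q v))
      rw [lastX_succ, lastX_succ]
      simp only [map_mul]
      set g := lastG r (i + 1) q v
      set h := incl r (i + 1 + 1) q v (lastG r i q v)
      set x := incl r (i + 1 + 1) q v (incl r (i + 1) q v (lastX r i q v))
      have hb : g * h * g = h * g * h := lastG_braid
      have hc : g * x = x * g := (commute_lastG_incl_incl _).eq
      calc g * (h * x * h) * g * h = g * h * x * (h * g * h) := by simp only [mul_assoc]
        _ = g * h * (x * g) * h * g := by rw [← hb]; simp only [mul_assoc]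
        _ = (g * h * g) * x * h * g := by rw [← hc]; simp only [mul_assoc]
        _ = h * (g * (h * x * h) * g) := by rw [hb]; simp only [mul_assoc]
    · have hx : Commute (lastX r 1 q v) (gen r 2 q v (.x (by omega))) := by
        have h0 := lastG_reflection (r := r) (q := q) (v := v)
        have h1 : incl r 1 q v (lastX r 0 q v) = gen r 2 q v (.x (by omega)) := incl_gen ..
        rw [lastX_succ, commute_iff_eq, ← h1]
        rw [h0]; simp only [mul_assoc]
      rcases h with rfl | rfl
      · rw [incl_gen]; exact hx
      · rw [incl_gen]; exact commute_xinv hx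

end Cyc

/-! ### The polynomial annihilating the first Jucys-Murphy element -/

section

open Polynomial

variable {R : Type u} [CommRing R] {d : ℕ}

/-- The polynomial `(X - v_1) ⋯ (X - v_d)`. -/
noncomputable def paramPoly (v : Fin d → Rˣ) : R[X] := ∏ k, (X - C (v k : R))

theorem paramPoly_monic (v : Fin d → Rˣ) : (paramPoly v).Monic :=
  monic_prod_of_monic _ _ fun _ _ => monic_X_sub_C _

theorem natDegree_paramPoly [Nontrivial R] (v : Fin d → Rˣ) : (paramPoly v).natDegree = d := by
  rw [paramPoly, natDegree_prod_of_monic _ _ fun _ _ => monic_X_sub_C _]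
  simp

theorem paramPoly_coeff_zero (v : Fin d → Rˣ) :
    IsUnit ((paramPoly v).coeff 0) := by
  rw [coeff_zero_eq_eval_zero, paramPoly, eval_prod, IsUnit.prod_univ_iff]
  intro k
  simp

theorem aeval_paramPoly (v : Fin d → Rˣ) {S : Type*} [Ring S] [Algebra R S] (x : S) :
    aeval x (paramPoly v) = (List.ofFn fun k : Fin d => x - algebraMap R S (v k : R)).prod := by
  rw [paramPoly, ← List.prod_ofFn, map_list_prod, List.map_ofFn]
  congr 2
  funext k
  simp

end

namespace Cyc

variable {R : Type u} [CommRing R] {d r m : ℕ} [Invertible (r : R)] {q : Rˣ} {v : Fin d → Rˣ}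

open Polynomial in
theorem aeval_lastX_zero : aeval (lastX r 0 q v) (paramPoly v) = 0 := by
  rw [aeval_paramPoly]; exact prod_x_sub one_pos

open Polynomial in
/-- The power `X_1^d` is a combination of lower powers. -/
theorem lastX_zero_pow_mem (S : Submodule R (Cyc r 1 q v)) (y : Cyc r 1 q v)
    (h : ∀ a < d, lastX r 0 q v ^ a * y ∈ S) : lastX r 0 q v ^ d * y ∈ S := by
  rcases subsingleton_or_nontrivial R with _ | _
  · have := Module.subsingleton R (Cyc r 1 q v)
    rw [Subsingleton.elim (_ * _) 0]
    exact S.zero_mem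
  have h0 := aeval_lastX_zero (r := r) (q := q) (v := v)
  rw [aeval_eq_sum_range, natDegree_paramPoly, Finset.sum_range_succ] at h0
  have h1 : (paramPoly v).coeff d = 1 := by
    have := (paramPoly_monic v).coeff_natDegree
    rwa [natDegree_paramPoly] at this
  rw [h1, one_smul] at h0
  rw [eq_neg_of_add_eq_zero_right h0, neg_mul, Finset.sum_mul]
  refine S.neg_mem (S.sum_mem fun a ha => ?_)
  rw [smul_mul_assoc]
  exact S.smul_mem _ (h a (Finset.mem_range.1 ha))

open Polynomial in
/-- The inverse of `X_1` is a polynomial in `X_1`, as `v_1 ⋯ v_d` is invertible. -/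
theorem exists_aeval_eq_xinv :
    ∃ p : R[X], aeval (lastX r 0 q v) p = gen r 1 q v (.xinv one_pos) := by
  obtain ⟨c, hc⟩ := paramPoly_coeff_zero v
  refine ⟨C (-(c⁻¹ : Rˣ) : R) * (paramPoly v).divX, ?_⟩
  have h0 := aeval_lastX_zero (r := r) (q := q) (v := v)
  have h1 := gen_x_xinv (r := r) (q := q) (v := v) one_pos
  rw [← divX_mul_X_add (paramPoly v), map_add, map_mul, aeval_X, aeval_C, ← hc] at h0
  have h2 := congrArg (· * gen r 1 q v (.xinv one_pos)) h0
  simp only [add_mul, mul_assoc, zero_mul] at h2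
  rw [lastX_zero, h1, mul_one] at h2
  rw [map_mul, aeval_C, lastX_zero, eq_neg_of_add_eq_zero_left h2, map_neg, neg_mul_neg,
    ← mul_assoc, ← map_mul, Units.inv_mul, map_one, one_mul]

/-! ### A spanning set of the next algebra -/

/-- The spanning set `X_{n+1}^a t_{n+1}^b y`, `y g_n z` of `Y_{r,n+1}^d`. -/
def spanSet (r n : ℕ) [Invertible (r : R)] (q : Rˣ) (v : Fin d → Rˣ) : Set (Cyc r (n + 1) q v) :=
  {w | (∃ a < d, ∃ b y, w = lastX r n q v ^ a * lastT r n q v ^ b * incl r n q v y) ∨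
    ∃ i, ∃ hi : i + 1 = n, ∃ y z,
      w = incl r n q v y * gen r (n + 1) q v (.g i (by omega)) * incl r n q v z}

theorem commute_avg_incl_lastT_lastG (m : ℕ) :
    Commute (lastG r m q v) (avg (R := R) r (incl r (m + 1) q v (lastT r m q v))
      (lastT r (m + 1) q v)) := by
  have h := mul_avg_of_semiconj (R := R) (r := r)
    (lastG_mul_incl_lastT (r := r) (m := m) (q := q) (v := v)) lastG_mul_lastT
  rwa [avg_symm (commute_lastT_incl _) lastT_pow (by rw [← map_pow, lastT_pow, map_one])] at h

/-- `g X_{m+2} = X_{m+1} g + (q - q⁻¹) e X_{m+2}` for `g = g_{m+1}`, `e = e_{m+1}`. -/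
theorem lastG_mul_lastX : lastG r m q v * lastX r (m + 1) q v
    = incl r (m + 1) q v (lastX r m q v) * lastG r m q v +
      ((q : R) - ((q⁻¹ : Rˣ) : R)) • (avg (R := R) r (incl r (m + 1) q v (lastT r m q v))
        (lastT r (m + 1) q v) * lastX r (m + 1) q v) := by
  rw [lastX_succ, ← mul_assoc, ← mul_assoc, lastG_mul_self]
  simp only [add_mul, one_mul, smul_mul_assoc, mul_assoc]

/-- `X_{m+2} g = g X_{m+1} + (q - q⁻¹) e X_{m+2}` for `g = g_{m+1}`, `e = e_{m+1}`. -/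
theorem lastX_mul_lastG : lastX r (m + 1) q v * lastG r m q v
    = lastG r m q v * incl r (m + 1) q v (lastX r m q v) +
      ((q : R) - ((q⁻¹ : Rˣ) : R)) • (avg (R := R) r (incl r (m + 1) q v (lastT r m q v))
        (lastT r (m + 1) q v) * lastX r (m + 1) q v) := by
  have h : Commute (lastX r (m + 1) q v) (avg (R := R) r (incl r (m + 1) q v (lastT r m q v))
      (lastT r (m + 1) q v)) :=
    Commute.avg_right (commute_lastX_incl _) commute_lastT_lastX.symm
  rw [← h.eq]
  conv_lhs => rw [lastX_succ, mul_assoc, lastG_mul_self,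
    ← (commute_avg_incl_lastT_lastG m).eq]
  rw [mul_add, mul_one, mul_smul_comm, ← mul_assoc, ← lastX_succ]

theorem avg_mul_mem (S : Submodule R (Cyc r m q v)) {a b : Cyc r m q v}
    (ha : ∀ y ∈ S, a * y ∈ S) (hb : ∀ y ∈ S, b * y ∈ S) : ∀ y ∈ S, avg (R := R) r a b * y ∈ S := by
  intro y hy
  rw [avg, smul_mul_assoc, Finset.sum_mul]
  refine S.smul_mem _ (S.sum_mem fun s _ => ?_)
  have hpow : ∀ c : Cyc r m q v, (∀ y ∈ S, c * y ∈ S) → ∀ s, ∀ y ∈ S, c ^ s * y ∈ S := by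
    intro c hc s
    induction s with
    | zero => simp
    | succ s ih => intro y hy; rw [pow_succ', mul_assoc]; exact hc _ (ih y hy)
  rw [mul_assoc]
  exact hpow a ha _ _ (hpow b hb _ _ hy)

theorem span_spanSet_zero (hd : 1 ≤ d) : Submodule.span R (spanSet r 0 q v) = ⊤ := by
  set S := Submodule.span R (spanSet r 0 q v) with hS
  have hx : ∀ y ∈ S, lastX r 0 q v * y ∈ S := by
    intro y hy
    induction hy using Submodule.span_induction with
    | mem y hy =>
      rcases hy with ⟨a, ha, b, y, rfl⟩ | ⟨i, hi, _⟩
      · rw [← mul_assoc, ← mul_assoc, ← pow_succ', mul_assoc]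
        rcases (Nat.succ_le_of_lt ha).lt_or_eq with ha | ha
        · exact Submodule.subset_span (.inl ⟨a + 1, ha, b, y, (mul_assoc _ _ _).symm⟩)
        · rw [show a + 1 = d from ha]
          refine lastX_zero_pow_mem S _ fun a ha => ?_
          exact Submodule.subset_span (.inl ⟨a, ha, b, y, (mul_assoc _ _ _).symm⟩)
      · omega
    | zero => simp
    | add a b _ _ ha hb => rw [mul_add]; exact S.add_mem ha hb
    | smul c a _ ha => rw [mul_smul_comm]; exact S.smul_mem c ha
  refine eq_top_of_gen_mul_mem S (Submodule.subset_span (.inl ⟨0, hd, 0, 1, by simp⟩)) ?_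
  intro z
  rcases z.eq_incl_or_last with ⟨w, rfl⟩ | rfl | ⟨i, hi, rfl⟩ | ⟨-, rfl | rfl⟩
  · exact w.elim_zero.elim
  · intro y hy
    induction hy using Submodule.span_induction with
    | mem y hy =>
      rcases hy with ⟨a, ha, b, y, rfl⟩ | ⟨i, hi, _⟩
      · refine Submodule.subset_span (.inl ⟨a, ha, b + 1, y, ?_⟩)
        change lastT r 0 q v * _ = _
        rw [← mul_assoc, ← mul_assoc, (commute_lastT_lastX.pow_right a).eq, mul_assoc _ _ (_ ^ b),
          ← pow_succ']
      · omega
    | zero => simp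
    | add a b _ _ ha hb => rw [mul_add]; exact S.add_mem ha hb
    | smul c a _ ha => rw [mul_smul_comm]; exact S.smul_mem c ha
  · omega
  · exact hx
  · obtain ⟨p, hp⟩ := exists_aeval_eq_xinv (r := r) (q := q) (v := v)
    rw [← hp]
    clear hp
    induction p using Polynomial.induction_on' with
    | add p p' h1 h2 => intro y hy; rw [map_add, add_mul]; exact S.add_mem (h1 y hy) (h2 y hy)
    | monomial k c =>
      intro y hy
      rw [Polynomial.aeval_monomial, mul_assoc, ← Algebra.smul_def]
      refine S.smul_mem _ ?_
      induction k with
      | zero => simpa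
      | succ k ih => rw [pow_succ', mul_assoc]; exact hx _ ih

end Cyc

namespace Cyc

variable {R : Type u} [CommRing R] {d r m n : ℕ} [Invertible (r : R)] {q : Rˣ} {v : Fin d → Rˣ}

theorem span_spanSet_incl_mul (y : Cyc r (n + 1) q v)
    (hy : y ∈ Submodule.span R (spanSet r n q v)) (c : Cyc r n q v) :
    incl r n q v c * y ∈ Submodule.span R (spanSet r n q v) := by
  induction hy using Submodule.span_induction with
  | mem y hy =>
    rcases hy with ⟨a, ha, b, y, rfl⟩ | ⟨i, hi, y, z, rfl⟩
    · refine Submodule.subset_span (.inl ⟨a, ha, b, c * y, ?_⟩)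
      rw [← mul_assoc, ← (((commute_lastX_incl c).pow_left a).mul_left
        ((commute_lastT_incl c).pow_left b)).eq, map_mul, mul_assoc]
    · exact Submodule.subset_span (.inr ⟨i, hi, c * y, z, by simp [mul_assoc]⟩)
  | zero => simp
  | add a b _ _ ha hb => rw [mul_add]; exact Submodule.add_mem _ ha hb
  | smul c a _ ha => rw [mul_smul_comm]; exact Submodule.smul_mem _ c ha

theorem span_spanSet_lastT_mul (y : Cyc r (m + 1 + 1) q v)
    (hy : y ∈ Submodule.span R (spanSet r (m + 1) q v)) :
    lastT r (m + 1) q v * y ∈ Submodule.span R (spanSet r (m + 1) q v) := by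
  induction hy using Submodule.span_induction with
  | mem y hy =>
    rcases hy with ⟨a, ha, b, y, rfl⟩ | ⟨i, hi, y, z, rfl⟩
    · refine Submodule.subset_span (.inl ⟨a, ha, b + 1, y, ?_⟩)
      rw [← mul_assoc, ← mul_assoc, (commute_lastT_lastX.pow_right a).eq, mul_assoc _ _ (_ ^ b),
        ← pow_succ']
    · obtain rfl : i = m := by omega
      refine Submodule.subset_span (.inr ⟨i, rfl, y, lastT r i q v * z, ?_⟩)
      change _ * (_ * lastG r i q v * _) = _ * lastG r i q v * _
      rw [map_mul, ← mul_assoc, ← mul_assoc, (commute_lastT_incl y).eq, mul_assoc _ (lastT _ _ _ _),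
        ← lastG_mul_incl_lastT]
      simp only [mul_assoc]
  | zero => simp
  | add a b _ _ ha hb => rw [mul_add]; exact Submodule.add_mem _ ha hb
  | smul c a _ ha => rw [mul_smul_comm]; exact Submodule.smul_mem _ c ha

/-- The span is stable under the generators coming from `Y_{r,m+1}^d` and the last `t`; the point
is its stability under `g = g_{m+1}`. By induction `g y g` only has to be treated for `y` in the
spanning set of `Y_{r,m+1}^d`: if `y` is a power of `X_{m+1}`, then `g y g` is rewritten by moving
`X_{m+1}` past `g`, and if `y` is `g_m`, then it is rewritten by the braid relation. -/
theorem span_spanSet_succ (hd : 1 ≤ d) (ih : Submodule.span R (spanSet r m q v) = ⊤) :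
    Submodule.span R (spanSet r (m + 1) q v) = ⊤ := by
  set S := Submodule.span R (spanSet r (m + 1) q v) with hS
  set g := lastG r m q v with hg
  set X := lastX r (m + 1) q v with hX
  set e := avg (R := R) r (incl r (m + 1) q v (lastT r m q v)) (lastT r (m + 1) q v) with he
  set x := incl r (m + 1) q v (lastX r m q v) with hx
  have hS_e : ∀ y ∈ S, e * y ∈ S :=
    avg_mul_mem S (fun y hy => span_spanSet_incl_mul y hy _) span_spanSet_lastT_mul
  have hge : Commute g e := commute_avg_incl_lastT_lastG m
  have hxe : Commute x e := by
    refine Commute.avg_right ?_ (commute_lastT_incl _).symm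
    exact (commute_lastT_lastX.map (incl r (m + 1) q v)).symm
  have hXx : Commute X x := commute_lastX_incl _
  have hXmem : ∀ a < d, ∀ y, X ^ a * incl r (m + 1) q v y ∈ S := fun a ha y =>
    Submodule.subset_span (.inl ⟨a, ha, 0, y, by simp [hX]⟩)
  have hgX : ∀ a < d, ∀ y, g * (X ^ a * incl r (m + 1) q v y) ∈ S := by
    intro a
    induction a with
    | zero => exact fun _ y => Submodule.subset_span (.inr ⟨m, rfl, 1, y, by simp [hg, lastG]⟩)
    | succ a iha =>
      intro ha y
      rw [← mul_assoc, pow_succ', ← mul_assoc, hg, hX, lastG_mul_lastX, ← hg, ← hX, add_mul,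
        add_mul, mul_assoc x, mul_assoc x, mul_assoc g, smul_mul_assoc, smul_mul_assoc,
        mul_assoc e, mul_assoc e, ← pow_succ']
      exact S.add_mem (span_spanSet_incl_mul _ (iha (by omega) y) _)
        (S.smul_mem _ (hS_e _ (hXmem _ ha y)))
  -- moving one factor `x` past the second `g` turns it into a factor `X` on the right
  have hgxgX : ∀ j a, j + a < d → ∀ y, g * (x ^ j * (g * (X ^ a * incl r (m + 1) q v y))) ∈ S := by
    intro j
    induction j with
    | zero =>
      intro a ha y
      rw [pow_zero, one_mul, ← mul_assoc, hg, lastG_mul_self, ← hg, add_mul, one_mul,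
        smul_mul_assoc, mul_assoc]
      exact S.add_mem (hXmem _ (by omega) y) (S.smul_mem _ (hS_e _ (hgX _ (by omega) y)))
    | succ j ihj =>
      intro a ha y
      have h1 : x * (g * (X ^ a * incl r (m + 1) q v y)) =
          g * (X ^ (a + 1) * incl r (m + 1) q v y) -
          ((q : R) - ((q⁻¹ : Rˣ) : R)) • (e * (X ^ (a + 1) * incl r (m + 1) q v y)) := by
        rw [pow_succ', mul_assoc X, ← mul_assoc g X, hg, hX, lastG_mul_lastX, ← hg, ← hX, add_mul,
          smul_mul_assoc, mul_assoc x, mul_assoc e, add_sub_cancel_right]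
      have h2 : g * (x ^ j * (e * (X ^ (a + 1) * incl r (m + 1) q v y))) =
          e * (g * (X ^ (a + 1) * incl r (m + 1) q v (lastX r m q v ^ j * y))) := by
        rw [map_mul, map_pow, ← hx, ← mul_assoc (x ^ j), (hxe.pow_left j).eq, mul_assoc e,
          ← mul_assoc (x ^ j), ← (hXx.pow_pow (a + 1) j).eq, ← mul_assoc g e, hge.eq]
        simp only [mul_assoc]
      rw [pow_succ, mul_assoc (x ^ j), h1, mul_sub, mul_sub, mul_smul_comm, mul_smul_comm, h2]
      exact S.sub_mem (ihj _ (by omega) y)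
        (S.smul_mem _ (hS_e _ (hgX _ (by omega) _)))
  have hpow : ∀ (b : ℕ), ∀ y ∈ S, lastT r (m + 1) q v ^ b * y ∈ S := by
    intro b
    induction b with
    | zero => simp
    | succ b ihb =>
      intro y hy; rw [pow_succ', mul_assoc]; exact span_spanSet_lastT_mul _ (ihb y hy)
  -- the elements `g y g z`
  have hgig : ∀ y z, g * (incl r (m + 1) q v y * g * incl r (m + 1) q v z) ∈ S := by
    intro y
    have hy : y ∈ Submodule.span R (spanSet r m q v) := ih ▸ Submodule.mem_top
    induction hy using Submodule.span_induction with
    | mem y hy =>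
      intro z
      rcases hy with ⟨a, ha, b, y, rfl⟩ | ⟨i, hi, y, y', rfl⟩
      · have h1 := hpow b _ (hgxgX a 0 (by omega) (incl r m q v y * z))
        have h2 : SemiconjBy g (incl r (m + 1) q v (lastT r m q v) ^ b)
          (lastT r (m + 1) q v ^ b) := SemiconjBy.pow_right lastG_mul_incl_lastT b
        have h3 : Commute g (incl r (m + 1) q v (incl r m q v y)) := commute_lastG_incl_incl y
        convert h1 using 1
        rw [pow_zero, one_mul, ← mul_assoc _ g, ← h2.eq,
          (commute_lastT_lastX.pow_pow b a).symm.eq]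
        simp only [map_mul, map_pow, mul_assoc, ← hx]
        rw [← mul_assoc g (incl r (m + 1) q v (incl r m q v y)), h3.eq, mul_assoc]
      · subst hi
        have hb := lastG_braid (r := r) (m := i) (q := q) (v := v)
        have h3 : Commute g _ := commute_lastG_incl_incl y
        have h3' : Commute g _ := commute_lastG_incl_incl y'
        refine Submodule.subset_span (.inr ⟨i + 1, rfl, incl r (i + 1) q v y * lastG r i q v,
          lastG r i q v * incl r (i + 1) q v y' * z, ?_⟩)
        change g * (incl r _ q v (_ * lastG r i q v * _) * g * _) = _ * g * _
        rw [← hg] at hb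
        simp only [map_mul]
        calc _ = g * incl r _ q v (incl r _ q v y) * incl r _ q v (lastG r i q v) *
              (incl r _ q v (incl r _ q v y') * g) * incl r _ q v z := by simp only [mul_assoc]
          _ = incl r _ q v (incl r _ q v y) * (g * incl r _ q v (lastG r i q v) * g) *
              incl r _ q v (incl r _ q v y') * incl r _ q v z := by
            rw [h3.eq, ← h3'.eq]; simp only [mul_assoc]
          _ = _ := by rw [hb]; simp only [mul_assoc]
    | zero => simp
    | add a b _ _ ha hb =>
      intro z; rw [map_add, add_mul, add_mul, mul_add]; exact S.add_mem (ha z) (hb z)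
    | smul c a _ ha =>
      intro z
      rw [map_smul, smul_mul_assoc, smul_mul_assoc, mul_smul_comm]; exact S.smul_mem c (ha z)
  refine eq_top_of_gen_mul_mem S (by simpa using hXmem 0 hd 1) ?_
  intro z
  rcases z.eq_incl_or_last with ⟨w, rfl⟩ | rfl | ⟨i, hi, rfl⟩ | ⟨h, -⟩
  · intro y hy
    rw [← incl_gen]
    exact span_spanSet_incl_mul y hy _
  · exact span_spanSet_lastT_mul
  · obtain rfl : i = m := by omega
    intro y hy
    change g * y ∈ S
    induction hy using Submodule.span_induction with
    | mem y hy =>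
      rcases hy with ⟨a, ha, b, y, rfl⟩ | ⟨j, hj, y, z, rfl⟩
      · have h2 : SemiconjBy g (lastT r (i + 1) q v ^ b)
          (incl r (i + 1) q v (lastT r i q v) ^ b) := SemiconjBy.pow_right lastG_mul_lastT b
        rw [← (commute_lastT_lastX.pow_pow b a).eq, mul_assoc, ← mul_assoc, h2.eq, ← map_pow,
          mul_assoc]
        exact span_spanSet_incl_mul _ (hgX a ha y) _
      · obtain rfl : j = i := by omega
        exact hgig y z
    | zero => simp
    | add a b _ _ ha hb => rw [mul_add]; exact S.add_mem ha hb
    | smul c a _ ha => rw [mul_smul_comm]; exact S.smul_mem c ha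
  · omega

/-- `Y_{r,n+1}^d` is spanned by the elements `X_{n+1}^a t_{n+1}^b y` with `a < d`, and `y g_n z`,
for `y`, `z` in `Y_{r,n}^d`. -/
theorem span_spanSet (hd : 1 ≤ d) (n : ℕ) : Submodule.span R (spanSet r n q v) = ⊤ := by
  induction n with
  | zero => exact span_spanSet_zero hd
  | succ m ih => exact span_spanSet_succ hd ih

end Cyc

/-! ### The tensor square of a Frobenius extension -/

open MulOpposite

section RightEnd

variable {R A B : Type u} [CommRing R] [Ring A] [Algebra R A] [Ring B] [Algebra R B]

/-- The `R`-linear endomorphisms of `A` that are linear for the right action of `B` through `ι`, as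
a submodule. -/
def rightEndSubmodule (ι : B →ₐ[R] A) : Submodule R (Module.End R A) where
  carrier := {φ | ∀ x b, φ (x * ι b) = φ x * ι b}
  add_mem' h1 h2 x b := by simp [h1 x b, h2 x b, add_mul]
  zero_mem' x b := by simp
  smul_mem' c φ h x b := by simp [h x b]

/-- The `R`-linear endomorphisms of `A` that are linear for the right action of `B` through `ι`. If
`A` is a Frobenius extension of `B`, this `(A, A)`-bimodule is a model of `A ⊗_B A`, with `a ⊗ a'`
acting as `x ↦ a θ(a' x)`. -/
def RightEnd (ι : B →ₐ[R] A) : Type u := ↥(rightEndSubmodule ι)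

namespace RightEnd

variable (ι : B →ₐ[R] A)

instance : AddCommGroup (RightEnd ι) := inferInstanceAs (AddCommGroup ↥(rightEndSubmodule ι))

instance : Module R (RightEnd ι) := inferInstanceAs (Module R ↥(rightEndSubmodule ι))

instance : FunLike (RightEnd ι) A A where
  coe φ := fun x => φ.1 x
  coe_injective _ _ h := Subtype.ext (LinearMap.ext (congrFun h))

variable {ι}

@[ext] theorem ext {φ ψ : RightEnd ι} (h : ∀ x, φ x = ψ x) : φ = ψ := DFunLike.ext φ ψ h

theorem map_mul_ι (φ : RightEnd ι) (x : A) (b : B) : φ (x * ι b) = φ x * ι b := φ.2 x b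

/-- Construct an element of `RightEnd ι` from a linear map. -/
def mk (φ : A →ₗ[R] A) (h : ∀ x b, φ (x * ι b) = φ x * ι b) : RightEnd ι := ⟨φ, h⟩

@[simp] theorem add_apply (φ ψ : RightEnd ι) (x : A) : (φ + ψ) x = φ x + ψ x := rfl

@[simp] theorem zero_apply (x : A) : (0 : RightEnd ι) x = 0 := rfl

@[simp] theorem apply_add (φ : RightEnd ι) (x y : A) : φ (x + y) = φ x + φ y := φ.1.map_add x y

@[simp] theorem apply_zero (φ : RightEnd ι) : φ 0 = 0 := φ.1.map_zero

@[simp] theorem apply_smul (φ : RightEnd ι) (c : R) (x : A) : φ (c • x) = c • φ x :=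
  φ.1.map_smul c x

theorem apply_sum (φ : RightEnd ι) {I : Type*} (s : Finset I) (f : I → A) :
    φ (∑ i ∈ s, f i) = ∑ i ∈ s, φ (f i) := map_sum φ.1 f s

theorem sum_apply {I : Type*} (s : Finset I) (f : I → RightEnd ι) (x : A) :
    (∑ i ∈ s, f i) x = ∑ i ∈ s, f i x := by
  classical
  induction s using Finset.induction_on with
  | empty => simp
  | insert a s ha ih => simp [Finset.sum_insert ha, ih]

instance : Module A (RightEnd ι) where
  smul a φ := mk (LinearMap.mulLeft R a ∘ₗ φ.1) fun x b => by
    simpa [mul_assoc] using congrArg (a * ·) (φ.2 x b)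
  one_smul φ := ext fun x => one_mul _
  mul_smul a b φ := ext fun x => mul_assoc _ _ _
  smul_zero a := ext fun x => mul_zero _
  smul_add a φ ψ := ext fun x => mul_add _ _ _
  add_smul a b φ := ext fun x => add_mul _ _ _
  zero_smul φ := ext fun x => zero_mul _

instance : Module Aᵐᵒᵖ (RightEnd ι) where
  smul a φ := mk (φ.1 ∘ₗ LinearMap.mulLeft R a.unop) fun x b => by
    simpa [mul_assoc] using φ.2 (a.unop * x) b
  one_smul φ := ext fun x => congrArg φ (one_mul x)
  mul_smul a b φ := ext fun x => congrArg φ (mul_assoc _ _ _)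
  smul_zero a := ext fun x => rfl
  smul_add a φ ψ := ext fun x => rfl
  add_smul a b φ := ext fun x => (congrArg φ (add_mul _ _ _)).trans (apply_add φ _ _)
  zero_smul φ := ext fun x => (congrArg φ (zero_mul _)).trans (apply_zero φ)

@[simp] theorem op_smul_apply (a : A) (φ : RightEnd ι) (x : A) : (op a • φ) x = φ (a * x) := rfl

instance : SMulCommClass A Aᵐᵒᵖ (RightEnd ι) := ⟨fun _ _ _ => rfl⟩

instance : IsScalarTower R A (RightEnd ι) := ⟨fun c a _ => ext fun _ => smul_mul_assoc c a _⟩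

instance : IsScalarTower R Aᵐᵒᵖ (RightEnd ι) := ⟨fun c a φ => ext fun x => by
  obtain ⟨a, rfl⟩ := op_surjective a
  rw [← op_smul, op_smul_apply, smul_mul_assoc, apply_smul]; rfl⟩

variable {I : Type} [Fintype I] (θ : A →ₗ[R] B) (x y : I → A)
  (hxy : ∀ a, ∑ i, x i * ι (θ (y i * a)) = a) (hyx : ∀ a, ∑ i, ι (θ (a * x i)) * y i = a)

/-- The element `x ↦ ι (θ x)`, corresponding to `1 ⊗ 1`. -/
def proj (hθ : ∀ a b, θ (a * ι b) = θ a * b) : RightEnd ι :=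
  mk (ι.toLinearMap ∘ₗ θ) fun x b => by simp [hθ]

include hxy in
theorem eq_sum (hθ : ∀ a b, θ (a * ι b) = θ a * b) (φ : RightEnd ι) :
    φ = ∑ i, op (y i) • φ (x i) • proj θ hθ := by
  ext z
  rw [sum_apply]
  conv_lhs => rw [← hxy z, apply_sum]
  refine Finset.sum_congr rfl fun i _ => ?_
  rw [map_mul_ι]
  rfl

include hxy hyx in
/-- `RightEnd ι` has the mapping property of `A ⊗_B A` for maps of right `A`-modules. -/
theorem exists_map (hθ : ∀ a b, θ (a * ι b) = θ a * b) {N : Type*} [AddCommGroup N] [Module R N]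
    [Module Aᵐᵒᵖ N] (γ : A →ₗ[R] N) (hγ : ∀ a b, γ (a * ι b) = op (ι b) • γ a) :
    ∃ H : RightEnd ι →ₗ[Aᵐᵒᵖ] N, ∀ a, H (a • proj θ hθ) = γ a := by
  refine ⟨{ toFun := fun φ => ∑ i, op (y i) • γ (φ (x i))
            map_add' := fun φ ψ => by simp [Finset.sum_add_distrib]
            map_smul' := fun c φ => ?_ }, fun a => ?_⟩
  · obtain ⟨c, rfl⟩ := op_surjective c
    have h1 : ∀ i, op (y i) • γ (φ (c * x i))
        = ∑ j, op (ι (θ (y j * c * x i)) * y i) • γ (φ (x j)) := by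
      intro i
      rw [← hxy (c * x i), apply_sum, map_sum, Finset.smul_sum]
      refine Finset.sum_congr rfl fun j _ => ?_
      rw [map_mul_ι, hγ, smul_smul, ← op_mul, mul_assoc]
    simp only [op_smul_apply, h1, RingHom.id_apply]
    rw [Finset.sum_comm, Finset.smul_sum]
    refine Finset.sum_congr rfl fun j _ => ?_
    rw [← Finset.sum_smul, ← Finset.op_sum, hyx, smul_smul, ← op_mul]
  · have h1 : ∀ i, op (y i) • γ ((a • proj θ hθ) (x i)) = op (ι (θ (1 * x i)) * y i) • γ a := by
      intro i
      change op (y i) • γ (a * ι (θ (x i))) = _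
      rw [hγ, smul_smul, ← op_mul, one_mul]
    simp only [LinearMap.coe_mk, AddHom.coe_mk, h1]
    rw [← Finset.sum_smul, ← Finset.op_sum, hyx, op_one, one_smul]

end RightEnd

end RightEnd

/-! ### The bimodule on which the next algebra will act -/

/-- The structure carried by `Y_{r,n+2}^d` as a bimodule over `A = Y_{r,n+1}^d`, apart from the
left multiplication by the last generator `g`: it is generated by `p`, standing for `g`, which
commutes with the image of `B = Y_{r,n}^d`, and by `ξ i`, standing for the `i`-th power of the last
`X`, which commutes with `A`, together with the left multiplication `τ` by the last `t`. The map
`π` is the coefficient of `ξ 0`, and `t` is the last `t` of `A`, so that `τ p = p t` is the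
relation between `g` and the `t`s. By `span` and `exists_map`, the underlying right module is
`A ⊗_B A ⊕ A^{dr}`, where the summands are generated by `p` and the `τ^j (ξ i)` with `i < d`; the
elements `ξ i` with `i ≥ d` are irrelevant. -/
structure ExtModel {R A B : Type u} [CommRing R] [Ring A] [Algebra R A] [Ring B] [Algebra R B]
    (ι : B →ₐ[R] A) (t : A) (d r : ℕ) (Q : Type u) [AddCommGroup Q] [Module R Q] [Module A Q]
    [Module Aᵐᵒᵖ Q] where
  p : Q
  ξ : ℕ → Q
  τ : Module.End Aᵐᵒᵖ Q
  π : Q →ₗ[R] A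
  ι_smul_p : ∀ b, ι b • p = op (ι b) • p
  smul_ξ : ∀ (c : A) i, c • ξ i = op c • ξ i
  τ_smul : ∀ (c : A) x, τ (c • x) = c • τ x
  τ_p : τ p = op t • p
  τ_pow : τ ^ r = 1
  π_smul : ∀ (c : A) x, π (c • x) = c * π x
  π_op_smul : ∀ (c : A) x, π (op c • x) = π x * c
  π_p : π p = 0
  π_ξ : ∀ i < d, ∀ j < r, π ((τ ^ j) (ξ i)) = if i = 0 ∧ j = 0 then 1 else 0
  span : ∀ S : Submodule Aᵐᵒᵖ Q, (∀ a : A, a • p ∈ S) → (∀ i < d, ∀ j, (τ ^ j) (ξ i) ∈ S) → S = ⊤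
  exists_map : ∀ γ : A →ₗ[R] Q, (∀ a b, γ (a * ι b) = op (ι b) • γ a) → ∀ m : ℕ → Q,
    ∃ G : Module.End Aᵐᵒᵖ Q, (∀ a : A, G (a • p) = γ a) ∧
      ∀ i < d, ∀ j, G ((τ ^ j) (ξ i)) = t ^ j • m i

section

variable {R A B : Type u} [CommRing R] [Ring A] [Algebra R A] [Ring B] [Algebra R B]

/-- Cyclic shift of the second index: multiplication by `t` on the free module with basis
`X^i t^j`. -/
def shiftRight (A : Type u) [Ring A] (d r : ℕ) :
    (Fin d → ZMod r → A) →ₗ[Aᵐᵒᵖ] (Fin d → ZMod r → A) where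
  toFun c i j := c i (j - 1)
  map_add' _ _ := rfl
  map_smul' _ _ := rfl

theorem shiftRight_pow_apply (A : Type u) [Ring A] (d r : ℕ) (k : ℕ) (c : Fin d → ZMod r → A)
    (i : Fin d) (j : ZMod r) : (shiftRight A d r ^ k) c i j = c i (j - k) := by
  induction k generalizing j with
  | zero => simp
  | succ k ih =>
    rw [pow_succ', Module.End.mul_apply]
    change (shiftRight A d r ^ k) c i (j - 1) = _
    rw [ih]; congr 1; push_cast; ring

variable {I : Type} [Fintype I] (ι : B →ₐ[R] A) (t : A) (d r : ℕ) [NeZero r]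

/-- The unit vector with index `(i, j)`, standing for `X^i t^j`; it is zero if `i ≥ d`. -/
def unitVec (A : Type u) [Ring A] (d r : ℕ) (i : ℕ) (j : ZMod r) : Fin d → ZMod r → A :=
  fun i' j' => if (i' : ℕ) = i ∧ j' = j then 1 else 0

omit [NeZero r] in
theorem shiftRight_pow_unitVec (i k : ℕ) :
    (shiftRight A d r ^ k) (unitVec A d r i 0) = unitVec A d r i k := by
  funext i' j'
  rw [shiftRight_pow_apply]
  simp only [unitVec, sub_eq_zero]

theorem sum_smul_unitVec (c : Fin d → ZMod r → A) :
    c = ∑ i, ∑ j, op (c i j) • unitVec A d r i j := by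
  funext i' j'
  simp only [Finset.sum_apply, Pi.smul_apply]
  rw [Finset.sum_eq_single i' (fun i _ hi => Finset.sum_eq_zero fun j _ => ?_) (by simp),
    Finset.sum_eq_single j' (fun j _ hj => ?_) (by simp)]
  · simp [unitVec]
  · simp [unitVec, Ne.symm hj]
  · rw [unitVec, if_neg (fun h => hi (Fin.ext h.1.symm)), smul_zero]

/-- If `θ : A → B` is a bimodule map with dual bases `x`, `y`, then `RightEnd ι`, which is
`A ⊗_B A`, plus the free module with basis `X^i t^j`, for `i < d` and `j` modulo `r`, is an
`ExtModel`. -/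
theorem exists_extModel (hd : 1 ≤ d) (ht : t ^ r = 1) (htB : ∀ b, Commute t (ι b)) (θ : A →ₗ[R] B)
    (hθ : ∀ a b, θ (a * ι b) = θ a * b) (hθ' : ∀ a b, θ (ι b * a) = b * θ a) (x y : I → A)
    (hxy : ∀ a, ∑ i, x i * ι (θ (y i * a)) = a) (hyx : ∀ a, ∑ i, ι (θ (a * x i)) * y i = a) :
    Nonempty (ExtModel (R := R) ι t d r (RightEnd ι × (Fin d → ZMod r → A))) := by
  set P : RightEnd ι := RightEnd.proj θ hθ with hP
  have hPB : ∀ b, ι b • P = op (ι b) • P := fun b => RightEnd.ext fun z => by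
    change ι b * ι (θ z) = ι (θ (ι b * z))
    rw [hθ', map_mul]
  obtain ⟨T, hT⟩ := RightEnd.exists_map θ x y hxy hyx hθ
    (N := RightEnd ι) (((LinearMap.toSpanSingleton A _ (op t • P)).restrictScalars R :
      A →ₗ[R] RightEnd ι)) (fun a b => by
        simp only [LinearMap.coe_restrictScalars, LinearMap.toSpanSingleton_apply]
        rw [mul_smul, smul_comm (ι b), hPB, smul_smul, ← op_mul, ← (htB b).eq, op_mul, ← smul_smul,
          smul_comm a])
  simp only [LinearMap.coe_restrictScalars, LinearMap.toSpanSingleton_apply, ← hP] at hT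
  have hspanE : ∀ S : Submodule Aᵐᵒᵖ (RightEnd ι), (∀ a : A, a • P ∈ S) → S = ⊤ := fun S h =>
    eq_top_iff.2 fun φ _ => by
      rw [RightEnd.eq_sum θ x y hxy hθ φ]
      exact S.sum_mem fun i _ => S.smul_mem _ (h _)
  have hTsmul : ∀ (c : A) φ, T (c • φ) = c • T φ := by
    intro c φ
    have : (⊤ : Submodule Aᵐᵒᵖ (RightEnd ι)) ≤ LinearMap.eqLocus
        (T ∘ₗ Algebra.lsmul R Aᵐᵒᵖ (RightEnd ι) c) (Algebra.lsmul R Aᵐᵒᵖ (RightEnd ι) c ∘ₗ T) := by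
      rw [hspanE (LinearMap.eqLocus _ _) fun a => ?_]
      simp only [LinearMap.mem_eqLocus, LinearMap.comp_apply, Algebra.lsmul_coe]
      rw [hT, smul_smul, hT, smul_smul]
    exact this (Submodule.mem_top (x := φ))
  have hTpow : ∀ k : ℕ, (T ^ k) P = op (t ^ k) • P := by
    intro k
    induction k with
    | zero => simp
    | succ k ih =>
      have h1 := hT 1
      rw [one_smul, one_smul] at h1
      rw [pow_succ', Module.End.mul_apply, ih, map_smul, h1, smul_smul, ← op_mul, pow_succ']
  have hτpow : ∀ (k : ℕ) (φ : RightEnd ι) (c : Fin d → ZMod r → A),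
      ((T.prodMap (shiftRight A d r)) ^ k) (φ, c) = ((T ^ k) φ, (shiftRight A d r ^ k) c) := by
    intro k
    induction k with
    | zero => intros; rfl
    | succ k ih =>
      intro φ c
      rw [pow_succ', Module.End.mul_apply, ih, pow_succ', pow_succ']; rfl
  have hTr : T ^ r = 1 := by
    have : (⊤ : Submodule Aᵐᵒᵖ (RightEnd ι)) ≤ LinearMap.eqLocus (T ^ r) 1 := by
      rw [hspanE (LinearMap.eqLocus _ _) fun a => ?_]
      have h1 : ∀ k : ℕ, (T ^ k) (a • P) = a • (T ^ k) P := by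
        intro k
        induction k with
        | zero => rfl
        | succ k ih => rw [pow_succ', Module.End.mul_apply, ih, hTsmul]; rfl
      rw [LinearMap.mem_eqLocus, h1, hTpow, ht, op_one, one_smul, Module.End.one_apply]
    exact LinearMap.ext fun φ => this (Submodule.mem_top (x := φ))
  refine ⟨{
    p := (P, 0)
    ξ := fun i => (0, unitVec A d r i 0)
    τ := T.prodMap (shiftRight A d r)
    π := LinearMap.proj (R := R) (φ := fun _ : ZMod r => A) 0 ∘ₗ
      LinearMap.proj (R := R) (φ := fun _ : Fin d => ZMod r → A) ⟨0, hd⟩ ∘ₗ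
      LinearMap.snd R (RightEnd ι) _
    ι_smul_p := fun b => Prod.ext (hPB b) (by simp)
    smul_ξ := fun c i => Prod.ext (by simp) ?_
    τ_smul := fun c x => Prod.ext (hTsmul c x.1) rfl
    τ_p := Prod.ext (by simpa using hTpow 1) (by simp)
    τ_pow := LinearMap.ext fun x => by
      rw [hτpow, hTr]
      refine Prod.ext rfl ?_
      funext i j
      simp [shiftRight_pow_apply]
    π_smul := fun c x => rfl
    π_op_smul := fun c x => rfl
    π_p := rfl
    π_ξ := fun i hi j hj => ?_
    span := fun S h1 h2 => ?_
    exists_map := fun γ hγ m => ?_ }⟩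
  · funext i' j'
    by_cases h : (i' : ℕ) = i ∧ j' = 0 <;> simp [unitVec, h]
  · rw [hτpow, shiftRight_pow_unitVec]
    have h0 : (0 : ZMod r) = (j : ZMod r) ↔ j = 0 := by
      rw [eq_comm, ZMod.natCast_eq_zero_iff]
      exact ⟨fun h => Nat.eq_zero_of_dvd_of_lt h hj, fun h => h ▸ dvd_zero r⟩
    simp [unitVec, h0, eq_comm]
  · have hl : ∀ φ : RightEnd ι, ((φ, 0) : RightEnd ι × (Fin d → ZMod r → A)) ∈ S := fun φ => by
      have := hspanE (S.comap (LinearMap.inl Aᵐᵒᵖ (RightEnd ι) (Fin d → ZMod r → A)))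
        (fun a => by simpa using h1 a)
      exact (this ▸ Submodule.mem_top : φ ∈ S.comap (LinearMap.inl _ _ _))
    have hr : ∀ c, ((0, c) : RightEnd ι × (Fin d → ZMod r → A)) ∈ S := fun c => by
      change c ∈ S.comap (LinearMap.inr Aᵐᵒᵖ (RightEnd ι) (Fin d → ZMod r → A))
      rw [sum_smul_unitVec d r c]
      refine Submodule.sum_mem _ fun i _ => Submodule.sum_mem _ fun j _ => Submodule.smul_mem _ _ ?_
      have := h2 i i.2 j.val
      rw [hτpow, map_zero, shiftRight_pow_unitVec, ZMod.natCast_zmod_val] at this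
      exact this
    refine eq_top_iff.2 fun x _ => ?_
    have := S.add_mem (hl x.1) (hr x.2)
    simpa using this
  · obtain ⟨H, hH⟩ := RightEnd.exists_map θ x y hxy hyx hθ γ hγ
    let L : (Fin d → ZMod r → A) →ₗ[Aᵐᵒᵖ] RightEnd ι × (Fin d → ZMod r → A) :=
      { toFun := fun c => ∑ i, ∑ j, op (c i j) • t ^ j.val • m i
        map_add' := fun c c' => by simp [add_smul, Finset.sum_add_distrib]
        map_smul' := fun a c => by
          obtain ⟨a, rfl⟩ := op_surjective a
          simp only [Finset.smul_sum, RingHom.id_apply, smul_smul (op a), ← op_mul]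
          rfl }
    refine ⟨H.coprod L, fun a => ?_, fun i hi j => ?_⟩
    · change H.coprod L (a • P, a • 0) = _
      rw [LinearMap.coprod_apply, hH]; simp
    · rw [hτpow, map_zero, shiftRight_pow_unitVec, LinearMap.coprod_apply, map_zero, zero_add]
      change ∑ i', ∑ j' : ZMod r, op (unitVec A d r i j i' j') • t ^ j'.val • m i' = _
      rw [Finset.sum_eq_single ⟨i, hi⟩ (fun i' _ hi' => Finset.sum_eq_zero fun j' _ => ?_)
        (by simp), Finset.sum_eq_single (j : ZMod r) (fun j' _ hj' => ?_) (by simp)]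
      · have : t ^ (j % r) = t ^ j := by
          conv_rhs => rw [← Nat.mod_add_div j r, pow_add, pow_mul, ht, one_pow, mul_one]
        simp [unitVec, this]
      · simp [unitVec, hj']
      · rw [unitVec, if_neg (fun h => hi' (Fin.ext h.1)), op_zero, zero_smul]

end

/-! ### Left multiplication by the new generator: quadratic relation -/

theorem smul_op_smul {A Q : Type*} [Ring A] [AddCommGroup Q] [Module A Q] [Module Aᵐᵒᵖ Q]
    [SMulCommClass A Aᵐᵒᵖ Q] (c a : A) (x : Q) : c • op a • x = op a • c • x := smul_comm _ _ _

theorem op_smul_op_smul {A Q : Type*} [Ring A] [AddCommGroup Q] [Module Aᵐᵒᵖ Q] (c a : A) (x : Q) :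
    op c • op a • x = op (a * c) • x := by
  rw [smul_smul, op_mul]

/-- The kernel of `P` is stable under all operators that `P` intertwines with some operator. -/
theorem mem_ker_of_mul_eq {T Q : Type*} [Ring T] [AddCommGroup Q] [Module T Q]
    {P f f' : Module.End T Q} (h : P * f = f' * P) {x : Q} (hx : x ∈ LinearMap.ker P) :
    f x ∈ LinearMap.ker P := by
  rw [LinearMap.mem_ker] at hx ⊢
  rw [← Module.End.mul_apply, h, Module.End.mul_apply, hx, map_zero]

theorem avg_apply_mem {R T Q : Type u} [CommRing R] [Ring T] [Algebra R T] [AddCommGroup Q]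
    [Module R Q] [Module T Q] [IsScalarTower R T Q] [SMulCommClass T R Q] {r : ℕ}
    [Invertible (r : R)]
    {W : Submodule T Q} {f g : Module.End T Q} (hf : ∀ x ∈ W, f x ∈ W) (hg : ∀ x ∈ W, g x ∈ W)
    (x : Q) (hx : x ∈ W) : avg (R := R) r f g x ∈ W := by
  have hpow : ∀ f : Module.End T Q, (∀ x ∈ W, f x ∈ W) → ∀ s : ℕ, ∀ x ∈ W, (f ^ s) x ∈ W := by
    intro f hf s
    induction s with
    | zero => simp
    | succ s ih => intro y hy; rw [pow_succ', Module.End.mul_apply]; exact hf _ (ih y hy)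
  rw [avg, LinearMap.smul_apply, LinearMap.sum_apply, ← algebraMap_smul T (⅟(r : R))]
  exact W.smul_mem _ (W.sum_mem fun s _ => hpow f hf _ _ (hpow g hg _ _ hx))

namespace ExtModel

variable {R A B : Type u} [CommRing R] [Ring A] [Algebra R A] [Ring B] [Algebra R B]
  {ι : B →ₐ[R] A} {t : A} {d r : ℕ} {Q : Type u} [AddCommGroup Q] [Module R Q] [Module A Q]
  [Module Aᵐᵒᵖ Q] (M : ExtModel ι t d r Q) (X : A) (Δ : R)

/-- Operators that agree on the generators are equal. -/
theorem end_ext {f g : Module.End Aᵐᵒᵖ Q} (h1 : ∀ a : A, f (a • M.p) = g (a • M.p))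
    (h2 : ∀ i < d, ∀ j, f ((M.τ ^ j) (M.ξ i)) = g ((M.τ ^ j) (M.ξ i))) : f = g := by
  refine LinearMap.ext fun x => ?_
  have h3 : LinearMap.eqLocus f g = ⊤ := M.span _ h1 h2
  exact (h3 ▸ Submodule.mem_top : x ∈ LinearMap.eqLocus f g)

theorem τ_pow_p (j : ℕ) : (M.τ ^ j) M.p = op (t ^ j) • M.p := by
  induction j with
  | zero => simp
  | succ k ih =>
    rw [pow_succ', Module.End.mul_apply, ih, map_smul, M.τ_p, smul_smul, ← op_mul, pow_succ']

theorem τ_pow_mod (j : ℕ) : M.τ ^ (j % r) = M.τ ^ j := by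
  conv_rhs => rw [← Nat.mod_add_div j r, pow_add, pow_mul, M.τ_pow, one_pow, mul_one]

theorem π_τ_pow_ξ [NeZero r] {i : ℕ} (hi : i < d) (j : ℕ) :
    M.π ((M.τ ^ j) (M.ξ i)) = if i = 0 ∧ r ∣ j then 1 else 0 := by
  rw [← M.τ_pow_mod, M.π_ξ i hi _ (Nat.mod_lt _ (NeZero.pos r))]
  simp only [Nat.dvd_iff_mod_eq_zero]

/-- The sum of the `X^i • ξ (a - i)` for `0 ≤ i < a`. It enters through the relation
`g X'^a = X^a g + (q - q⁻¹) e ∑ X^i X'^{a-i}` between consecutive Jucys-Murphy elements `X`, `X'`.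
-/
def symm : ℕ → Q
  | 0 => 0
  | a + 1 => X • symm a + M.ξ (a + 1)

variable [SMulCommClass A Aᵐᵒᵖ Q]

variable {X} in
theorem commute_smul_symm {c : A} (hX : Commute X c) (a : ℕ) :
    c • M.symm X a = op c • M.symm X a := by
  induction a with
  | zero => simp [symm]
  | succ a ih =>
    simp only [symm, smul_add]
    rw [smul_smul, ← hX.eq, mul_smul, ih, smul_comm X, M.smul_ξ]

variable [IsScalarTower R A Q] [IsScalarTower R Aᵐᵒᵖ Q]

theorem commute_lsmul_τ (c : A) : Commute (Algebra.lsmul R Aᵐᵒᵖ Q c) M.τ :=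
  LinearMap.ext fun x => (M.τ_smul c x).symm

theorem τ_pow_smul (j : ℕ) (c : A) (x : Q) : (M.τ ^ j) (c • x) = c • (M.τ ^ j) x :=
  LinearMap.congr_fun ((M.commute_lsmul_τ (R := R) c).pow_right j).symm.eq x

variable [Invertible (r : R)]

/-- Left multiplication by the idempotent `e` of the last two indices. -/
noncomputable def ε : Module.End Aᵐᵒᵖ Q := avg (R := R) r (Algebra.lsmul R Aᵐᵒᵖ Q t) M.τ

/-- The element that stands for `g X'^a`, where `X'` is the last one of the larger algebra; the
recursion is the relation `g X' = X g + (q - q⁻¹) e X'`. -/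
noncomputable def gX : ℕ → Q
  | 0 => M.p
  | a + 1 => X • gX a + Δ • M.ε (M.ξ (a + 1))

/-- The sum of the elements standing for `g X'^{a-i} X^i` for `0 ≤ i < a`, that is, `g` times
`symm`. -/
noncomputable def gSymm : ℕ → Q
  | 0 => 0
  | a + 1 => op X • gSymm a + M.gX X Δ (a + 1)

/-- The element that stands for `g X^a g`, where `X` is the last one of the smaller algebra. The
formula is forced by `g (g X'^a) = X'^a + (q - q⁻¹) e g X'^a` and the expansion `gX_eq` of
`g X'^a`. -/
noncomputable def gXg (a : ℕ) : Q := M.ξ a + Δ • M.ε (M.gX X Δ a - M.gSymm X Δ a)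

theorem ε_mul_lsmul_t (ht : t ^ r = 1) : M.ε * Algebra.lsmul R Aᵐᵒᵖ Q t = M.ε * M.τ :=
  avg_mul_left_eq_mul_right (M.commute_lsmul_τ t) (by rw [← map_pow, ht, map_one]) M.τ_pow

theorem ε_t_smul (ht : t ^ r = 1) (x : Q) : M.ε (t • x) = M.ε (M.τ x) :=
  LinearMap.congr_fun (M.ε_mul_lsmul_t ht) x

theorem ε_τ (x : Q) : M.ε (M.τ x) = M.τ (M.ε x) := by
  have h : Commute M.τ M.ε := Commute.avg_right (M.commute_lsmul_τ t).symm (Commute.refl _)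
  exact LinearMap.congr_fun h.symm.eq x

theorem ε_smul {c : A} (hc : Commute t c) (x : Q) : M.ε (c • x) = c • M.ε x := by
  have h : Commute (Algebra.lsmul R Aᵐᵒᵖ Q c) M.ε :=
    Commute.avg_right (hc.symm.map _) (M.commute_lsmul_τ c)
  exact LinearMap.congr_fun h.symm.eq x

theorem ε_pow (ht : t ^ r = 1) (j : ℕ) (x : Q) : M.ε (t ^ j • x) = M.ε ((M.τ ^ j) x) := by
  induction j with
  | zero => simp
  | succ j ih =>
    rw [pow_succ', mul_smul, M.ε_t_smul ht, ε_τ, ih, pow_succ', Module.End.mul_apply, ε_τ]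

theorem τ_pow_ε (j : ℕ) (x : Q) : (M.τ ^ j) (M.ε x) = M.ε ((M.τ ^ j) x) := by
  induction j with
  | zero => simp
  | succ j ih =>
    rw [pow_succ', Module.End.mul_apply, Module.End.mul_apply, ih, ε_τ]

variable {X} in
theorem commute_smul_gX {b : B} (hX : Commute X (ι b)) (ht : Commute t (ι b)) (a : ℕ) :
    ι b • M.gX X Δ a = op (ι b) • M.gX X Δ a := by
  induction a with
  | zero => exact M.ι_smul_p b
  | succ a ih =>
    simp only [gX, smul_add]
    rw [smul_smul, ← hX.eq, mul_smul, ih, smul_comm X, smul_comm _ Δ, smul_comm _ Δ,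
      ← M.ε_smul ht, M.smul_ξ, map_smul]

variable {X} in
theorem op_t_smul_gX (ht : t ^ r = 1) (a : ℕ) :
    op t • M.gX X Δ a = M.τ (M.gX X Δ a) := by
  induction a with
  | zero => exact M.τ_p.symm
  | succ a ih =>
    simp only [gX, smul_add, map_add]
    rw [← smul_comm X, ih, M.τ_smul, LinearMap.map_smul_of_tower, smul_comm _ Δ, ← map_smul M.ε,
      ← M.smul_ξ, M.ε_t_smul ht, ε_τ]

variable {X} in
theorem gX_eq (hX : Commute t X) (a : ℕ) :
    M.gX X Δ a = X ^ a • M.p + Δ • M.ε (M.symm X a) := by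
  induction a with
  | zero => simp [gX, symm]
  | succ a ih =>
    simp only [gX, symm, ih, smul_add, map_add, M.ε_smul hX]
    rw [pow_succ', mul_smul, smul_comm X Δ, add_assoc]

variable {X} in
theorem commute_smul_gSymm {b : B} (hX : Commute X (ι b)) (ht : Commute t (ι b)) (a : ℕ) :
    ι b • M.gSymm X Δ a = op (ι b) • M.gSymm X Δ a := by
  induction a with
  | zero => simp [gSymm]
  | succ a ih =>
    simp only [gSymm, smul_add]
    rw [smul_comm (ι b) (op X), ih, smul_smul, smul_smul, ← op_mul, ← op_mul, hX.eq,
      M.commute_smul_gX Δ hX ht]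

variable {X} in
theorem op_t_smul_gSymm (ht : t ^ r = 1) (hX : Commute t X) (a : ℕ) :
    op t • M.gSymm X Δ a = M.τ (M.gSymm X Δ a) := by
  induction a with
  | zero => simp [gSymm]
  | succ a ih =>
    simp only [gSymm, smul_add, map_add]
    rw [smul_smul, ← op_mul, ← hX.eq, op_mul, mul_smul, ih, M.op_t_smul_gX Δ ht, map_smul]

variable {X} in
theorem commute_smul_gXg {b : B} (hX : Commute X (ι b)) (ht : Commute t (ι b)) (a : ℕ) :
    ι b • M.gXg X Δ a = op (ι b) • M.gXg X Δ a := by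
  simp only [gXg, smul_add]
  rw [M.smul_ξ, smul_comm _ Δ, smul_comm _ Δ, ← M.ε_smul ht, smul_sub,
    M.commute_smul_gX Δ hX ht, M.commute_smul_gSymm Δ hX ht, ← smul_sub, map_smul]

variable {X} in
theorem t_smul_gXg (ht : t ^ r = 1) (hX : Commute t X) (a : ℕ) :
    t • M.gXg X Δ a = op t • M.gXg X Δ a := by
  simp only [gXg, smul_add]
  rw [M.smul_ξ, smul_comm _ Δ, smul_comm _ Δ, ← M.ε_smul (Commute.refl t), M.ε_t_smul ht, map_sub,
    ← M.op_t_smul_gX Δ ht, ← M.op_t_smul_gSymm Δ ht hX, ← smul_sub, map_smul]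

theorem ε_smul_p {c : B} {h : A} (hc : h * ι c = t * h) :
    M.ε (h • M.p) = h • op (avg (R := R) r (ι c) t) • M.p := by
  have hs : SemiconjBy h (ι c) t := hc
  have hterm : ∀ s, (Algebra.lsmul R Aᵐᵒᵖ Q t ^ s * M.τ ^ (r - s)) (h • M.p) =
      h • op (ι c ^ s * t ^ (r - s)) • M.p := by
    intro s
    rw [Module.End.mul_apply, M.τ_pow_smul, M.τ_pow_p, ← map_pow, Algebra.lsmul_coe]
    dsimp only
    rw [smul_smul, ← (hs.pow_right s).eq, mul_smul, ← map_pow, smul_op_smul, M.ι_smul_p,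
      op_smul_op_smul]
  rw [ε, avg, avg, LinearMap.smul_apply, LinearMap.sum_apply, op_smul, Finset.op_sum,
    smul_assoc, smul_comm h (⅟(r : R)), Finset.sum_smul, Finset.smul_sum]
  simp only [hterm, Finset.smul_sum]

end ExtModel

/-- The operator `G` of left multiplication by the last generator `g` on the bimodule of an
`ExtModel`. Here `A` plays the role of `Y_{r,n+1}^d`, with last generators `X` and `t`, and `H`
contains its last generator `h` of type `g`, if there is one; by `span`, the `X^i t^j` and `h`
generate `A` over `B`. The element `γ a` stands for `g a g`, which is determined by its values on
these generators: `g h g = h g h`, and `gXg` for the powers of `X`. -/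
structure ExtOp {R A B : Type u} [CommRing R] [Ring A] [Algebra R A] [Ring B] [Algebra R B]
    {ι : B →ₐ[R] A} {t : A} {d r : ℕ} {Q : Type u} [AddCommGroup Q] [Module R Q] [Module A Q]
    [Module Aᵐᵒᵖ Q] [SMulCommClass A Aᵐᵒᵖ Q] [IsScalarTower R A Q] [IsScalarTower R Aᵐᵒᵖ Q]
    [Invertible (r : R)] (M : ExtModel ι t d r Q) (X : A) (Δ : R) (H : Set A) where
  t_pow : t ^ r = 1
  t_X : Commute t X
  t_ι : ∀ b, Commute t (ι b)
  X_ι : ∀ b, Commute X (ι b)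
  H_rel : ∀ h ∈ H, ∃ b, h * t = ι b * h ∧ h * ι b = t * h ∧
    h * h = 1 + Δ • (avg (R := R) r (ι b) t * h)
  span : ∀ S : Submodule R A, (∀ i < d, ∀ j b, X ^ i * t ^ j * ι b ∈ S) →
    (∀ h ∈ H, ∀ b b', ι b * h * ι b' ∈ S) → S = ⊤
  γ : A →ₗ[R] Q
  γ_left : ∀ b a, γ (ι b * a) = ι b • γ a
  γ_right : ∀ a b, γ (a * ι b) = op (ι b) • γ a
  γ_pow : ∀ i < d, ∀ j, γ (X ^ i * t ^ j) = (M.τ ^ j) (M.gXg X Δ i)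
  γ_H : ∀ h ∈ H, γ h = h • op h • M.p
  G : Module.End Aᵐᵒᵖ Q
  G_p : ∀ a : A, G (a • M.p) = γ a
  G_ξ : ∀ i < d, ∀ j, G ((M.τ ^ j) (M.ξ i)) = t ^ j • M.gX X Δ i

namespace ExtOp

variable {R A B : Type u} [CommRing R] [Ring A] [Algebra R A] [Ring B] [Algebra R B]
  {ι : B →ₐ[R] A} {t : A} {d r : ℕ} {Q : Type u} [AddCommGroup Q] [Module R Q] [Module A Q]
  [Module Aᵐᵒᵖ Q] [SMulCommClass A Aᵐᵒᵖ Q] [IsScalarTower R A Q] [IsScalarTower R Aᵐᵒᵖ Q]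
  [Invertible (r : R)] {M : ExtModel ι t d r Q} {X : A} {Δ : R} {H : Set A}
  (D : ExtOp M X Δ H)

include D

theorem eqOn_span {N : Type*} [AddCommGroup N] [Module R N] {f g : A →ₗ[R] N}
    (h1 : ∀ i < d, ∀ j b, f (X ^ i * t ^ j * ι b) = g (X ^ i * t ^ j * ι b))
    (h2 : ∀ h ∈ H, ∀ b b', f (ι b * h * ι b') = g (ι b * h * ι b'))
    (a : A) : f a = g a := by
  have h3 : LinearMap.eqLocus f g = ⊤ := D.span _ h1 h2
  exact (h3 ▸ Submodule.mem_top : a ∈ LinearMap.eqLocus f g)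

theorem G_ξ_zero {i : ℕ} (hi : i < d) : D.G (M.ξ i) = M.gX X Δ i := by
  simpa using D.G_ξ i hi 0

theorem commute_G_ι (b : B) : Commute D.G (Algebra.lsmul R Aᵐᵒᵖ Q (ι b)) := by
  refine M.end_ext (fun a => ?_) fun i hi j => ?_
  · simp only [Module.End.mul_apply, Algebra.lsmul_coe]
    rw [smul_smul, D.G_p, D.γ_left, D.G_p]
  · simp only [Module.End.mul_apply, Algebra.lsmul_coe]
    rw [← M.τ_pow_smul, M.smul_ξ, map_smul, map_smul, D.G_ξ i hi, smul_smul (ι b),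
      ← ((D.t_ι b).pow_left j).eq, mul_smul, M.commute_smul_gX Δ (D.X_ι b) (D.t_ι b),
      smul_op_smul]

theorem γ_t_mul (a : A) : D.γ (t * a) = M.τ (D.γ a) := by
  refine D.eqOn_span (f := D.γ ∘ₗ LinearMap.mulLeft R t) (g := M.τ.restrictScalars R ∘ₗ D.γ)
    (fun i hi j b => ?_) (fun h hh b b' => ?_) a
  · simp only [LinearMap.comp_apply, LinearMap.mulLeft_apply, LinearMap.coe_restrictScalars]
    rw [← mul_assoc, ← mul_assoc, (D.t_X.pow_right i).eq, mul_assoc _ t, ← pow_succ', D.γ_right,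
      D.γ_pow i hi, D.γ_right, D.γ_pow i hi, map_smul, pow_succ', Module.End.mul_apply]
  · obtain ⟨c, hc1, hc2, -⟩ := D.H_rel h hh
    simp only [LinearMap.comp_apply, LinearMap.mulLeft_apply, LinearMap.coe_restrictScalars]
    have h1 : t * (ι b * h * ι b') = ι b * h * ι (c * b') := by
      rw [← mul_assoc, ← mul_assoc, (D.t_ι b).eq, mul_assoc _ t, ← hc2]
      simp only [mul_assoc, map_mul]
    rw [h1, D.γ_right, D.γ_left, D.γ_right, D.γ_left, D.γ_H h hh]
    have h2 : op (h * ι c) • M.p = op (t * h) • M.p := by rw [hc2]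
    simp only [map_smul, M.τ_smul, M.τ_p, smul_op_smul, op_smul_op_smul, map_mul, ← mul_assoc,
      ← hc2]

theorem t_smul_γ (a : A) : t • D.γ a = op t • D.γ a := by
  refine D.eqOn_span (f := (Algebra.lsmul R R Q t) ∘ₗ D.γ)
    (g := (Algebra.lsmul R R Q (op t)) ∘ₗ D.γ) (fun i hi j b => ?_) (fun h hh b b' => ?_) a
  · simp only [LinearMap.comp_apply, Algebra.lsmul_coe]
    rw [D.γ_right, D.γ_pow i hi, smul_comm, ← M.τ_pow_smul, M.t_smul_gXg Δ D.t_pow D.t_X, map_smul,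
      smul_smul, smul_smul, ← op_mul, ← op_mul, (D.t_ι b).eq]
  · obtain ⟨c, hc1, hc2, -⟩ := D.H_rel h hh
    simp only [LinearMap.comp_apply, Algebra.lsmul_coe]
    have h1 : t • ι b • h • M.p = op (ι c) • (ι b • h • M.p) := by
      rw [smul_smul, (D.t_ι b).eq, mul_smul, smul_smul t, ← hc2, mul_smul, M.ι_smul_p]
      simp only [smul_op_smul]
    rw [D.γ_right, D.γ_left, D.γ_H h hh]
    simp only [smul_op_smul, h1, op_smul_op_smul]
    rw [← mul_assoc, ← hc1, mul_assoc, mul_assoc, (D.t_ι b').eq]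

theorem G_mul_lsmul_t : D.G * Algebra.lsmul R Aᵐᵒᵖ Q t = M.τ * D.G := by
  refine M.end_ext (fun a => ?_) fun i hi j => ?_
  · simp only [Module.End.mul_apply, Algebra.lsmul_coe]
    rw [smul_smul, D.G_p, D.γ_t_mul, D.G_p]
  · simp only [Module.End.mul_apply, Algebra.lsmul_coe]
    rw [← M.τ_pow_smul, M.smul_ξ, map_smul, map_smul, D.G_ξ i hi, ← smul_comm,
      M.op_t_smul_gX Δ D.t_pow, M.τ_smul]

theorem G_mul_τ : D.G * M.τ = Algebra.lsmul R Aᵐᵒᵖ Q t * D.G := by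
  refine M.end_ext (fun a => ?_) fun i hi j => ?_
  · simp only [Module.End.mul_apply, Algebra.lsmul_coe]
    rw [M.τ_smul, M.τ_p, smul_comm, map_smul, D.G_p, D.t_smul_γ]
  · simp only [Module.End.mul_apply, Algebra.lsmul_coe]
    have h1 := D.G_ξ i hi (j + 1)
    rw [pow_succ', Module.End.mul_apply] at h1
    rw [h1, D.G_ξ i hi, pow_succ', mul_smul]

theorem commute_G_ε : Commute D.G M.ε := by
  have h := mul_avg_of_semiconj (R := R) (r := r) D.G_mul_lsmul_t D.G_mul_τ
  rwa [avg_symm (M.commute_lsmul_τ t).symm M.τ_pow (by rw [← map_pow, D.t_pow, map_one])] at h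

theorem G_ε (x : Q) : D.G (M.ε x) = M.ε (D.G x) := LinearMap.congr_fun D.commute_G_ε.eq x

theorem G_symm {a : ℕ} (ha : a < d) : D.G (M.symm X a) = M.gSymm X Δ a := by
  induction a with
  | zero => simp [ExtModel.symm, ExtModel.gSymm]
  | succ a ih =>
    rw [ExtModel.symm, M.commute_smul_symm (Commute.refl X), map_add, map_smul, ih (by omega),
      D.G_ξ_zero ha, ExtModel.gSymm]

/-- The quadratic relation on `ξ a`. -/
theorem G_gX {a : ℕ} (ha : a < d) : D.G (M.gX X Δ a) = M.ξ a + Δ • M.ε (M.gX X Δ a) := by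
  have h := D.γ_pow a ha 0
  rw [pow_zero, mul_one, pow_zero, Module.End.one_apply] at h
  conv_lhs => rw [M.gX_eq Δ D.t_X, map_add, D.G_p, LinearMap.map_smul_of_tower, D.G_ε,
    D.G_symm ha, h]
  rw [ExtModel.gXg, add_assoc, ← smul_add, map_sub, sub_add_cancel]

/-- `G X G` maps `ξ a` to `ξ (a + 1)`. -/
theorem G_X_gX {a : ℕ} (ha : a + 1 < d) : D.G (X • M.gX X Δ a) = M.ξ (a + 1) := by
  have h := D.G_gX ha
  have h2 : X • M.gX X Δ a = M.gX X Δ (a + 1) - Δ • M.ε (M.ξ (a + 1)) := by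
    rw [ExtModel.gX, add_sub_cancel_right]
  rw [h2, map_sub, h, LinearMap.map_smul_of_tower, D.G_ε, D.G_ξ_zero ha, add_sub_cancel_right]

/-- A right submodule that is stable under both `t`s and contains the elements standing for `X'^a`
and `g X'^a`, with `X'` the last one of the larger algebra, contains those standing for
`X^i t^j b g`, with `X` and `t` the last ones of the smaller algebra. -/
theorem smul_p_mem {W : Submodule Aᵐᵒᵖ Q} (ht : ∀ x ∈ W, t • x ∈ W) (hτ : ∀ x ∈ W, M.τ x ∈ W)
    (h1 : ∀ i < d, M.ξ i ∈ W) (h2 : ∀ i < d, M.gX X Δ i ∈ W) {i : ℕ} (hi : i < d) (j : ℕ) (b : B) :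
    (X ^ i * t ^ j * ι b) • M.p ∈ W := by
  have hΔ : ∀ x ∈ W, Δ • x ∈ W := fun x hx => by
    rw [← algebraMap_smul Aᵐᵒᵖ Δ]; exact W.smul_mem _ hx
  have h3 : ∀ i < d, M.symm X i ∈ W := by
    intro i
    induction i with
    | zero => exact fun _ => W.zero_mem
    | succ i ih =>
      intro hi
      rw [ExtModel.symm, M.commute_smul_symm (Commute.refl X)]
      exact W.add_mem (W.smul_mem _ (ih (by omega))) (h1 _ hi)
  have h4 : X ^ i • M.p ∈ W := by
    rw [eq_sub_of_add_eq (M.gX_eq Δ D.t_X i).symm]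
    exact W.sub_mem (h2 i hi) (hΔ _ (avg_apply_mem ht hτ _ (h3 i hi)))
  rw [mul_smul, M.ι_smul_p, smul_comm, ← ((D.t_X.pow_left j).pow_right i).eq, mul_smul]
  refine W.smul_mem _ ?_
  clear hi
  induction j with
  | zero => simpa
  | succ j ih => rw [pow_succ', mul_smul]; exact ht _ ih

/-- The quadratic relation. The defect `P` commutes with `G`, with the left multiplications by both
`t`s and with those by the image of `B`, so that its kernel is stable under them; as it contains
the `ξ i`, by `G_gX`, and `h p`, it contains all the generators. -/
theorem G_mul_G : D.G * D.G = 1 + Δ • (M.ε * D.G) := by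
  set P : Module.End Aᵐᵒᵖ Q := D.G * D.G - (1 + Δ • (M.ε * D.G)) with hP
  have hGt := D.G_mul_lsmul_t
  have hGτ := D.G_mul_τ
  have hPG : D.G * P = P * D.G := by
    have h := D.commute_G_ε.eq
    simp only [hP, mul_sub, sub_mul, mul_add, add_mul, mul_one, one_mul, mul_smul_comm,
      smul_mul_assoc, ← mul_assoc, h]
  have hPt : P * Algebra.lsmul R Aᵐᵒᵖ Q t = Algebra.lsmul R Aᵐᵒᵖ Q t * P := by
    have h : Commute (Algebra.lsmul R Aᵐᵒᵖ Q t) M.ε :=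
      Commute.avg_right (Commute.refl _) (M.commute_lsmul_τ t)
    have h1 : D.G * D.G * Algebra.lsmul R Aᵐᵒᵖ Q t = Algebra.lsmul R Aᵐᵒᵖ Q t * D.G * D.G := by
      rw [mul_assoc, hGt, ← mul_assoc, hGτ]
    have h2 : M.ε * D.G * Algebra.lsmul R Aᵐᵒᵖ Q t = Algebra.lsmul R Aᵐᵒᵖ Q t * M.ε * D.G := by
      rw [mul_assoc, hGt, ← mul_assoc, ← M.ε_mul_lsmul_t D.t_pow, h.eq]
    simp only [hP, mul_sub, sub_mul, mul_add, add_mul, mul_one, one_mul, mul_smul_comm,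
      smul_mul_assoc, ← mul_assoc, h1, h2]
  have hPτ : P * M.τ = M.τ * P := by
    have h : Commute M.τ M.ε :=
      Commute.avg_right (M.commute_lsmul_τ t).symm (Commute.refl _)
    have h1 : D.G * D.G * M.τ = M.τ * D.G * D.G := by
      rw [mul_assoc, hGτ, ← mul_assoc, hGt]
    have h2 : M.ε * D.G * M.τ = M.τ * M.ε * D.G := by
      rw [mul_assoc, hGτ, ← mul_assoc, M.ε_mul_lsmul_t D.t_pow, h.eq]
    simp only [hP, mul_sub, sub_mul, mul_add, add_mul, mul_one, one_mul, mul_smul_comm,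
      smul_mul_assoc, ← mul_assoc, h1, h2]
  have hPι (b : B) : P * Algebra.lsmul R Aᵐᵒᵖ Q (ι b) = Algebra.lsmul R Aᵐᵒᵖ Q (ι b) * P := by
    have h0 := D.commute_G_ι b
    have h : Commute (Algebra.lsmul R Aᵐᵒᵖ Q (ι b)) M.ε :=
      Commute.avg_right ((D.t_ι b).symm.map _) (M.commute_lsmul_τ _)
    exact (((h0.mul_left h0).sub_left ((Commute.one_left _).add_left
      ((h.symm.mul_left h0).smul_left Δ))).eq :)
  have hξ : ∀ i < d, M.ξ i ∈ LinearMap.ker P := fun i hi => by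
    rw [LinearMap.mem_ker, hP]
    simp only [LinearMap.sub_apply, LinearMap.add_apply, Module.End.mul_apply,
      LinearMap.smul_apply, Module.End.one_apply]
    rw [D.G_ξ_zero hi, D.G_gX hi, sub_self]
  have hg : ∀ i < d, M.gX X Δ i ∈ LinearMap.ker P := fun i hi => by
    rw [← D.G_ξ_zero hi]; exact mem_ker_of_mul_eq hPG.symm (hξ i hi)
  have hτpow : ∀ j : ℕ, P * M.τ ^ j = M.τ ^ j * P := fun j => (Commute.pow_right hPτ j :)
  have h0 : P = 0 := by
    refine M.end_ext (fun a => ?_) fun i hi j => ?_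
    · refine D.eqOn_span (f := P.restrictScalars R ∘ₗ
        (LinearMap.toSpanSingleton A Q M.p).restrictScalars R) (g := 0) (fun i hi j b => ?_)
        (fun h hh b b' => ?_) a
      · exact D.smul_p_mem (fun x hx => mem_ker_of_mul_eq hPt hx)
          (fun x hx => mem_ker_of_mul_eq hPτ hx) hξ hg hi j b
      · obtain ⟨c, hc1, hc2, hc3⟩ := D.H_rel h hh
        have h1 : P (h • M.p) = 0 := by
          rw [hP]
          simp only [LinearMap.sub_apply, LinearMap.add_apply, Module.End.mul_apply,
            LinearMap.smul_apply, Module.End.one_apply]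
          rw [D.G_p, D.γ_H h hh, smul_op_smul, map_smul D.G, map_smul M.ε, M.ε_smul_p hc2, D.G_p,
            D.γ_H h hh, smul_op_smul, smul_op_smul, op_smul_op_smul, op_smul_op_smul,
            hc3, op_add, op_one, op_smul, add_smul, one_smul, smul_assoc, sub_self]
        simp only [LinearMap.comp_apply, LinearMap.coe_restrictScalars,
          LinearMap.toSpanSingleton_apply, LinearMap.zero_apply]
        have h2 := LinearMap.congr_fun (hPι b) (h • M.p)
        simp only [Module.End.mul_apply, Algebra.lsmul_coe] at h2
        rw [mul_assoc, mul_smul, mul_smul, M.ι_smul_p, smul_op_smul, smul_op_smul, map_smul, h2,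
          h1, smul_zero, smul_zero]
    · rw [← Module.End.mul_apply, hτpow, Module.End.mul_apply, LinearMap.mem_ker.1 (hξ i hi),
        map_zero, LinearMap.zero_apply]
  exact sub_eq_zero.1 h0

end ExtOp

/-! ### Left multiplication by the new generator: reflection equation -/

section BraidDefect

variable {R S : Type u} [CommRing R] [Ring S] [Algebra R S] {r : ℕ} [Invertible (r : R)] {Δ : R}
  {g h t c τ : S}

/-- The defect `P = g h g - h g h` of the braid relation satisfies `P h = -g⁻¹ P`, by the quadratic
relations; note that `g⁻¹ = g - Δ e`. -/
theorem braid_defect_mul_left (hhc : h * c = t * h) (hhτ : h * τ = τ * h)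
    (hgt : g * t = τ * g) (hgc : g * c = c * g)
    (hg : g * g = 1 + Δ • (avg (R := R) r t τ * g))
    (hh : h * h = 1 + Δ • (avg (R := R) r c t * h)) :
    (g * h * g - h * g * h) * h = (Δ • avg (R := R) r t τ - g) * (g * h * g - h * g * h) := by
  have h1 : h * (g * (avg (R := R) r c t)) = avg (R := R) r t τ * (h * g) := by
    rw [mul_avg_of_semiconj hgc hgt, ← mul_assoc, mul_avg_of_semiconj hhc hhτ, mul_assoc]
  have h2 : g * (g * h * g) = h * g + Δ • (avg (R := R) r t τ * (g * h * g)) := by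
    rw [← mul_assoc, ← mul_assoc, hg]; simp only [add_mul, one_mul, smul_mul_assoc, mul_assoc]
  have h3 : h * g * h * h = h * g + Δ • (avg (R := R) r t τ * (h * g * h)) := by
    rw [mul_assoc (h * g), hh, mul_add, mul_one, mul_smul_comm, mul_assoc, ← mul_assoc g,
      ← mul_assoc h, h1]
    simp only [mul_assoc]
  rw [sub_mul, h3, sub_mul, mul_sub g, h2, mul_sub, smul_mul_assoc, smul_mul_assoc]
  simp only [mul_assoc]
  abel

end BraidDefect

namespace ExtOp

variable {R A B : Type u} [CommRing R] [Ring A] [Algebra R A] [Ring B] [Algebra R B]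
  {ι : B →ₐ[R] A} {t : A} {d r : ℕ} {Q : Type u} [AddCommGroup Q] [Module R Q] [Module A Q]
  [Module Aᵐᵒᵖ Q] [SMulCommClass A Aᵐᵒᵖ Q] [IsScalarTower R A Q] [IsScalarTower R Aᵐᵒᵖ Q]
  [Invertible (r : R)] {M : ExtModel ι t d r Q} {X : A} {Δ : R} {H : Set A}
  (D : ExtOp M X Δ H)

include D

/-- The commutator of `X` and `g X'^a`. -/
theorem smul_X_gX (a : ℕ) :
    X • M.gX X Δ a - op X • M.gX X Δ a = X ^ (a + 1) • M.p - X ^ a • op X • M.p := by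
  induction a with
  | zero => simp [ExtModel.gX]
  | succ a ih =>
    rw [ExtModel.gX, smul_add, smul_add, smul_comm X Δ, smul_comm (op X) Δ, ← M.ε_smul D.t_X,
      M.smul_ξ, map_smul M.ε, add_sub_add_right_eq_sub, ← smul_op_smul, ← smul_sub, ih, smul_sub,
      smul_smul, smul_smul, ← pow_succ', ← pow_succ']

/-- The commutator of `X` and the sum of the `g X'^{a-i} X^i`; the sum of the commutators of
`smul_X_gX` telescopes. -/
theorem smul_X_gSymm (a : ℕ) :
    X • M.gSymm X Δ a - op X • M.gSymm X Δ a = X ^ (a + 1) • M.p - X • op (X ^ a) • M.p := by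
  induction a with
  | zero => simp [ExtModel.gSymm]
  | succ a ih =>
    rw [ExtModel.gSymm, smul_add, smul_add, add_sub_add_comm, D.smul_X_gX, smul_op_smul,
      ← smul_sub, ih, smul_sub, ← smul_op_smul, ← smul_op_smul, op_smul_op_smul, ← pow_succ]
    abel

/-- The commutator of `X` and `g y g`, for `y` in `Y_{r,1}^d`. -/
theorem smul_X_γ (hH : H = ∅) (y : A) :
    X • D.γ y - op X • D.γ y = Δ • M.ε (X • op y • M.p - y • op X • M.p) := by
  have h1 (i : ℕ) : X • M.gXg X Δ i - op X • M.gXg X Δ i =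
      Δ • M.ε (X • op (X ^ i) • M.p - X ^ i • op X • M.p) := by
    rw [ExtModel.gXg, smul_add, smul_add, M.smul_ξ, add_sub_add_left_eq_sub, smul_comm X Δ,
      smul_comm (op X) Δ, ← M.ε_smul D.t_X, ← map_smul M.ε, ← smul_sub, ← map_sub, smul_sub,
      smul_sub, sub_sub_sub_comm, D.smul_X_gX, D.smul_X_gSymm]
    congr 2
    abel
  refine D.eqOn_span (f := Algebra.lsmul R R Q X ∘ₗ D.γ - Algebra.lsmul R R Q (op X) ∘ₗ D.γ)
    (g := Δ • (M.ε.restrictScalars R ∘ₗ (Algebra.lsmul R R Q X ∘ₗ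
        ((LinearMap.toSpanSingleton Aᵐᵒᵖ Q M.p).restrictScalars R ∘ₗ (opLinearEquiv R).toLinearMap)
        - (LinearMap.toSpanSingleton A Q (op X • M.p)).restrictScalars R)))
    (fun i hi j b => ?_) (by simp [hH]) y
  simp only [LinearMap.sub_apply, LinearMap.smul_apply, LinearMap.comp_apply, Algebra.lsmul_coe,
    LinearMap.coe_restrictScalars, LinearMap.toSpanSingleton_apply, LinearEquiv.coe_coe,
    coe_opLinearEquiv]
  have h2 : X • op (X ^ i * t ^ j * ι b) • M.p = op (ι b) • (M.τ ^ j) (X • op (X ^ i) • M.p) := by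
    rw [M.τ_pow_smul, map_smul, M.τ_pow_p, op_smul_op_smul, ← ((D.t_X.pow_left j).pow_right i).eq,
      ← smul_op_smul, op_smul_op_smul]
  have h3 : (X ^ i * t ^ j * ι b) • op X • M.p = op (ι b) • t ^ j • X ^ i • op X • M.p := by
    rw [← ((D.t_X.pow_left j).pow_right i).eq, mul_smul, mul_smul, ← smul_op_smul, ← smul_op_smul,
      smul_op_smul (ι b), M.ι_smul_p, op_smul_op_smul, op_smul_op_smul, (D.X_ι b).eq]
  rw [D.γ_right, D.γ_pow i hi, h2, h3, smul_op_smul, op_smul_op_smul X, ← (D.X_ι b).eq,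
    ← op_smul_op_smul, ← smul_sub, ← M.τ_pow_smul, ← map_smul, ← map_sub, h1, ← smul_sub,
    LinearMap.map_smul_of_tower, smul_comm _ Δ, M.τ_pow_ε, map_smul M.ε, map_sub M.ε _ (t ^ j • _),
    M.ε_pow D.t_pow, ← map_sub M.ε, ← map_sub]

/-- An expression for `X'^{a+1} = g X g X'^a`. Unlike `G_X_gX`, it covers `a + 1 = d`, where the
power is not one of the generators. -/
theorem G_X_gX_eq {a : ℕ} (ha : a < d) :
    D.G (X • M.gX X Δ a) = D.γ (X ^ (a + 1)) + Δ • M.ε (op X • M.gSymm X Δ a) := by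
  rw [M.gX_eq Δ D.t_X, smul_add, smul_smul, ← pow_succ', map_add, D.G_p, smul_comm X Δ,
    LinearMap.map_smul_of_tower, ← M.ε_smul D.t_X, D.G_ε, M.commute_smul_symm (Commute.refl X),
    map_smul D.G, D.G_symm ha]

/-- `X` commutes with `X'^{a+1}`, also for `a + 1 = d`. -/
theorem smul_X_G_X_gX (hH : H = ∅) {a : ℕ} (ha : a < d) :
    X • D.G (X • M.gX X Δ a) = op X • D.G (X • M.gX X Δ a) := by
  have h1 := D.G_X_gX_eq ha
  have h2 : X • op X • M.gSymm X Δ a - op X • op X • M.gSymm X Δ a =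
      op X • (X ^ (a + 1) • M.p - X • op (X ^ a) • M.p) := by
    rw [smul_op_smul, ← smul_sub, D.smul_X_gSymm]
  rw [← sub_eq_zero, h1, smul_add, smul_add, add_sub_add_comm, D.smul_X_γ hH, smul_comm X Δ,
    smul_comm (op X) Δ, ← smul_sub, ← smul_add, ← M.ε_smul D.t_X, ← map_smul M.ε, ← map_sub,
    ← map_add, h2, smul_sub, ← smul_op_smul, ← smul_op_smul, op_smul_op_smul, ← pow_succ]
  convert smul_zero Δ
  convert map_zero M.ε
  abel

/-- The reflection equation between `G` and `X`, when the smaller algebra is `Y_{r,1}^d`. The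
kernel of the defect is stable under `G` and the `t`s, and contains the `ξ i` by `smul_X_G_X_gX`.
-/
theorem reflection (hH : H = ∅) :
    D.G * Algebra.lsmul R Aᵐᵒᵖ Q X * D.G * Algebra.lsmul R Aᵐᵒᵖ Q X =
      Algebra.lsmul R Aᵐᵒᵖ Q X * D.G * Algebra.lsmul R Aᵐᵒᵖ Q X * D.G := by
  set G := D.G with hG
  set x := Algebra.lsmul R Aᵐᵒᵖ Q X with hx
  set τ := M.τ with hτ
  set T := Algebra.lsmul R Aᵐᵒᵖ Q t with hT
  set P := G * x * G * x - x * G * x * G with hP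
  have hGt : G * T = τ * G := D.G_mul_lsmul_t
  have hGτ : G * τ = T * G := D.G_mul_τ
  have hxT : x * T = T * x := ((D.t_X.map (Algebra.lsmul R Aᵐᵒᵖ Q)).symm.eq :)
  have hxτ : x * τ = τ * x := (M.commute_lsmul_τ X).eq
  have hPT : P * T = T * P := by
    have h1 : G * x * G * x * T = T * (G * x * G * x) := by
      rw [mul_assoc _ x, hxT, ← mul_assoc, mul_assoc _ G, hGt, ← mul_assoc, mul_assoc _ x, hxτ,
        ← mul_assoc, hGτ]
      simp only [mul_assoc]
    have h2 : x * G * x * G * T = T * (x * G * x * G) := by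
      rw [mul_assoc _ G, hGt, ← mul_assoc, mul_assoc _ x, hxτ, ← mul_assoc, mul_assoc _ G, hGτ,
        ← mul_assoc, hxT]
      simp only [mul_assoc]
    rw [hP, sub_mul, mul_sub, h1, h2]
  have hPτ : P * τ = τ * P := by
    have h1 : G * x * G * x * τ = τ * (G * x * G * x) := by
      rw [mul_assoc _ x, hxτ, ← mul_assoc, mul_assoc _ G, hGτ, ← mul_assoc, mul_assoc _ x, hxT,
        ← mul_assoc, hGt]
      simp only [mul_assoc]
    have h2 : x * G * x * G * τ = τ * (x * G * x * G) := by
      rw [mul_assoc _ G, hGτ, ← mul_assoc, mul_assoc _ x, hxT, ← mul_assoc, mul_assoc _ G, hGt,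
        ← mul_assoc, hxτ]
      simp only [mul_assoc]
    rw [hP, sub_mul, mul_sub, h1, h2]
  have hPG : P * G = (Δ • M.ε - G) * P := by
    have hGG : G * G = 1 + Δ • (M.ε * G) := D.G_mul_G
    have hεx : x * M.ε = M.ε * x := (show Commute x M.ε from Commute.avg_right hxT hxτ).eq
    have hεG : G * M.ε = M.ε * G := D.commute_G_ε.eq
    have h1 : G * (G * x * G * x) = x * G * x + Δ • (M.ε * (G * x * G * x)) := by
      simp only [← mul_assoc]; rw [hGG]; simp only [add_mul, one_mul, smul_mul_assoc]
    have h2 : x * G * x * G * G = x * G * x + Δ • (M.ε * (x * G * x * G)) := by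
      rw [mul_assoc _ G G, hGG, mul_add, mul_one, mul_smul_comm, ← mul_assoc, mul_assoc _ x M.ε,
        hεx,
        ← mul_assoc, mul_assoc _ G M.ε, hεG, ← mul_assoc, hεx]
      simp only [mul_assoc]
    rw [hP, sub_mul, h2, sub_mul, mul_sub G, h1, mul_sub, smul_mul_assoc, smul_mul_assoc]
    simp only [mul_assoc]
    abel
  have hξ : ∀ i < d, M.ξ i ∈ LinearMap.ker P := fun i hi => by
    rw [LinearMap.mem_ker, hP]
    simp only [LinearMap.sub_apply, Module.End.mul_apply, hx, Algebra.lsmul_coe]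
    rw [M.smul_ξ, map_smul G, D.G_ξ_zero hi, smul_op_smul, map_smul G, ← D.smul_X_G_X_gX hH hi,
      sub_self]
  have hg : ∀ i < d, M.gX X Δ i ∈ LinearMap.ker P := fun i hi => by
    rw [← D.G_ξ_zero hi]; exact mem_ker_of_mul_eq hPG (hξ i hi)
  have hPτj : ∀ j : ℕ, P * τ ^ j = τ ^ j * P := fun j => (Commute.pow_right hPτ j :)
  have h0 : P = 0 := by
    refine M.end_ext (fun a => ?_) fun i hi j => ?_
    · refine D.eqOn_span (f := P.restrictScalars R ∘ₗ
        (LinearMap.toSpanSingleton A Q M.p).restrictScalars R) (g := 0) (fun i hi j b => ?_)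
        (by simp [hH]) a
      exact D.smul_p_mem (fun x hx => mem_ker_of_mul_eq hPT hx)
        (fun x hx => mem_ker_of_mul_eq hPτ hx) hξ hg hi j b
    · exact LinearMap.mem_ker.1 (mem_ker_of_mul_eq (hPτj j) (hξ i hi))
  exact sub_eq_zero.1 h0

end ExtOp

/-! ### Left multiplication by the new generator: braid relation -/

namespace ExtOp

variable {R A B : Type u} [CommRing R] [Ring A] [Algebra R A] [Ring B] [Algebra R B]
  {ι : B →ₐ[R] A} {t : A} {d r : ℕ} {Q : Type u} [AddCommGroup Q] [Module R Q] [Module A Q]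
  [Module Aᵐᵒᵖ Q] [SMulCommClass A Aᵐᵒᵖ Q] [IsScalarTower R A Q] [IsScalarTower R Aᵐᵒᵖ Q]
  [Invertible (r : R)] {M : ExtModel ι t d r Q} {X : A} {Δ : R} {h : A}
  (D : ExtOp M X Δ {h})

include D

/-- The braid relation on `X'^a`, with `X'` the last one of the larger algebra:
`g h (g X'^a) = h (g X'^a) h`. Here `x'`, `c` are the last `X` and `t` of `B`. -/
theorem G_h_gX {x' c : B} (hht : h * t = ι c * h)
    (hX : X = h * ι x' * h) (hhh : h * h = 1 + Δ • (avg (R := R) r (ι c) t * h))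
    (hxc : Commute x' c) (hcr : c ^ r = 1) {a : ℕ} (ha : a < d) :
    D.G (h • M.gX X Δ a) = op h • h • M.gX X Δ a := by
  set e := avg (R := R) r (ι c) t with he
  set f := avg (R := R) r (Algebra.lsmul R Aᵐᵒᵖ Q (ι c)) M.τ with hf
  have hGe (x : Q) : D.G (e • x) = f (D.G x) := by
    have h1 := mul_avg_of_semiconj (R := R) (r := r) (D.commute_G_ι c) D.G_mul_lsmul_t
    rw [← map_avg (R := R)] at h1
    exact LinearMap.congr_fun h1 x
  have hGf (x : Q) : D.G (f x) = e • D.G x := by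
    have h1 := mul_avg_of_semiconj (R := R) (r := r) (D.commute_G_ι c) D.G_mul_τ
    rw [← map_avg (R := R)] at h1
    exact LinearMap.congr_fun h1 x
  have hhε (x : Q) : h • M.ε x = f (h • x) := by
    have h1 := mul_avg_of_semiconj (R := R) (r := r) (g := Algebra.lsmul R Aᵐᵒᵖ Q h)
      (a := Algebra.lsmul R Aᵐᵒᵖ Q t) (a' := Algebra.lsmul R Aᵐᵒᵖ Q (ι c))
      (by rw [← map_mul, hht, map_mul]) (M.commute_lsmul_τ h)
    exact LinearMap.congr_fun h1 x
  have hef (x : Q) : e • M.ε x = f (e • x) := by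
    have h0 : Algebra.lsmul R Aᵐᵒᵖ Q e = avg (R := R) r (Algebra.lsmul R Aᵐᵒᵖ Q (ι c))
      (Algebra.lsmul R Aᵐᵒᵖ Q t) := map_avg (R := R) r _ _ _
    have h1 : Algebra.lsmul R Aᵐᵒᵖ Q e * M.ε = Algebra.lsmul R Aᵐᵒᵖ Q e * f := by
      rw [h0]
      exact avg_mul_avg ((D.t_ι c).symm.map _) (by rw [← map_pow, ← map_pow, hcr, map_one, map_one])
        (by rw [← map_pow, D.t_pow, map_one])
    have h2 : Commute (Algebra.lsmul R Aᵐᵒᵖ Q e) f := by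
      rw [h0]
      refine Commute.avg_right (Commute.symm (Commute.avg_right (Commute.refl _) ?_))
        (Commute.symm (Commute.avg_right ?_ ?_))
      · exact (D.t_ι c).symm.map _
      · exact (M.commute_lsmul_τ _).symm
      · exact (M.commute_lsmul_τ _).symm
    exact LinearMap.congr_fun (h1.trans h2.eq) x
  have hhX : h * X = ι x' * h + Δ • (e * X) := by
    have hxe : Commute (ι x') e := Commute.avg_right (hxc.map ι) (D.t_ι x').symm
    rw [hX, mul_assoc h (ι x') h, ← mul_assoc h h, hhh, add_mul, one_mul, smul_mul_assoc,
      mul_assoc e]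
  have hX_smul (x : Q) : h • X • x = ι x' • h • x + Δ • e • X • x := by
    rw [smul_smul, hhX, add_smul, smul_assoc, mul_smul, mul_smul]
  have hGι (b : B) (x : Q) : D.G (ι b • x) = ι b • D.G x :=
    LinearMap.congr_fun (D.commute_G_ι b).eq x
  induction a with
  | zero => rw [ExtModel.gX, D.G_p, D.γ_H h rfl, smul_op_smul]
  | succ a ih =>
    have ih := ih (by omega)
    have hξ : op h • op h • M.ξ (a + 1) = M.ξ (a + 1) + Δ • e • h • M.ξ (a + 1) := by
      rw [op_smul_op_smul, ← M.smul_ξ, hhh, add_smul, one_smul, smul_assoc, mul_smul]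
    have h1 : D.G (h • M.gX X Δ (a + 1)) = ι x' • op h • h • M.gX X Δ a + Δ • f (M.ξ (a + 1)) +
        Δ • e • op h • M.gX X Δ (a + 1) := by
      rw [ExtModel.gX, smul_add, hX_smul, map_add, map_add, hGι, ih, LinearMap.map_smul_of_tower,
        hGe, D.G_X_gX ha, smul_comm h Δ, LinearMap.map_smul_of_tower, hhε, hGf, M.smul_ξ,
        map_smul, D.G_ξ_zero ha, ExtModel.gX]
    have h2 : op h • h • M.gX X Δ (a + 1) = ι x' • op h • h • M.gX X Δ a +
        Δ • e • op h • X • M.gX X Δ a + Δ • f (M.ξ (a + 1)) +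
        Δ • Δ • f (e • h • M.ξ (a + 1)) := by
      rw [ExtModel.gX, smul_add, hX_smul, smul_add, smul_add, ← smul_op_smul, smul_comm h Δ, hhε,
        smul_comm _ Δ, smul_comm _ Δ, ← smul_op_smul e, M.smul_ξ, ← map_smul, hξ, map_add, smul_add,
        LinearMap.map_smul_of_tower, M.smul_ξ]
      abel
    rw [h1, h2, ExtModel.gX, smul_add, smul_add, smul_add, smul_comm (op h) Δ, smul_comm e Δ,
      ← map_smul M.ε, hef, M.smul_ξ]
    abel

variable {B' : Type u} [Ring B'] [Algebra R B'] (κ : B' →ₐ[R] B) (K : Set B)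

/-- The braid relation between `G` and the last generator `h` of type `g` of the smaller algebra
`A`. The algebra `B` is generated over `B'` by its last generators `x'`, `c` and by the set `K`,
which contains its last generator of type `g`, if there is one. By `braid_defect_mul_left` the
kernel of the defect is stable under `G` and `h`; it contains the `ξ i` by `G_h_gX`, and the
elements `b h p` because they can be rewritten in terms of the generators of `B`. -/
theorem braid {x' c : B} (hht : h * t = ι c * h) (hhc : h * ι c = t * h)
    (hX : X = h * ι x' * h) (hhh : h * h = 1 + Δ • (avg (R := R) r (ι c) t * h))
    (hxc : Commute x' c) (hcr : c ^ r = 1) (hhκ : ∀ b, Commute h (ι (κ b)))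
    (hK : ∀ k ∈ K, h * ι k * h = ι k * h * ι k)
    (hspan : ∀ S : Submodule R B, (∀ i < d, ∀ j b, x' ^ i * c ^ j * κ b ∈ S) →
      (∀ k ∈ K, ∀ b b', κ b * k * κ b' ∈ S) → S = ⊤) :
    D.G * Algebra.lsmul R Aᵐᵒᵖ Q h * D.G =
      Algebra.lsmul R Aᵐᵒᵖ Q h * D.G * Algebra.lsmul R Aᵐᵒᵖ Q h := by
  set e := avg (R := R) r (ι c) t with he
  set G := D.G with hG
  set l : A →ₐ[R] Module.End Aᵐᵒᵖ Q := Algebra.lsmul R Aᵐᵒᵖ Q with hl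
  set τ := M.τ with hτ
  set P := G * l h * G - l h * G * l h with hP
  have hGt : G * l t = τ * G := D.G_mul_lsmul_t
  have hGτ : G * τ = l t * G := D.G_mul_τ
  have hGc : G * l (ι c) = l (ι c) * G := (D.commute_G_ι c).eq
  have hlht : l h * l t = l (ι c) * l h := by rw [← map_mul, hht, map_mul]
  have hlhc : l h * l (ι c) = l t * l h := by rw [← map_mul, hhc, map_mul]
  have hlhτ : l h * τ = τ * l h := (M.commute_lsmul_τ h).eq
  -- `P` intertwines `h` with `-g⁻¹` and, by symmetry, `g` with `-h⁻¹`
  have hPh : P * l h = (Δ • M.ε - G) * P := by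
    refine braid_defect_mul_left hlhc hlhτ hGt hGc D.G_mul_G ?_
    rw [← map_mul, hhh, map_add, map_one, map_smul, map_mul, map_avg]
  have hcr' : ι c ^ r = 1 := by rw [← map_pow, hcr, map_one]
  have hPG : P * G = (Δ • l e - l h) * P := by
    have hle : l e = avg (R := R) r (l t) (l (ι c)) := by
      rw [← map_avg, he, avg_symm (D.t_ι c).symm hcr' D.t_pow]
    have h1 := braid_defect_mul_left (R := R) (r := r) (Δ := Δ) (g := l h) (h := G)
      (t := l t) (c := τ) (τ := l (ι c)) hGτ hGc hlht hlhτ ?_ ?_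
    · rw [hP, ← neg_sub (l h * G * l h), neg_mul, mul_neg, h1, hle]
    · rw [← hle, ← map_mul, hhh, map_add, map_one, map_smul, map_mul]
    · rw [D.G_mul_G, ExtModel.ε, avg_symm (M.commute_lsmul_τ t)
        (by rw [← map_pow, D.t_pow, map_one])
        M.τ_pow]
  have hPt : P * l t = l t * P := by
    have h1 : G * l h * G * l t = l t * (G * l h * G) := by
      rw [mul_assoc _ G, hGt, ← mul_assoc, mul_assoc _ (l h) τ, hlhτ, ← mul_assoc, hGτ]
      simp only [mul_assoc]
    have h2 : l h * G * l h * l t = l t * (l h * G * l h) := by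
      rw [mul_assoc _ (l h), hlht, ← mul_assoc, mul_assoc _ G, hGc, ← mul_assoc, hlhc]
      simp only [mul_assoc]
    rw [hP, sub_mul, mul_sub, h1, h2]
  have hPτ : P * τ = l (ι c) * P := by
    have h1 : G * l h * G * τ = l (ι c) * (G * l h * G) := by
      rw [mul_assoc _ G, hGτ, ← mul_assoc, mul_assoc _ (l h) (l t), hlht, ← mul_assoc, hGc]
      simp only [mul_assoc]
    have h2 : l h * G * l h * τ = l (ι c) * (l h * G * l h) := by
      rw [mul_assoc _ (l h), hlhτ, ← mul_assoc, mul_assoc _ G, hGτ, ← mul_assoc, hlht]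
      simp only [mul_assoc]
    rw [hP, sub_mul, mul_sub, h1, h2]
  have hPc : P * l (ι c) = τ * P := by
    have h1 : G * l h * G * l (ι c) = τ * (G * l h * G) := by
      rw [mul_assoc _ G, hGc, ← mul_assoc, mul_assoc _ (l h) (l (ι c)), hlhc, ← mul_assoc, hGt]
      simp only [mul_assoc]
    have h2 : l h * G * l h * l (ι c) = τ * (l h * G * l h) := by
      rw [mul_assoc _ (l h), hlhc, ← mul_assoc, mul_assoc _ G, hGt, ← mul_assoc, hlhτ]
      simp only [mul_assoc]
    rw [hP, sub_mul, mul_sub, h1, h2]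
  have hPκ (b : B') : P * l (ι (κ b)) = l (ι (κ b)) * P := by
    have h1 : Commute (l h) (l (ι (κ b))) := (hhκ b).map l
    have h2 : Commute G (l (ι (κ b))) := D.commute_G_ι _
    exact (((h2.mul_left h1).mul_left h2).sub_left ((h1.mul_left h2).mul_left h1)).eq
  have hξ : ∀ i < d, M.ξ i ∈ LinearMap.ker P := fun i hi => by
    rw [LinearMap.mem_ker, hP]
    simp only [LinearMap.sub_apply, Module.End.mul_apply, hl, Algebra.lsmul_coe]
    rw [D.G_ξ_zero hi, D.G_h_gX hht hX hhh hxc hcr hi, M.smul_ξ, map_smul G, D.G_ξ_zero hi,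
      smul_op_smul, sub_self]
  have hg : ∀ i < d, M.gX X Δ i ∈ LinearMap.ker P := fun i hi => by
    rw [← D.G_ξ_zero hi]; exact mem_ker_of_mul_eq hPG (hξ i hi)
  have hXp (i : ℕ) (hi : i < d) (j : ℕ) (b : B) : (X ^ i * t ^ j * ι b) • M.p ∈ LinearMap.ker P :=
    D.smul_p_mem (fun x hx => mem_ker_of_mul_eq hPt hx)
      (fun x hx => mem_ker_of_mul_eq hPτ hx) hξ hg hi j b
  have hΔ : ∀ x ∈ LinearMap.ker P, Δ • x ∈ LinearMap.ker P := fun x hx => by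
    rw [← algebraMap_smul Aᵐᵒᵖ Δ]; exact Submodule.smul_mem _ _ hx
  have hemem : ∀ x ∈ LinearMap.ker P, e • x ∈ LinearMap.ker P := fun x hx => by
    have h1 := avg_apply_mem (R := R) (r := r) (f := l (ι c)) (g := l t)
      (fun x hx => mem_ker_of_mul_eq hPc hx) (fun x hx => mem_ker_of_mul_eq hPt hx) x hx
    rwa [← map_avg] at h1
  have hhX : h * X = ι x' * h + Δ • (e * X) := by
    have hxe : Commute (ι x') e := Commute.avg_right (hxc.map ι) (D.t_ι x').symm
    rw [hX, mul_assoc h (ι x') h, ← mul_assoc h h, hhh, add_mul, one_mul, smul_mul_assoc,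
      mul_assoc e]
  have hxe (i : ℕ) : Commute (ι x' ^ i) e :=
    Commute.pow_left (Commute.avg_right (hxc.map ι) (D.t_ι x').symm) i
  -- moving a factor `x'` past `h` turns it into a factor `X`
  have hxhX : ∀ i a, i + a < d → (ι x' ^ i * (h * X ^ a)) • M.p ∈ LinearMap.ker P := by
    intro i
    induction i with
    | zero =>
      intro a ha
      rw [pow_zero, one_mul, mul_smul]
      refine mem_ker_of_mul_eq hPh ?_
      simpa using hXp a (by omega) 0 1
    | succ i ih =>
      intro a ha
      have h1 : ι x' ^ (i + 1) * (h * X ^ a) =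
          ι x' ^ i * (h * X ^ (a + 1)) - Δ • (e * (X ^ (a + 1) * ι (x' ^ i))) := by
        have h2 := ((D.X_ι x').pow_pow (a + 1) i).eq
        have h3 : h * X ^ (a + 1) - Δ • (e * X ^ (a + 1)) = ι x' * (h * X ^ a) := by
          rw [pow_succ' X, ← mul_assoc h, ← mul_assoc e, hhX, add_mul, smul_mul_assoc,
            add_sub_cancel_right, mul_assoc]
        rw [map_pow, h2, ← mul_assoc e, ← (hxe i).eq, mul_assoc (ι x' ^ i), ← mul_smul_comm,
          ← mul_sub, h3, pow_succ, mul_assoc]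
      rw [h1, sub_smul, smul_assoc, mul_smul e]
      refine Submodule.sub_mem _ (ih (a + 1) (by omega)) (hΔ _ (hemem _ ?_))
      simpa using hXp (a + 1) (by omega) 0 (x' ^ i)
  have hcpow (j : ℕ) : ∀ x ∈ LinearMap.ker P, ι c ^ j • x ∈ LinearMap.ker P := by
    induction j with
    | zero => intro x hx; simpa using hx
    | succ j ih =>
      intro x hx
      rw [pow_succ', mul_smul]
      exact mem_ker_of_mul_eq hPc (ih x hx)
  have hkp (k : B) (hk : k ∈ K) : (ι k * h) • M.p ∈ LinearMap.ker P := by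
    have hGk (x : Q) : G (ι k • x) = ι k • G x := LinearMap.congr_fun (D.commute_G_ι k).eq x
    have hGh : G (h • M.p) = h • op h • M.p := by rw [hG, D.G_p, D.γ_H h rfl]
    have hk' := hK k hk
    rw [LinearMap.mem_ker, hP]
    simp only [LinearMap.sub_apply, Module.End.mul_apply, hl, Algebra.lsmul_coe]
    have h1 : h • (ι k * h) • M.p = op (ι k) • ι k • h • M.p := by
      rw [smul_smul, ← mul_assoc, hk', mul_smul, M.ι_smul_p, smul_op_smul, mul_smul]
    have h2 : G (h • G ((ι k * h) • M.p)) =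
        op h • op (ι k) • ι k • op h • h • M.p := by
      rw [mul_smul, hGk, hGh, smul_smul (ι k), smul_op_smul, smul_op_smul, map_smul G, h1,
        map_smul G,
        hGk, hGh, smul_op_smul h]
    have h3 : h • G (h • (ι k * h) • M.p) = op (ι k) • op h • op (ι k) • ι k • h • M.p := by
      rw [h1, map_smul G, hGk, hGh, smul_smul (ι k), smul_op_smul h, smul_op_smul (ι k * h),
        smul_op_smul h, h1]
    rw [h2, h3, smul_op_smul (ι k)]
    simp only [op_smul_op_smul]
    rw [hk', sub_self]
  have hbh (b : B) : (ι b * h) • M.p ∈ LinearMap.ker P := by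
    let S : Submodule R B := ((LinearMap.ker P).restrictScalars R).comap
      ((LinearMap.toSpanSingleton A Q M.p).restrictScalars R ∘ₗ LinearMap.mulRight R h ∘ₗ
        ι.toLinearMap)
    have hS : S = ⊤ := by
      refine hspan S (fun i hi j b => ?_) (fun k hk b b' => ?_)
      · change (ι (x' ^ i * c ^ j * κ b) * h) • M.p ∈ LinearMap.ker P
        have h1 : ι (x' ^ i * c ^ j * κ b) * h = ι c ^ j * (ι x' ^ i * h) * ι (κ b) := by
          rw [(hxc.pow_pow i j).eq, map_mul, map_mul, mul_assoc, ← (hhκ b).eq]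
          simp only [map_pow, mul_assoc]
        rw [h1, mul_smul, M.ι_smul_p, smul_op_smul, mul_smul]
        refine Submodule.smul_mem _ _ (hcpow j _ ?_)
        simpa using hxhX i 0 (by omega)
      · change (ι (κ b * k * κ b') * h) • M.p ∈ LinearMap.ker P
        have h1 : ι (κ b * k * κ b') * h = ι (κ b) * (ι k * h) * ι (κ b') := by
          rw [map_mul, map_mul, mul_assoc, ← (hhκ b').eq]
          simp only [mul_assoc]
        rw [h1, mul_smul, M.ι_smul_p, smul_op_smul, mul_smul]
        exact Submodule.smul_mem _ _ (mem_ker_of_mul_eq (hPκ b) (hkp k hk))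
    exact (hS ▸ Submodule.mem_top : b ∈ S)
  have hτpow (j : ℕ) : ∀ x ∈ LinearMap.ker P, (τ ^ j) x ∈ LinearMap.ker P := by
    induction j with
    | zero => intro x hx; simpa using hx
    | succ j ih =>
      intro x hx
      rw [pow_succ', Module.End.mul_apply]
      exact mem_ker_of_mul_eq hPτ (ih x hx)
  have h0 : P = 0 := by
    refine M.end_ext (fun a => ?_) fun i hi j => ?_
    · refine D.eqOn_span (f := P.restrictScalars R ∘ₗ
        (LinearMap.toSpanSingleton A Q M.p).restrictScalars R)
        (g := 0) (fun i hi j b => hXp i hi j b)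
        ?_ a
      rintro _ rfl b b'
      change (ι b * _ * ι b') • M.p ∈ LinearMap.ker P
      rw [mul_smul, M.ι_smul_p, smul_op_smul]
      exact Submodule.smul_mem _ _ (hbh b)
    · exact LinearMap.mem_ker.1 (hτpow j _ (hξ i hi))
  exact sub_eq_zero.1 h0

end ExtOp

/-! ### Extending a homomorphism to the next algebra -/

namespace Cyc

variable {R : Type u} [CommRing R] {d r m : ℕ} [Invertible (r : R)] {q : Rˣ} {v : Fin d → Rˣ}

/-- An algebra homomorphism from `Y_{r,m+1}^d` extends to `Y_{r,m+2}^d` as soon as there are values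
for the new generators that satisfy the relations involving them. -/
theorem exists_extend {S : Type u} [Ring S] [Algebra R S] (l : Cyc r (m + 1) q v →ₐ[R] S) (G τ : S)
    (hτ : ∀ y, Commute τ (l y)) (hτr : τ ^ r = 1)
    (hG : ∀ y, Commute G (l (incl r m q v y)))
    (hGt : G * l (lastT r m q v) = τ * G) (hGτ : G * τ = l (lastT r m q v) * G)
    (hGG : G * G = 1 + ((q : R) - ((q⁻¹ : Rˣ) : R)) •
      (avg (R := R) r (l (lastT r m q v)) τ * G))
    (hbraid : ∀ i (hi : i + 1 < m + 1), i + 1 = m → G * l (gen r (m + 1) q v (.g i hi)) * G =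
      l (gen r (m + 1) q v (.g i hi)) * G * l (gen r (m + 1) q v (.g i hi)))
    (hrefl : m = 0 → G * l (gen r (m + 1) q v (.x m.succ_pos)) * G *
        l (gen r (m + 1) q v (.x m.succ_pos)) =
      l (gen r (m + 1) q v (.x m.succ_pos)) * G * l (gen r (m + 1) q v (.x m.succ_pos)) * G) :
    ∃ F : Cyc r (m + 1 + 1) q v →ₐ[R] S, (∀ y, F (incl r (m + 1) q v y) = l y) ∧
      F (lastG r m q v) = G ∧ F (lastT r (m + 1) q v) = τ := by
  let f : Gen (m + 1 + 1) → S := fun z => match z with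
    | .t i => Fin.lastCases (motive := fun _ => S) τ (fun j => l (gen r (m + 1) q v (.t j))) i
    | .g i _ => if hi : i + 1 < m + 1 then l (gen r (m + 1) q v (.g i hi)) else G
    | .x _ => l (gen r (m + 1) q v (.x m.succ_pos))
    | .xinv _ => l (gen r (m + 1) q v (.xinv m.succ_pos))
  have hft (j : Fin (m + 1)) : f (.t j.castSucc) = l (gen r (m + 1) q v (.t j)) := by simp [f]
  have hfτ : f (.t (Fin.last (m + 1))) = τ := by simp [f]
  have hfg (i : ℕ) (hi' : i + 1 < m + 1 + 1) (hi : i + 1 < m + 1) :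
      f (.g i hi') = l (gen r (m + 1) q v (.g i hi)) := by simp only [f, dif_pos hi]
  have hfG (i : ℕ) (hi' : i + 1 < m + 1 + 1) (hi : ¬ i + 1 < m + 1) : f (.g i hi') = G := by
    simp only [f, dif_neg hi]
  have hfx (h : 0 < m + 1 + 1) : f (.x h) = l (gen r (m + 1) q v (.x m.succ_pos)) := rfl
  have hfy (h : 0 < m + 1 + 1) : f (.xinv h) = l (gen r (m + 1) q v (.xinv m.succ_pos)) := rfl
  have hGl (z : Gen m) : Commute G (l (gen r (m + 1) q v z.incl)) := by
    rw [← incl_gen]; exact hG _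
  have hrel : ∀ a b, AffRel r (m + 1 + 1) q a b →
      FreeAlgebra.lift R f a = FreeAlgebra.lift R f b := by
    intro a b hab
    cases hab with
    | g_g i hi j hj hij =>
      simp only [map_mul, FreeAlgebra.lift_ι_apply]
      by_cases h1 : i + 1 < m + 1
      · by_cases h2 : j + 1 < m + 1
        · rw [hfg i hi h1, hfg j hj h2]
          exact (((gen_g_g (r := r) (q := q) (v := v) i h1 j h2 hij).map l).eq :)
        · rw [hfg i hi h1, hfG j hj h2]
          exact ((hGl (.g i (by omega))).symm.eq :)
      · rw [hfg j hj (by omega), hfG i hi h1]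
        exact ((hGl (.g j (by omega))).eq :)
    | g_g_g i hi hi' =>
      simp only [map_mul, FreeAlgebra.lift_ι_apply]
      rw [hfg i hi (by omega)]
      by_cases h1 : i + 1 + 1 < m + 1
      · rw [hfg (i + 1) hi' h1, ← map_mul, ← map_mul, gen_braid i (by omega) h1, map_mul, map_mul]
      · rw [hfG (i + 1) hi' h1, hbraid i (by omega) (by omega)]
    | t_t i j =>
      simp only [map_mul, FreeAlgebra.lift_ι_apply]
      rcases Fin.eq_castSucc_or_eq_last i with ⟨i, rfl⟩ | rfl <;>
        rcases Fin.eq_castSucc_or_eq_last j with ⟨j, rfl⟩ | rfl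
      · rw [hft, hft]; exact ((gen_t_t i j).map l).eq
      · rw [hft, hfτ]; exact (hτ _).symm.eq
      · rw [hft, hfτ]; exact (hτ _).eq
      · rfl
    | g_t i hi j =>
      simp only [map_mul, FreeAlgebra.lift_ι_apply]
      by_cases h1 : i + 1 < m + 1
      · rcases Fin.eq_castSucc_or_eq_last j with ⟨j, rfl⟩ | rfl
        · rw [← castSucc_swapAt i h1, hft, hft, hfg i hi h1, ← map_mul, gen_g_t, map_mul]
        · rw [swapAt_of_ne _ (by simp; omega) (by simp; omega), hfτ, hfg i hi h1]
          exact (hτ _).symm.eq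
      · obtain rfl : i = m := by omega
        rw [hfG i hi h1]
        rcases Fin.eq_castSucc_or_eq_last j with ⟨j, rfl⟩ | rfl
        · rcases Fin.eq_castSucc_or_eq_last j with ⟨j, rfl⟩ | rfl
          · have := j.2
            rw [swapAt_of_ne _ (by simp; omega) (by simp; omega), hft]
            exact (hGl (.t j)).eq
          · have h2 : swapAt i hi (Fin.last i).castSucc = Fin.last (i + 1) := by
              simp [swapAt, Equiv.swap_apply_def, Fin.ext_iff]
            rw [h2, hft, hfτ]; exact hGt
        · have h2 : swapAt i hi (Fin.last (i + 1)) = (Fin.last i).castSucc := by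
            simp [swapAt, Equiv.swap_apply_def, Fin.ext_iff]
          rw [h2, hft, hfτ]; exact hGτ
    | t_pow i =>
      simp only [map_pow, map_one, FreeAlgebra.lift_ι_apply]
      rcases Fin.eq_castSucc_or_eq_last i with ⟨i, rfl⟩ | rfl
      · rw [hft, ← map_pow, gen_t_pow, map_one]
      · rw [hfτ, hτr]
    | g_sq i hi =>
      simp only [map_add, map_one, map_smul, map_mul, map_pow, map_avg, FreeAlgebra.lift_ι_apply]
      by_cases h1 : i + 1 < m + 1
      · have h2 := congrArg l (gen_g_sq (r := r) (q := q) (v := v) i h1)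
        rw [map_add, map_one, map_smul, map_mul, map_mul, map_avg] at h2
        have h3 := hft ⟨i, by omega⟩
        have h4 := hft ⟨i + 1, h1⟩
        simp only [Fin.castSucc_mk] at h3 h4
        rw [hfg i hi h1, sq, h3, h4]
        exact h2
      · obtain rfl : i = m := by omega
        rw [hfG i hi h1, sq, hGG]
        congr 4
        · exact (hft (Fin.last i)).symm
        · exact hfτ.symm
    | x_xinv h =>
      simp only [map_mul, map_one, FreeAlgebra.lift_ι_apply]
      rw [hfx h, hfy h, ← map_mul, gen_x_xinv, map_one]
    | xinv_x h =>
      simp only [map_mul, map_one, FreeAlgebra.lift_ι_apply]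
      rw [hfx h, hfy h, ← map_mul, gen_xinv_x, map_one]
    | g_x_g_x h h' =>
      simp only [map_mul, FreeAlgebra.lift_ι_apply]
      rw [hfx h]
      by_cases h1 : 0 + 1 < m + 1
      · rw [hfg 0 h' h1]
        simp only [← map_mul]
        rw [gen_g_x_g_x]
      · rw [hfG 0 h' h1]
        exact hrefl (by omega)
    | g_x h i hi hi' =>
      simp only [map_mul, FreeAlgebra.lift_ι_apply]
      rw [hfx h]
      by_cases h1 : i + 1 < m + 1
      · rw [hfg i hi h1]
        simp only [← map_mul]
        exact congrArg l (gen_g_x _ i h1 hi').eq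
      · rw [hfG i hi h1]
        exact ((hGl (.x (by omega))).eq :)
    | t_x h j =>
      simp only [map_mul, FreeAlgebra.lift_ι_apply]
      rw [hfx h]
      rcases Fin.eq_castSucc_or_eq_last j with ⟨j, rfl⟩ | rfl
      · rw [hft]; exact ((gen_t_x _ j).map l).eq
      · rw [hfτ]; exact (hτ _).eq
  have hcyc : ∀ h : 0 < m + 1 + 1,
      (List.ofFn fun k : Fin d => f (.x h) - algebraMap R S (v k : R)).prod = 0 := by
    intro h
    have h1 := congrArg l (prod_x_sub (r := r) (q := q) (v := v) m.succ_pos)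
    rw [map_list_prod, List.map_ofFn, map_zero] at h1
    rw [← h1]
    congr 2
    funext k
    simp [hfx]
  obtain ⟨F, hF⟩ := exists_lift (r := r) (q := q) (v := v) f hrel hcyc
  refine ⟨F, fun y => ?_, ?_, ?_⟩
  · refine DFunLike.congr_fun (f := F.comp (incl r (m + 1) q v)) (g := l)
      (algHom_ext fun z => ?_) y
    rw [AlgHom.comp_apply, incl_gen, hF]
    cases z with
    | t i => exact hft i
    | g i h => exact hfg i (by omega) h
    | x h => exact hfx (by omega)
    | xinv h => exact hfy (by omega)
  · rw [lastG, hF, hfG m (by omega) (by omega)]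
  · rw [lastT, hF, hfτ]

end Cyc

/-! ### Forms on powers and the dual family of the monomials -/

/-- A bimodule map `θ : A' → A` for an extension `ι : A → A'`, with the values of the projection to
the coefficient of `1` on the monomials `X^i t^j`, where `X` and `t` commute with `A` and each
other, `t^r = 1`, and `θ` takes on `X^d` the value that an equation `X^d = ⋯ + c` over `A` would
imply. -/
structure FormOnPowers {R A A' : Type u} [CommRing R] [Ring A] [Algebra R A]
    [Ring A'] [Algebra R A']
    (ι : A →ₐ[R] A') (X t : A') (d r : ℕ) (c : R) (θ : A' →ₗ[R] A) : Prop where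
  t_pow : t ^ r = 1
  t_X : Commute t X
  t_ι : ∀ a, Commute t (ι a)
  X_ι : ∀ a, Commute X (ι a)
  map_left : ∀ a y, θ (ι a * y) = a * θ y
  map_right : ∀ y a, θ (y * ι a) = θ y * a
  map_pow : ∀ i < d, ∀ j < r, θ (X ^ i * t ^ j) = if i = 0 ∧ j = 0 then 1 else 0
  map_top : ∀ j < r, θ (X ^ d * t ^ j) = if j = 0 then algebraMap R A c else 0

namespace FormOnPowers

variable {R A A' : Type u} [CommRing R] [Ring A] [Algebra R A] [Ring A'] [Algebra R A']
  {ι : A →ₐ[R] A'} {X t : A'} {d r : ℕ} {c : R} {θ : A' →ₗ[R] A}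

theorem pow_mod (h : FormOnPowers ι X t d r c θ) (j : ℕ) : t ^ j = t ^ (j % r) := by
  conv_lhs => rw [← Nat.mod_add_div j r, pow_add, pow_mul, h.t_pow, one_pow, mul_one]

theorem commute_pow (h : FormOnPowers ι X t d r c θ) (i j : ℕ) (a : A) :
    Commute (X ^ i * t ^ j) (ι a) :=
  ((h.X_ι a).pow_left i).mul_left ((h.t_ι a).pow_left j)

theorem map_pow_mem_center (h : FormOnPowers ι X t d r c θ) (i j : ℕ) :
    θ (X ^ i * t ^ j) ∈ Subalgebra.center R A :=
  Subalgebra.mem_center_iff.2 fun a => by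
    rw [← h.map_left, ← (h.commute_pow i j a).eq, h.map_right]

theorem pow_mul_pow (h : FormOnPowers ι X t d r c θ) (i j k l : ℕ) :
    X ^ i * t ^ j * (X ^ k * t ^ l) = X ^ (i + k) * t ^ (j + l) := by
  rw [mul_assoc, ← mul_assoc (t ^ j), (h.t_X.pow_pow j k).eq, pow_add, pow_add]
  simp only [mul_assoc]

variable [NeZero r]

theorem map_pow_mod (h : FormOnPowers ι X t d r c θ) {i : ℕ} (hi : i < d) (j : ℕ) :
    θ (X ^ i * t ^ j) = if i = 0 ∧ r ∣ j then 1 else 0 := by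
  rw [h.pow_mod, h.map_pow i hi _ (Nat.mod_lt _ (NeZero.pos r))]
  simp only [Nat.dvd_iff_mod_eq_zero]

theorem map_top_mod (h : FormOnPowers ι X t d r c θ) (j : ℕ) :
    θ (X ^ d * t ^ j) = if r ∣ j then algebraMap R A c else 0 := by
  rw [h.pow_mod, h.map_top _ (Nat.mod_lt _ (NeZero.pos r))]
  simp only [Nat.dvd_iff_mod_eq_zero]

/-- The monomials have a dual family `Y`, as their Gram matrix is invertible: if the row of
`X^i t^j` is moved to the position of `X^{d-i} t^{r-j}`, exponents being read modulo `d` and `r`,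
then it is triangular with the units `1` and `c` on the diagonal. Its entries are central in `A`,
so that the theory of determinants applies; the `Y k` are combinations of the monomials with
central coefficients. -/
theorem exists_dual (h : FormOnPowers ι X t d r c θ) (hc : IsUnit c) :
    ∃ Y : Fin d × Fin r → A', (∀ k a, Commute (Y k) (ι a)) ∧
      (∀ S : Submodule R A', (∀ i < d, ∀ j a, ι a * (X ^ i * t ^ j) ∈ S) → ∀ k, Y k ∈ S) ∧
      (∀ k l, θ (Y k * (X ^ (l.1 : ℕ) * t ^ (l.2 : ℕ))) = if k = l then 1 else 0) ∧
      ∀ i < d, ∀ j, ∑ k, ι (θ (X ^ i * t ^ j * (X ^ (k.1 : ℕ) * t ^ (k.2 : ℕ)))) * Y k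
        = X ^ i * t ^ j := by
  set I := Fin d ×ₗ Fin r
  let e : Fin d → ℕ := fun a => if (a : ℕ) = 0 then 0 else d - a
  have he (a : Fin d) : e a < d := by
    simp only [e]; split_ifs <;> omega
  -- the monomials, in the order of the rows of the triangular matrix `P`
  let W : I → A' := fun k => X ^ e (ofLex k).1 * t ^ (r - (ofLex k).2 : ℕ)
  let P : Matrix I I (Subalgebra.center R A) := Matrix.of fun k l =>
    ⟨θ (X ^ (e (ofLex k).1 + (ofLex l).1) * t ^ (r - (ofLex k).2 + (ofLex l).2 : ℕ)),
      h.map_pow_mem_center _ _⟩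
  have hP (k l : I) : (P k l : A) = θ (W k * (X ^ ((ofLex l).1 : ℕ) * t ^ ((ofLex l).2 : ℕ))) := by
    simp only [W, h.pow_mul_pow]; rfl
  have hdvd (b b' : Fin r) : r ∣ r - (b' : ℕ) + b ↔ b' = b := by
    constructor
    · rintro ⟨m, hm⟩
      have := b.2; have := b'.2
      rcases m with _ | _ | m
      · omega
      · refine Fin.ext ?_; omega
      · have : r * (m + 1 + 1) = r * m + r + r := by ring
        have : 0 ≤ r * m := Nat.zero_le _
        omega
    · rintro rfl
      have := b'.2
      rw [Nat.sub_add_cancel (by omega)]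
  have hdiag (k l : I) (hkl : (ofLex k).1 = (ofLex l).1) :
      (P k l : A) =
        if k = l then (if ((ofLex k).1 : ℕ) = 0 then 1 else algebraMap R A c) else 0 := by
    have h2 : k = l ↔ (ofLex k).2 = (ofLex l).2 := by
      rw [← ofLex_inj, Prod.ext_iff]; simp [hkl]
    have h1 := (ofLex k).1.2
    change θ (X ^ (e (ofLex k).1 + (ofLex l).1) * _) = _
    rw [← hkl]
    by_cases h0 : ((ofLex k).1 : ℕ) = 0
    · simp only [e, h0, if_true, add_zero]
      rw [h.map_pow_mod (by omega)]
      simp only [hdvd, h2, true_and]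
    · simp only [e, h0, if_false]
      rw [Nat.sub_add_cancel h1.le, h.map_top_mod]
      simp only [hdvd, h2]
  have htri : P.BlockTriangular id := by
    intro k l hlk
    refine Subtype.ext ?_
    rcases Prod.Lex.lt_iff.1 hlk with h1 | ⟨h1, h2⟩
    · have h1' : ((ofLex l).1 : ℕ) < (ofLex k).1 := h1
      have h2 := (ofLex k).1.2
      change θ (X ^ (e (ofLex k).1 + (ofLex l).1) * _) = 0
      have h3 : e (ofLex k).1 = d - (ofLex k).1 := by simp only [e]; rw [if_neg (by omega)]
      rw [h3, h.map_pow_mod (by omega), if_neg (by omega)]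
    · rw [hdiag k l h1.symm, if_neg (by rintro rfl; exact lt_irrefl _ h2)]; rfl
  have hdet : IsUnit P.det := by
    rw [Matrix.det_of_isUpperTriangular htri, IsUnit.prod_univ_iff]
    intro k
    have h1 : P k k = algebraMap R _ (if ((ofLex k).1 : ℕ) = 0 then 1 else c) := by
      refine Subtype.ext ?_
      rw [hdiag k k rfl, if_pos rfl]
      split_ifs
      · simp
      · rfl
    rw [h1]
    refine IsUnit.map _ ?_
    split_ifs
    · exact isUnit_one
    · exact hc
  let N := P⁻¹
  have hNP : N * P = 1 := Matrix.nonsing_inv_mul P hdet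
  have hPN : P * N = 1 := Matrix.mul_nonsing_inv P hdet
  have hNc (k l : I) (a : A) : Commute (N k l : A) a :=
    (Subalgebra.mem_center_iff.1 (N k l).2 a).symm
  have hWc (k : I) (a : A) : Commute (W k) (ι a) := h.commute_pow _ _ a
  let Y : I → A' := fun k => ∑ l, ι (N k l) * W l
  refine ⟨fun k => Y (toLex k), fun k a => ?_, fun S hS k => ?_, fun k l => ?_, fun i hi j => ?_⟩
  · exact Commute.sum_left _ _ _ fun l _ => ((hNc _ _ a).map ι).mul_left (hWc l a)
  · exact S.sum_mem fun l _ => hS _ (he _) _ _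
  · have h1 := congrArg (Subtype.val) (congrFun (congrFun hNP (toLex k)) (toLex l))
    rw [Matrix.mul_apply, Matrix.one_apply] at h1
    simp only [Y, Finset.sum_mul, map_sum, mul_assoc (ι _), h.map_left]
    refine Eq.trans ?_ (h1.trans ?_)
    · rw [AddSubmonoidClass.coe_finsetSum]
      refine Finset.sum_congr rfl fun m _ => ?_
      rw [MulMemClass.coe_mul, hP]; rfl
    · simp only [toLex_inj]
      split_ifs <;> rfl
  · obtain ⟨k, hk⟩ : ∃ k : I, W k = X ^ i * t ^ j := by
      have hr := NeZero.pos r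
      have hj := Nat.mod_lt j hr
      refine ⟨toLex (⟨if i = 0 then 0 else d - i, by split_ifs <;> omega⟩,
        ⟨if j % r = 0 then 0 else r - j % r, by split_ifs <;> omega⟩), ?_⟩
      simp only [W, e, ofLex_toLex]
      congr 1
      · congr 1; split_ifs <;> omega
      · rw [h.pow_mod j]
        split_ifs with h1
        · rw [h1, Nat.sub_zero, h.t_pow, pow_zero]
        · congr 1; omega
    rw [← hk]
    have h1 : ∀ l : I, ∑ m, ι (P k m) * (ι (N m l) * W l) = if k = l then W l else 0 := by
      intro l
      have h2 := congrArg (Subtype.val) (congrFun (congrFun hPN k) l)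
      rw [Matrix.mul_apply, Matrix.one_apply, AddSubmonoidClass.coe_finsetSum] at h2
      simp only [← mul_assoc, ← map_mul, ← Finset.sum_mul, ← map_sum]
      simp only [MulMemClass.coe_mul] at h2
      rw [h2]
      split_ifs <;> simp
    calc _ = ∑ m : I, ι (P k m) * Y m := by
          refine Fintype.sum_equiv (toLex) _ _ fun m => ?_
          rw [hP]; rfl
      _ = ∑ l, ∑ m, ι (P k m) * (ι (N m l) * W l) := by
          simp only [Y, Finset.mul_sum]; exact Finset.sum_comm
      _ = W k := by simp only [h1]; simp

end FormOnPowers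

/-! ### Frobenius forms -/

namespace FormOnPowers

variable {R A A' : Type u} [CommRing R] [Ring A] [Algebra R A] [Ring A'] [Algebra R A']
  {ι : A →ₐ[R] A'} {X t : A'} {d r : ℕ} [NeZero r] {c : R} {θ : A' →ₗ[R] A}

/-- Bimodule maps with prescribed values on the monomials. The values are elements on which the
left and right actions `L` and `N` of `A` agree. The map is `y ↦ ∑ k_m θ(Y_m y)`, with `Y` the dual
family, and hence vanishes on the elements that are orthogonal to the monomials. -/
theorem exists_map (h : FormOnPowers ι X t d r c θ) (hc : IsUnit c) {Q : Type u} [AddCommGroup Q]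
    [Module R Q] (L : A →ₐ[R] Module.End R Q) (N : Aᵐᵒᵖ →ₐ[R] Module.End R Q)
    (hLN : ∀ a b, Commute (L a) (N b)) (k : ℕ → ℕ → Q)
    (hk : ∀ i j a, L a (k i j) = N (op a) (k i j)) (hkr : ∀ i j, k i (j % r) = k i j) :
    ∃ γ : A' →ₗ[R] Q, (∀ a y, γ (ι a * y) = L a (γ y)) ∧ (∀ y a, γ (y * ι a) = N (op a) (γ y)) ∧
      (∀ i < d, ∀ j, γ (X ^ i * t ^ j) = k i j) ∧
      ∀ g, (∀ i < d, ∀ j, θ (X ^ i * t ^ j * g) = 0) → γ g = 0 := by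
  obtain ⟨Y, hY1, hY2, hY3, -⟩ := h.exists_dual hc
  let γ : A' →ₗ[R] Q := ∑ m : Fin d × Fin r, N.toLinearMap.flip (k m.1 m.2) ∘ₗ
    (opLinearEquiv R).toLinearMap ∘ₗ θ ∘ₗ LinearMap.mulLeft R (Y m)
  have hγ (y : A') : γ y = ∑ m : Fin d × Fin r, N (op (θ (Y m * y))) (k m.1 m.2) := by
    simp [γ, LinearMap.sum_apply]
  refine ⟨γ, fun a y => ?_, fun y a => ?_, fun i hi j => ?_, fun g hg => ?_⟩
  · rw [hγ, hγ, map_sum]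
    refine Finset.sum_congr rfl fun m _ => ?_
    rw [← mul_assoc, (hY1 m a).eq, mul_assoc, h.map_left, op_mul, map_mul, Module.End.mul_apply,
      ← hk]
    exact LinearMap.congr_fun (hLN a _).symm.eq _
  · rw [hγ, hγ, map_sum]
    refine Finset.sum_congr rfl fun m _ => ?_
    rw [← mul_assoc, h.map_right, op_mul, map_mul, Module.End.mul_apply]
  · rw [hγ, Fintype.sum_eq_single (⟨⟨i, hi⟩, ⟨j % r, Nat.mod_lt _ (NeZero.pos r)⟩⟩ : Fin d × Fin r)]
    · have := hY3 ⟨⟨i, hi⟩, ⟨j % r, Nat.mod_lt _ (NeZero.pos r)⟩⟩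
        ⟨⟨i, hi⟩, ⟨j % r, Nat.mod_lt _ (NeZero.pos r)⟩⟩
      rw [h.pow_mod j, this, if_pos rfl, op_one, map_one, Module.End.one_apply, hkr]
    · intro m hm
      have := hY3 m ⟨⟨i, hi⟩, ⟨j % r, Nat.mod_lt _ (NeZero.pos r)⟩⟩
      rw [h.pow_mod j, this, if_neg hm, op_zero, map_zero, LinearMap.zero_apply]
  · rw [hγ]
    refine Finset.sum_eq_zero fun m _ => ?_
    have h1 : θ (Y m * g) = 0 := hY2 (LinearMap.ker (θ ∘ₗ LinearMap.mulRight R g))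
      (fun i hi j a => by
        rw [LinearMap.mem_ker, LinearMap.comp_apply, LinearMap.mulRight_apply, mul_assoc,
          h.map_left, hg i hi j, mul_zero]) m
    rw [h1, op_zero, map_zero, LinearMap.zero_apply]

end FormOnPowers

namespace Cyc

variable {R : Type u} [CommRing R] {d : ℕ}

/-- The set of the last generator of type `g`; it is empty if there is none. -/
def lastGs (r : ℕ) [Invertible (r : R)] (q : Rˣ) (v : Fin d → Rˣ) : ∀ n, Set (Cyc r (n + 1) q v)
  | 0 => ∅
  | m + 1 => {lastG r m q v}

/-- The image of `Y_{r,n-1}^d` in `Y_{r,n}^d`; it is empty for `n = 0`, where there is no smaller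
algebra. -/
def inclRange (r : ℕ) [Invertible (r : R)] (q : Rˣ) (v : Fin d → Rˣ) : ∀ n, Set (Cyc r n q v)
  | 0 => ∅
  | m + 1 => Set.range (incl r m q v)

variable {r : ℕ} [Invertible (r : R)] {q : Rˣ} {v : Fin d → Rˣ}

theorem eq_top_of_mem (hd : 1 ≤ d) {n : ℕ} (S : Submodule R (Cyc r (n + 1) q v))
    (h1 : ∀ i < d, ∀ j b, lastX r n q v ^ i * lastT r n q v ^ j * incl r n q v b ∈ S)
    (h2 : ∀ h ∈ lastGs r q v n, ∀ b b', incl r n q v b * h * incl r n q v b' ∈ S) : S = ⊤ := by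
  rw [eq_top_iff, ← span_spanSet hd n, Submodule.span_le]
  rintro _ (⟨a, ha, b, y, rfl⟩ | ⟨i, rfl, y, z, rfl⟩)
  · exact h1 a ha b y
  · exact h2 _ rfl y z

/-- A Frobenius form `θ : Y_{r,n+1}^d → Y_{r,n}^d`: a bimodule map with dual bases, whose values on
the spanning set are those of the coefficient of `1`. The last field is the universal property of
`Y_{r,n+1}^d` as a bimodule over `Y_{r,n}^d`: bimodule maps to `Q`, with left and right actions `L`
and `N`, may be prescribed on the monomials in the last `X` and `t`, by elements `k i j` that
commute with `Y_{r,n}^d`, and on the last `g`, by an element `l` that commutes with `Y_{r,n-1}^d`.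
-/
structure FrobeniusForm {n : ℕ} (θ : Cyc r (n + 1) q v →ₗ[R] Cyc r n q v) : Prop extends
    FormOnPowers (incl r n q v) (lastX r n q v) (lastT r n q v) d r (-(paramPoly v).coeff 0) θ where
  map_lastG : ∀ h ∈ lastGs r q v n, θ h = 0
  exists_dual_bases : ∃ (I : Type) (_ : Fintype I) (x y : I → Cyc r (n + 1) q v),
    (∀ z, ∑ i, x i * incl r n q v (θ (y i * z)) = z) ∧
    ∀ z, ∑ i, incl r n q v (θ (z * x i)) * y i = z
  exists_bimodule_map : ∀ (Q : Type u) [AddCommGroup Q] [Module R Q]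
    (L : Cyc r n q v →ₐ[R] Module.End R Q) (N : (Cyc r n q v)ᵐᵒᵖ →ₐ[R] Module.End R Q),
    (∀ a b, Commute (L a) (N b)) → ∀ k : ℕ → ℕ → Q,
    (∀ i j a, L a (k i j) = N (op a) (k i j)) → (∀ i j, k i (j % r) = k i j) → ∀ l : Q,
    (∀ a ∈ inclRange r q v n, L a l = N (op a) l) → ∃ γ : Cyc r (n + 1) q v →ₗ[R] Q,
      (∀ a y, γ (incl r n q v a * y) = L a (γ y)) ∧
      (∀ y a, γ (y * incl r n q v a) = N (op a) (γ y)) ∧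
      (∀ i < d, ∀ j, γ (lastX r n q v ^ i * lastT r n q v ^ j) = k i j) ∧
      ∀ h ∈ lastGs r q v n, γ h = l

theorem isUnit_neg_paramPoly_coeff_zero (v : Fin d → Rˣ) : IsUnit (-(paramPoly v).coeff 0) :=
  (paramPoly_coeff_zero v).neg

/-- For `n = 0`, the monomials and their dual family are dual bases. -/
theorem FrobeniusForm.of_zero [NeZero r] (hd : 1 ≤ d) {θ : Cyc r 1 q v →ₗ[R] Cyc r 0 q v}
    (h : FormOnPowers (incl r 0 q v) (lastX r 0 q v) (lastT r 0 q v) d r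
      (-(paramPoly v).coeff 0) θ) :
    FrobeniusForm θ where
  toFormOnPowers := h
  map_lastG _ hg := hg.elim
  exists_dual_bases := by
    obtain ⟨Y, hY1, hY2, hY3, hY4⟩ := h.exists_dual (isUnit_neg_paramPoly_coeff_zero v)
    refine ⟨Fin d × Fin r, inferInstance,
      fun k => lastX r 0 q v ^ (k.1 : ℕ) * lastT r 0 q v ^ (k.2 : ℕ),
      Y, fun z => ?_, fun z => ?_⟩
    · let f : Cyc r 1 q v →ₗ[R] Cyc r 1 q v := ∑ k : Fin d × Fin r,
        LinearMap.mulLeft R (lastX r 0 q v ^ (k.1 : ℕ) * lastT r 0 q v ^ (k.2 : ℕ)) ∘ₗ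
          (incl r 0 q v).toLinearMap ∘ₗ θ ∘ₗ LinearMap.mulLeft R (Y k)
      have hf : LinearMap.eqLocus f LinearMap.id = ⊤ := by
        refine eq_top_of_mem hd _ (fun i hi j b => ?_) fun _ hg => hg.elim
        simp only [LinearMap.mem_eqLocus, f, LinearMap.sum_apply, LinearMap.comp_apply,
          LinearMap.mulLeft_apply, AlgHom.toLinearMap_apply, LinearMap.id_apply]
        rw [Fintype.sum_eq_single (⟨⟨i, hi⟩, ⟨j % r, Nat.mod_lt _ (NeZero.pos r)⟩⟩ : Fin d × Fin r)]
        · rw [h.pow_mod j, ← mul_assoc (Y _), h.map_right, hY3 _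
            ⟨⟨i, hi⟩, ⟨j % r, Nat.mod_lt _ (NeZero.pos r)⟩⟩, if_pos rfl, one_mul]
        · intro m hm
          rw [h.pow_mod j, ← mul_assoc (Y _), h.map_right, hY3 _
            ⟨⟨i, hi⟩, ⟨j % r, Nat.mod_lt _ (NeZero.pos r)⟩⟩, if_neg hm, zero_mul, map_zero,
              mul_zero]
      have := (hf ▸ Submodule.mem_top : z ∈ LinearMap.eqLocus f LinearMap.id)
      simpa only [f, LinearMap.mem_eqLocus, LinearMap.add_apply, LinearMap.sum_apply,
        LinearMap.comp_apply, LinearMap.mulLeft_apply, LinearMap.mulRight_apply,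
        AlgHom.toLinearMap_apply, LinearMap.id_apply] using this
    · let f : Cyc r 1 q v →ₗ[R] Cyc r 1 q v := ∑ k : Fin d × Fin r,
        LinearMap.mulRight R (Y k) ∘ₗ (incl r 0 q v).toLinearMap ∘ₗ θ ∘ₗ
          LinearMap.mulRight R (lastX r 0 q v ^ (k.1 : ℕ) * lastT r 0 q v ^ (k.2 : ℕ))
      have hf : LinearMap.eqLocus f LinearMap.id = ⊤ := by
        refine eq_top_of_mem hd _ (fun i hi j b => ?_) fun _ hg => hg.elim
        rw [(h.commute_pow i j b).eq]
        simp only [LinearMap.mem_eqLocus, f, LinearMap.sum_apply, LinearMap.comp_apply,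
          LinearMap.mulRight_apply, AlgHom.toLinearMap_apply, LinearMap.id_apply]
        simp only [mul_assoc (incl r 0 q v b), h.map_left, map_mul]
        rw [← Finset.mul_sum, hY4 i hi j]
      have := (hf ▸ Submodule.mem_top : z ∈ LinearMap.eqLocus f LinearMap.id)
      simpa only [f, LinearMap.mem_eqLocus, LinearMap.add_apply, LinearMap.sum_apply,
        LinearMap.comp_apply, LinearMap.mulLeft_apply, LinearMap.mulRight_apply,
        AlgHom.toLinearMap_apply, LinearMap.id_apply] using this
  exists_bimodule_map Q _ _ L N hLN k hk hkr l _ := by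
    obtain ⟨γ, h1, h2, h3, -⟩ := h.exists_map (isUnit_neg_paramPoly_coeff_zero v) L N hLN k hk hkr
    exact ⟨γ, h1, h2, h3, fun _ hg => hg.elim⟩

/-- The inductive step for dual bases and for the universal property. If `x`, `y` are dual bases
for `θ'`, then the `x i g` and `g y i`, together with the monomials and their dual family, are dual
bases for `θ`: the elements `ι(Y) g ι(Y)` are orthogonal to the monomials, and `θ` restricts on
them to the form `(a g b, a' g b') ↦ a θ'(b a') b'`. -/
theorem FrobeniusForm.succ [NeZero r] (hd : 1 ≤ d) {m : ℕ}
    {θ' : Cyc r (m + 1) q v →ₗ[R] Cyc r m q v}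
    (h' : FrobeniusForm θ') {θ : Cyc r (m + 1 + 1) q v →ₗ[R] Cyc r (m + 1) q v}
    (h : FormOnPowers (incl r (m + 1) q v) (lastX r (m + 1) q v) (lastT r (m + 1) q v) d r
      (-(paramPoly v).coeff 0) θ)
    (hg : θ (lastG r m q v) = 0)
    (hgg : ∀ a, θ (lastG r m q v * incl r (m + 1) q v a * lastG r m q v) = incl r m q v (θ' a))
    (hgX : ∀ i < d, ∀ j,
      θ (lastG r m q v * (lastX r (m + 1) q v ^ i * lastT r (m + 1) q v ^ j)) = 0)
    (hXg : ∀ i < d, ∀ j,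
      θ (lastX r (m + 1) q v ^ i * lastT r (m + 1) q v ^ j * lastG r m q v) = 0) :
    FrobeniusForm θ where
  toFormOnPowers := h
  map_lastG := by rintro _ rfl; exact hg
  exists_dual_bases := by
    obtain ⟨Y, hY1, hY2, hY3, hY4⟩ := h.exists_dual (isUnit_neg_paramPoly_coeff_zero v)
    obtain ⟨I, _, x, y, hxy, hyx⟩ := h'.exists_dual_bases
    set g := lastG r m q v
    set X := lastX r (m + 1) q v
    set t := lastT r (m + 1) q v
    set ι := incl r (m + 1) q v
    have hYg (k) : θ (Y k * g) = 0 := hY2 (LinearMap.ker (θ ∘ₗ LinearMap.mulRight R g))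
      (fun i hi j a => by
        rw [LinearMap.mem_ker, LinearMap.comp_apply, LinearMap.mulRight_apply, mul_assoc,
          h.map_left, hXg i hi j, mul_zero]) k
    refine ⟨I ⊕ (Fin d × Fin r), inferInstance,
      Sum.elim (fun i => ι (x i) * g) (fun k => X ^ (k.1 : ℕ) * t ^ (k.2 : ℕ)),
      Sum.elim (fun i => g * ι (y i)) Y, fun z => ?_, fun z => ?_⟩
    · simp only [Fintype.sum_sum_type, Sum.elim_inl, Sum.elim_inr]
      let f : Cyc r (m + 1 + 1) q v →ₗ[R] Cyc r (m + 1 + 1) q v :=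
        ∑ i, LinearMap.mulLeft R (ι (x i) * g) ∘ₗ ι.toLinearMap ∘ₗ θ ∘ₗ
          LinearMap.mulLeft R (g * ι (y i)) +
        ∑ k : Fin d × Fin r, LinearMap.mulLeft R (X ^ (k.1 : ℕ) * t ^ (k.2 : ℕ)) ∘ₗ
          ι.toLinearMap ∘ₗ θ ∘ₗ LinearMap.mulLeft R (Y k)
      have hf : LinearMap.eqLocus f LinearMap.id = ⊤ := by
        refine eq_top_of_mem hd _ (fun i hi j b => ?_) ?_
        · simp only [LinearMap.mem_eqLocus, f, LinearMap.add_apply, LinearMap.sum_apply,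
            LinearMap.comp_apply, LinearMap.mulLeft_apply, AlgHom.toLinearMap_apply,
            LinearMap.id_apply]
          rw [Finset.sum_eq_zero fun k _ => ?_, zero_add, Fintype.sum_eq_single
            (⟨⟨i, hi⟩, ⟨j % r, Nat.mod_lt _ (NeZero.pos r)⟩⟩ : Fin d × Fin r)]
          · rw [h.pow_mod j, ← mul_assoc (Y _), h.map_right, hY3 _
              ⟨⟨i, hi⟩, ⟨j % r, Nat.mod_lt _ (NeZero.pos r)⟩⟩, if_pos rfl, one_mul]
          · intro m hm
            rw [h.pow_mod j, ← mul_assoc (Y _), h.map_right, hY3 _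
              ⟨⟨i, hi⟩, ⟨j % r, Nat.mod_lt _ (NeZero.pos r)⟩⟩, if_neg hm, zero_mul, map_zero,
              mul_zero]
          · rw [mul_assoc g, ← mul_assoc (ι (y k)), ← (h.commute_pow i j (y k)).eq,
              mul_assoc _ (ι (y k)), ← map_mul, ← mul_assoc g, h.map_right, hgX i hi j, zero_mul,
              map_zero, mul_zero]
        · rintro _ rfl b b'
          change f (ι b * g * ι b') = ι b * g * ι b'
          simp only [f, LinearMap.add_apply, LinearMap.sum_apply, LinearMap.comp_apply,
            LinearMap.mulLeft_apply, AlgHom.toLinearMap_apply]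
          have h1 (i) : ι (x i) * g * ι (θ (g * ι (y i) * (ι b * g * ι b'))) =
              ι (x i * incl r m q v (θ' (y i * b))) * g * ι b' := by
            have h2 : g * ι (y i) * (ι b * g * ι b') = g * ι (y i * b) * g * ι b' := by
              rw [map_mul]; simp only [mul_assoc]
            rw [h2, h.map_right, hgg, map_mul ι, map_mul ι, mul_assoc (ι (x i)), ← mul_assoc g,
              (commute_lastG_incl_incl (θ' (y i * b))).eq]
            simp only [mul_assoc]; rfl
          have h3 (k) : X ^ (k.1 : ℕ) * t ^ (k.2 : ℕ) * ι (θ (Y k * (ι b * g * ι b'))) = 0 := by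
            rw [← mul_assoc, ← mul_assoc, (hY1 k b).eq, mul_assoc (ι b), h.map_right, h.map_left,
              hYg, mul_zero, zero_mul, map_zero, mul_zero]
          simp only [h1, h3, Finset.sum_const_zero, add_zero, ← Finset.sum_mul, ← map_sum, hxy]
      have := (hf ▸ Submodule.mem_top : z ∈ LinearMap.eqLocus f LinearMap.id)
      simpa only [f, LinearMap.mem_eqLocus, LinearMap.add_apply, LinearMap.sum_apply,
        LinearMap.comp_apply, LinearMap.mulLeft_apply, LinearMap.mulRight_apply,
        AlgHom.toLinearMap_apply, LinearMap.id_apply] using this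
    · simp only [Fintype.sum_sum_type, Sum.elim_inl, Sum.elim_inr]
      let f : Cyc r (m + 1 + 1) q v →ₗ[R] Cyc r (m + 1 + 1) q v :=
        ∑ i, LinearMap.mulRight R (g * ι (y i)) ∘ₗ ι.toLinearMap ∘ₗ θ ∘ₗ
          LinearMap.mulRight R (ι (x i) * g) +
        ∑ k : Fin d × Fin r, LinearMap.mulRight R (Y k) ∘ₗ
          ι.toLinearMap ∘ₗ θ ∘ₗ LinearMap.mulRight R (X ^ (k.1 : ℕ) * t ^ (k.2 : ℕ))
      have hf : LinearMap.eqLocus f LinearMap.id = ⊤ := by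
        refine eq_top_of_mem hd _ (fun i hi j b => ?_) ?_
        · rw [(h.commute_pow i j b).eq]
          simp only [LinearMap.mem_eqLocus, f, LinearMap.add_apply, LinearMap.sum_apply,
            LinearMap.comp_apply, LinearMap.mulRight_apply, AlgHom.toLinearMap_apply,
            LinearMap.id_apply]
          rw [Finset.sum_eq_zero fun k _ => ?_, zero_add]
          · simp only [mul_assoc (ι b), h.map_left, map_mul]
            rw [← Finset.mul_sum, hY4 i hi j]
          · rw [mul_assoc (ι b), h.map_left, ← mul_assoc _ (ι (x k)), (h.commute_pow i j (x k)).eq,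
              mul_assoc (ι (x k)), h.map_left, hXg i hi j, mul_zero, mul_zero, map_zero, zero_mul]
        · rintro _ rfl b b'
          change f (ι b * g * ι b') = ι b * g * ι b'
          simp only [f, LinearMap.add_apply, LinearMap.sum_apply, LinearMap.comp_apply,
            LinearMap.mulRight_apply, AlgHom.toLinearMap_apply]
          have h1 (i) : ι (θ (ι b * g * ι b' * (ι (x i) * g))) * (g * ι (y i)) =
              ι b * (g * ι (incl r m q v (θ' (b' * x i)) * y i)) := by
            have h2 : ι b * g * ι b' * (ι (x i) * g) = ι b * (g * ι (b' * x i) * g) := by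
              rw [map_mul]; simp only [mul_assoc]
            rw [h2, h.map_left, hgg, map_mul ι, map_mul ι, ← mul_assoc g,
              (commute_lastG_incl_incl (θ' (b' * x i))).eq]
            simp only [mul_assoc]; rfl
          have h3 (k : Fin d × Fin r) :
              ι (θ (ι b * g * ι b' * (X ^ (k.1 : ℕ) * t ^ (k.2 : ℕ)))) * Y k = 0 := by
            rw [mul_assoc _ (ι b'), ← (h.commute_pow _ _ b').eq, ← mul_assoc, h.map_right,
              mul_assoc (ι b), h.map_left, hgX _ k.1.2, mul_zero, zero_mul, map_zero, zero_mul]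
          simp only [h1, h3, Finset.sum_const_zero, add_zero, ← Finset.mul_sum, ← map_sum, hyx]
          simp only [mul_assoc]
      have := (hf ▸ Submodule.mem_top : z ∈ LinearMap.eqLocus f LinearMap.id)
      simpa only [f, LinearMap.mem_eqLocus, LinearMap.add_apply, LinearMap.sum_apply,
        LinearMap.comp_apply, LinearMap.mulLeft_apply, LinearMap.mulRight_apply,
        AlgHom.toLinearMap_apply, LinearMap.id_apply] using this
  exists_bimodule_map Q _ _ L N hLN k hk hkr l hl := by
    obtain ⟨γ, hγ1, hγ2, hγ3, hγ4⟩ :=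
      h.exists_map (isUnit_neg_paramPoly_coeff_zero v) L N hLN k hk hkr
    obtain ⟨I, _, x, y, hxy, hyx⟩ := h'.exists_dual_bases
    set g := lastG r m q v
    set X := lastX r (m + 1) q v
    set t := lastT r (m + 1) q v
    set ι := incl r (m + 1) q v
    have hl (b : Cyc r m q v) : L (incl r m q v b) l = N (op (incl r m q v b)) l := hl _ ⟨b, rfl⟩
    -- `γ` takes care of the monomials, and `δ` of the last `g`
    let δ : Cyc r (m + 1 + 1) q v →ₗ[R] Q := ∑ i, L (x i) ∘ₗ N.toLinearMap.flip l ∘ₗ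
      (opLinearEquiv R).toLinearMap ∘ₗ θ ∘ₗ LinearMap.mulLeft R (g * ι (y i))
    have hδ (z) : δ z = ∑ i, L (x i) (N (op (θ (g * ι (y i) * z))) l) := by
      simp only [δ, LinearMap.sum_apply, LinearMap.comp_apply, LinearMap.mulLeft_apply]
      rfl
    have hNL (a b) (w : Q) : N a (L b w) = L b (N a w) := LinearMap.congr_fun (hLN b a).symm.eq w
    refine ⟨γ + δ, fun a z => ?_, fun z a => ?_, fun i hi j => ?_, ?_⟩
    · rw [LinearMap.add_apply, LinearMap.add_apply, map_add, hγ1]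
      congr 1
      rw [hδ, hδ, map_sum]
      have h1 (i) : L (x i) (N (op (θ (g * ι (y i) * (ι a * z)))) l) = ∑ j,
          N (op (θ (g * ι (y j) * z))) (L (x i * incl r m q v (θ' (y i * a * x j))) l) := by
        have h2 : g * ι (y i) * (ι a * z) =
            ∑ j, ι (incl r m q v (θ' (y i * a * x j))) * (g * ι (y j) * z) := by
          rw [← mul_assoc, mul_assoc g, ← map_mul]
          conv_lhs => rw [← hyx (y i * a)]
          rw [map_sum, Finset.mul_sum, Finset.sum_mul]
          refine Finset.sum_congr rfl fun j _ => ?_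
          rw [map_mul, ← mul_assoc g, (commute_lastG_incl_incl _).eq]
          simp only [mul_assoc]; rfl
        rw [h2, map_sum, Finset.op_sum, map_sum, LinearMap.sum_apply, map_sum]
        refine Finset.sum_congr rfl fun j _ => ?_
        rw [h.map_left, op_mul, map_mul N, map_mul L, Module.End.mul_apply,
          Module.End.mul_apply, ← hl, hNL, hNL, hNL]
      simp only [h1]
      rw [Finset.sum_comm]
      refine Finset.sum_congr rfl fun j _ => ?_
      rw [← map_sum, ← LinearMap.sum_apply, ← map_sum]
      simp only [mul_assoc (y _), hxy]
      rw [map_mul L, Module.End.mul_apply, hNL, hNL]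
    · rw [LinearMap.add_apply, LinearMap.add_apply, map_add, hγ2]
      congr 1
      rw [hδ, hδ, map_sum]
      refine Finset.sum_congr rfl fun i _ => ?_
      rw [← mul_assoc, h.map_right, op_mul, map_mul, Module.End.mul_apply, hNL]
    · rw [LinearMap.add_apply, hγ3 i hi, hδ, Finset.sum_eq_zero fun n _ => ?_, add_zero]
      rw [mul_assoc g, ← (h.commute_pow i j (y n)).eq, ← mul_assoc g, h.map_right, hgX i hi j,
        zero_mul, op_zero, map_zero, LinearMap.zero_apply, map_zero]
    · rintro _ rfl
      change (γ + δ) g = l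
      rw [LinearMap.add_apply, hγ4 _ hXg, hδ, zero_add]
      have h1 (i) : L (x i) (N (op (θ (g * ι (y i) * g))) l) =
          L (x i * incl r m q v (θ' (y i * 1))) l := by
        rw [hgg, ← hl, map_mul, Module.End.mul_apply, mul_one]
      simp only [h1]
      rw [← LinearMap.sum_apply, ← map_sum, hxy, map_one, Module.End.one_apply]

end Cyc

/-! ### The Frobenius form on the next algebra -/

section

variable {R A B : Type u} [CommRing R] [Ring A] [Algebra R A] [Ring B] [Algebra R B]
  {ι : B →ₐ[R] A} {t : A} {d r : ℕ} {Q : Type u} [AddCommGroup Q] [Module R Q] [Module A Q]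
  [Module Aᵐᵒᵖ Q] [SMulCommClass A Aᵐᵒᵖ Q] [IsScalarTower R A Q] [IsScalarTower R Aᵐᵒᵖ Q]
  [Invertible (r : R)] {M : ExtModel ι t d r Q} {X : A} {Δ : R} {H : Set A}

theorem ExtModel.π_τ_pow_ε (M : ExtModel ι t d r Q) {x : Q} (hx : ∀ j, M.π ((M.τ ^ j) x) = 0)
    (j : ℕ) : M.π ((M.τ ^ j) (M.ε x)) = 0 := by
  rw [M.τ_pow_ε, ExtModel.ε, avg, LinearMap.smul_apply, LinearMap.sum_apply, map_smul, map_sum,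
    Finset.sum_eq_zero fun s _ => ?_, smul_zero]
  rw [Module.End.mul_apply, ← Module.End.mul_apply (M.τ ^ _), ← pow_add, ← map_pow,
    Algebra.lsmul_coe, M.π_smul, hx, mul_zero]

theorem ExtModel.π_τ_pow_gX [NeZero r] (M : ExtModel ι t d r Q) {a : ℕ} (ha : a < d) (j : ℕ) :
    M.π ((M.τ ^ j) (M.gX X Δ a)) = 0 := by
  induction a generalizing j with
  | zero => rw [ExtModel.gX, M.τ_pow_p, M.π_op_smul, M.π_p, zero_mul]
  | succ a ih =>
    rw [ExtModel.gX, map_add, M.τ_pow_smul, map_add, M.π_smul, ih (by omega), mul_zero, zero_add,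
      LinearMap.map_smul_of_tower, map_smul, M.π_τ_pow_ε, smul_zero]
    intro k
    rw [M.π_τ_pow_ξ ha, if_neg (by omega)]

theorem ExtModel.π_τ_pow_gSymm [NeZero r] (M : ExtModel ι t d r Q) {a : ℕ} (ha : a < d) (j : ℕ) :
    M.π ((M.τ ^ j) (M.gSymm X Δ a)) = 0 := by
  induction a generalizing j with
  | zero => simp [ExtModel.gSymm]
  | succ a ih =>
    rw [ExtModel.gSymm, map_add, map_smul, map_add, M.π_op_smul, ih (by omega), zero_mul, zero_add,
      M.π_τ_pow_gX ha]

/-- The coefficient of `1` in `g a g` is the value of the given form at `a`. -/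
theorem ExtOp.π_γ [NeZero r] (D : ExtOp M X Δ H) {c : R} {θ' : A →ₗ[R] B}
    (h' : FormOnPowers ι X t d r c θ') (hH : ∀ h ∈ H, θ' h = 0) (a : A) :
    M.π (D.γ a) = ι (θ' a) := by
  refine D.eqOn_span (f := M.π ∘ₗ D.γ) (g := ι.toLinearMap ∘ₗ θ') (fun i hi j b => ?_)
    (fun h hh b b' => ?_) a
  · simp only [LinearMap.comp_apply, AlgHom.toLinearMap_apply]
    rw [D.γ_right, M.π_op_smul, h'.map_right, map_mul ι, D.γ_pow i hi, h'.map_pow_mod hi,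
      ExtModel.gXg, map_add, map_add, LinearMap.map_smul_of_tower, map_smul, M.π_τ_pow_ε,
      smul_zero, add_zero, M.π_τ_pow_ξ hi]
    · split_ifs <;> simp
    · intro k
      rw [map_sub, map_sub, M.π_τ_pow_gX hi, M.π_τ_pow_gSymm hi, sub_zero]
  · simp only [LinearMap.comp_apply, AlgHom.toLinearMap_apply]
    rw [D.γ_right, D.γ_left, D.γ_H h hh, h'.map_right, h'.map_left, hH h hh]
    simp only [M.π_op_smul, M.π_smul, M.π_p, smul_op_smul, mul_zero, zero_mul, map_zero]

end

namespace Cyc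

variable {R : Type u} [CommRing R] {d r m : ℕ} [Invertible (r : R)] {q : Rˣ} {v : Fin d → Rˣ}

section

variable {Q : Type u} [AddCommGroup Q] [Module R Q] [Module (Cyc r (m + 1) q v) Q]
  [Module (Cyc r (m + 1) q v)ᵐᵒᵖ Q] [SMulCommClass (Cyc r (m + 1) q v) (Cyc r (m + 1) q v)ᵐᵒᵖ Q]
  [IsScalarTower R (Cyc r (m + 1) q v) Q] [IsScalarTower R (Cyc r (m + 1) q v)ᵐᵒᵖ Q]

/-- The operator `G` exists: `γ` comes from the universal property of `Y_{r,m+1}^d` as a bimodule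
over `Y_{r,m}^d`, and `G` from that of the `ExtModel`. -/
theorem FrobeniusForm.exists_extOp (hd : 1 ≤ d) {θ' : Cyc r (m + 1) q v →ₗ[R] Cyc r m q v}
    (h' : FrobeniusForm θ') (M : ExtModel (incl r m q v) (lastT r m q v) d r Q) :
    Nonempty (ExtOp M (lastX r m q v) ((q : R) - ((q⁻¹ : Rˣ) : R)) (lastGs r q v m)) := by
  -- the element standing for `g h g`
  obtain ⟨l, hl1, hl2⟩ : ∃ l : Q,
      (∀ a ∈ inclRange r q v m, incl r m q v a • l = op (incl r m q v a) • l) ∧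
      ∀ h ∈ lastGs r q v m, l = h • op h • M.p := by
    cases m with
    | zero => exact ⟨0, fun _ ha => ha.elim, fun _ hh => hh.elim⟩
    | succ i =>
      refine ⟨lastG r i q v • op (lastG r i q v) • M.p, ?_, by rintro _ rfl; rfl⟩
      rintro _ ⟨a, rfl⟩
      have h1 := (commute_lastG_incl_incl (r := r) (q := q) (v := v) a).eq
      change (incl r (i + 1) q v (incl r i q v a)) • _ =
        op (incl r (i + 1) q v (incl r i q v a)) • _
      rw [smul_smul, ← h1, mul_smul, smul_op_smul, M.ι_smul_p, op_smul_op_smul, ← h1,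
        ← op_smul_op_smul, smul_op_smul]
  obtain ⟨γ, hγ1, hγ2, hγ3, hγ4⟩ := h'.exists_bimodule_map Q
    ((Algebra.lsmul R R Q).comp (incl r m q v))
    ((Algebra.lsmul R R Q).comp (AlgHom.op (incl r m q v)))
    (fun a b => LinearMap.ext fun x => smul_comm (incl r m q v a) (AlgHom.op (incl r m q v) b) x)
    (fun i j => (M.τ ^ j) (M.gXg (lastX r m q v) ((q : R) - ((q⁻¹ : Rˣ) : R)) i))
    (fun i j a => by
      change incl r m q v a • (M.τ ^ j) (M.gXg (lastX r m q v) ((q : R) - ((q⁻¹ : Rˣ) : R)) i) =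
        op (incl r m q v a) •
          (M.τ ^ j) (M.gXg (lastX r m q v) ((q : R) - ((q⁻¹ : Rˣ) : R)) i)
      rw [← M.τ_pow_smul, M.commute_smul_gXg _ (h'.X_ι a) (h'.t_ι a), map_smul])
    (fun i j => LinearMap.congr_fun (M.τ_pow_mod j) _)
    l hl1
  obtain ⟨G, hG1, hG2⟩ := M.exists_map γ hγ2 (M.gX (lastX r m q v) ((q : R) - ((q⁻¹ : Rˣ) : R)))
  exact ⟨{
    t_pow := h'.t_pow
    t_X := h'.t_X
    t_ι := h'.t_ι
    X_ι := h'.X_ι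
    H_rel := fun h hh => by
      cases m with
      | zero => exact hh.elim
      | succ i =>
        obtain rfl : h = lastG r i q v := hh
        exact ⟨lastT r i q v, lastG_mul_lastT, lastG_mul_incl_lastT, lastG_mul_self⟩
    span := fun S => eq_top_of_mem hd S
    γ := γ
    γ_left := hγ1
    γ_right := fun a b => hγ2 a b
    γ_pow := hγ3
    γ_H := fun h hh => (hγ4 h hh).trans (hl2 h hh)
    G := G
    G_p := hG1
    G_ξ := hG2 }⟩

/-- The bimodule of an `ExtModel` becomes a module over the next algebra. -/
theorem exists_action (hd : 1 ≤ d) {M : ExtModel (incl r m q v) (lastT r m q v) d r Q}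
    (D : ExtOp M (lastX r m q v) ((q : R) - ((q⁻¹ : Rˣ) : R)) (lastGs r q v m)) :
    ∃ F : Cyc r (m + 1 + 1) q v →ₐ[R] Module.End (Cyc r (m + 1) q v)ᵐᵒᵖ Q,
      (∀ y, F (incl r (m + 1) q v y) = Algebra.lsmul R (Cyc r (m + 1) q v)ᵐᵒᵖ Q y) ∧
      F (lastG r m q v) = D.G ∧ F (lastT r (m + 1) q v) = M.τ := by
  refine exists_extend (Algebra.lsmul R (Cyc r (m + 1) q v)ᵐᵒᵖ Q) D.G M.τ
    (fun y => (M.commute_lsmul_τ y).symm) M.τ_pow D.commute_G_ι D.G_mul_lsmul_t D.G_mul_τ D.G_mul_G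
    (fun i hi him => ?_) fun hm => ?_
  · subst him
    refine D.braid (incl r i q v) (lastGs r q v i) (x' := lastX r i q v) (c := lastT r i q v)
      lastG_mul_lastT lastG_mul_incl_lastT lastX_succ lastG_mul_self commute_lastT_lastX.symm
      lastT_pow commute_lastG_incl_incl (fun k hk => ?_) fun S h1 h2 => eq_top_of_mem hd S h1 h2
    cases i with
    | zero => exact hk.elim
    | succ j =>
      obtain rfl : k = lastG r j q v := hk
      exact lastG_braid
  · subst hm
    exact D.reflection rfl

/-- The form on the next algebra sends `y` to the coefficient of `ξ 0` in `y ξ_0`, for its action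
on the bimodule of an `ExtModel`. -/
theorem FrobeniusForm.exists_succ_of_extOp [NeZero r] (hd : 1 ≤ d)
    {θ' : Cyc r (m + 1) q v →ₗ[R] Cyc r m q v} (h' : FrobeniusForm θ')
    {M : ExtModel (incl r m q v) (lastT r m q v) d r Q}
    (D : ExtOp M (lastX r m q v) ((q : R) - ((q⁻¹ : Rˣ) : R)) (lastGs r q v m)) :
    ∃ θ : Cyc r (m + 1 + 1) q v →ₗ[R] Cyc r (m + 1) q v, FrobeniusForm θ := by
  obtain ⟨F, hF, hFg, hFt⟩ := exists_action hd D
  let θ : Cyc r (m + 1 + 1) q v →ₗ[R] Cyc r (m + 1) q v :=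
    { toFun := fun y => M.π (F y (M.ξ 0))
      map_add' := fun y z => by rw [map_add, LinearMap.add_apply, map_add]
      map_smul' := fun c y => by rw [map_smul, LinearMap.smul_apply, map_smul]; rfl }
  have hθ (y) : θ y = M.π (F y (M.ξ 0)) := rfl
  have hFX (x : Q) : F (lastX r (m + 1) q v) x = D.G (lastX r m q v • D.G x) := by
    rw [lastX_succ, map_mul, map_mul, hF, hFg]; rfl
  have hFXpow : ∀ i < d, F (lastX r (m + 1) q v ^ i) (M.ξ 0) = M.ξ i := by
    intro i
    induction i with
    | zero => intro _; rw [pow_zero, map_one]; rfl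
    | succ i ih =>
      intro hi
      rw [pow_succ', map_mul, Module.End.mul_apply, ih (by omega), hFX, D.G_ξ_zero (by omega),
        D.G_X_gX hi]
  have hFXt (i j : ℕ) : F (lastX r (m + 1) q v ^ i * lastT r (m + 1) q v ^ j) (M.ξ 0) =
      (M.τ ^ j) (F (lastX r (m + 1) q v ^ i) (M.ξ 0)) := by
    rw [← (commute_lastT_lastX.pow_pow j i).eq, map_mul, map_pow F (lastT r (m + 1) q v), hFt]; rfl
  have hform : FormOnPowers (incl r (m + 1) q v) (lastX r (m + 1) q v) (lastT r (m + 1) q v) d r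
      (-(paramPoly v).coeff 0) θ :=
    { t_pow := lastT_pow
      t_X := commute_lastT_lastX
      t_ι := commute_lastT_incl
      X_ι := commute_lastX_incl
      map_left := fun a y => by
        rw [hθ, hθ, map_mul, hF, Module.End.mul_apply, Algebra.lsmul_coe, M.π_smul]
      map_right := fun y a => by
        rw [hθ, hθ, map_mul, hF, Module.End.mul_apply]
        change M.π (F y (a • M.ξ 0)) = _
        rw [M.smul_ξ, map_smul, M.π_op_smul]
      map_pow := fun i hi j hj => by
        rw [hθ, hFXt, hFXpow i hi, M.π_ξ i hi j hj]
      map_top := fun j hj => by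
        obtain ⟨e, rfl⟩ : ∃ e, d = e + 1 := ⟨d - 1, by omega⟩
        have h1 : (M.τ ^ j) (D.γ (lastX r m q v ^ (e + 1))) =
            D.γ (lastX r m q v ^ (e + 1) * lastT r m q v ^ j) := by
          rw [← (D.t_X.pow_pow j (e + 1)).eq]
          clear hj
          induction j with
          | zero => simp
          | succ j ih =>
            rw [pow_succ' M.τ, Module.End.mul_apply, ih, pow_succ' (lastT r m q v), mul_assoc,
              D.γ_t_mul]
        rw [hθ, hFXt, pow_succ', map_mul, Module.End.mul_apply, hFXpow e (by omega), hFX,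
          D.G_ξ_zero (by omega), D.G_X_gX_eq (by omega), map_add, h1, map_add,
          D.π_γ h'.toFormOnPowers h'.map_lastG, h'.map_top j hj, LinearMap.map_smul_of_tower,
          map_smul, M.π_τ_pow_ε, smul_zero, add_zero]
        · split_ifs
          · exact AlgHom.commutes _ _
          · exact map_zero _
        · intro k
          rw [map_smul, M.π_op_smul, M.π_τ_pow_gSymm (by omega), zero_mul] }
  have hXg : ∀ i < d, θ (lastX r (m + 1) q v ^ i * lastG r m q v) = 0 := by
    intro i
    induction i with
    | zero =>
      intro h0
      rw [pow_zero, one_mul, hθ, hFg, D.G_ξ_zero h0, ExtModel.gX, M.π_p]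
    | succ i ih =>
      intro hi
      have h1 : Commute (lastX r (m + 1) q v ^ i)
          (avg (R := R) r (incl r (m + 1) q v (lastT r m q v)) (lastT r (m + 1) q v)) :=
        Commute.pow_left (Commute.avg_right (commute_lastX_incl _) commute_lastT_lastX.symm) i
      rw [pow_succ, mul_assoc, lastX_mul_lastG, mul_add, map_add, ← mul_assoc, hform.map_right,
        ih (by omega), zero_mul, zero_add, mul_smul_comm, map_smul, ← mul_assoc, h1.eq, mul_assoc,
        ← pow_succ, avg, smul_mul_assoc, Finset.sum_mul, map_smul, map_sum,
        Finset.sum_eq_zero fun s _ => ?_, smul_zero, smul_zero]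
      rw [← map_pow, mul_assoc, hform.map_left, (commute_lastT_lastX.pow_pow _ _).eq,
        hform.map_pow_mod hi, if_neg (by omega), mul_zero]
  refine ⟨θ, h'.succ hd hform ?_ (fun a => ?_) (fun i hi j => ?_) fun i hi j => ?_⟩
  · simpa using hXg 0 (by omega)
  · rw [hθ, map_mul, map_mul, hF, hFg, Module.End.mul_apply, Module.End.mul_apply,
      D.G_ξ_zero (by omega), Algebra.lsmul_coe, ExtModel.gX, D.G_p,
      D.π_γ h'.toFormOnPowers h'.map_lastG]
  · rw [hθ, map_mul, Module.End.mul_apply, hFXt, hFXpow i hi, hFg, D.G_ξ i hi, M.π_smul]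
    have := M.π_τ_pow_gX (X := lastX r m q v) (Δ := (q : R) - ((q⁻¹ : Rˣ) : R)) hi 0
    rw [pow_zero, Module.End.one_apply] at this
    rw [this, mul_zero]
  · have h1 : ∀ j : ℕ, lastT r (m + 1) q v ^ j * lastG r m q v =
        lastG r m q v * incl r (m + 1) q v (lastT r m q v ^ j) := by
      intro j
      have hs : SemiconjBy (lastG r m q v) (incl r (m + 1) q v (lastT r m q v))
        (lastT r (m + 1) q v) := lastG_mul_incl_lastT
      rw [map_pow, (hs.pow_right j).eq]
    rw [mul_assoc, h1, ← mul_assoc, hform.map_right, hXg i hi, zero_mul]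

end

theorem FrobeniusForm.exists_succ [NeZero r] (hd : 1 ≤ d)
    {θ' : Cyc r (m + 1) q v →ₗ[R] Cyc r m q v} (h' : FrobeniusForm θ') :
    ∃ θ : Cyc r (m + 1 + 1) q v →ₗ[R] Cyc r (m + 1) q v, FrobeniusForm θ := by
  obtain ⟨I, _, x, y, hxy, hyx⟩ := h'.exists_dual_bases
  obtain ⟨M⟩ := exists_extModel (R := R) (incl r m q v) (lastT r m q v) d r hd lastT_pow
    commute_lastT_incl θ' h'.map_right (fun a b => h'.map_left b a) x y hxy hyx
  obtain ⟨D⟩ := h'.exists_extOp hd M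
  exact h'.exists_succ_of_extOp hd D

end Cyc

/-! ### The form on the algebra of rank one -/

section

open Polynomial

variable {K : Type u} [CommRing K] {g : K[X]}

/-- The constant coefficient of the remainder modulo `g`. -/
noncomputable def remainderCoeffZero (hg : g.Monic) : AdjoinRoot g →ₗ[K] K :=
  lcoeff K 0 ∘ₗ AdjoinRoot.modByMonicHom hg

theorem remainderCoeffZero_mk (hg : g.Monic) (f : K[X]) :
    remainderCoeffZero hg (AdjoinRoot.mk g f) = (f %ₘ g).coeff 0 := by
  rw [remainderCoeffZero, LinearMap.comp_apply, AdjoinRoot.modByMonicHom_mk, lcoeff_apply]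

theorem remainderCoeffZero_root_pow (hg : g.Monic) {i : ℕ} (hi : i < g.natDegree) :
    remainderCoeffZero hg (AdjoinRoot.root g ^ i) = if i = 0 then 1 else 0 := by
  nontriviality K
  rw [← AdjoinRoot.mk_X, ← map_pow, remainderCoeffZero_mk, (modByMonic_eq_self_iff hg).2,
    coeff_X_pow]
  · simp only [eq_comm]
  · rw [degree_X_pow, degree_eq_natDegree hg.ne_zero]; exact_mod_cast hi

theorem remainderCoeffZero_root_pow_natDegree (hg : g.Monic) (hd : g.natDegree ≠ 0) :
    remainderCoeffZero hg (AdjoinRoot.root g ^ g.natDegree) = -g.coeff 0 := by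
  nontriviality K
  have h1 : AdjoinRoot.root g ^ g.natDegree = AdjoinRoot.mk g (X ^ g.natDegree - g) := by
    rw [map_sub, AdjoinRoot.mk_self, sub_zero, map_pow, AdjoinRoot.mk_X]
  rw [h1, remainderCoeffZero_mk, (modByMonic_eq_self_iff hg).2, coeff_sub, coeff_X_pow,
    if_neg hd.symm, zero_sub]
  have h2 : (X ^ g.natDegree : K[X]).degree = g.degree := by
    rw [degree_X_pow, degree_eq_natDegree hg.ne_zero]
  rw [← h2]
  exact degree_sub_lt_left h2 (monic_X_pow _).ne_zero
    (by rw [(monic_X_pow g.natDegree).leadingCoeff, hg.leadingCoeff])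

end

namespace Cyc

variable {R : Type u} [CommRing R] {d r : ℕ} [Invertible (r : R)] {q : Rˣ} {v : Fin d → Rˣ}

theorem algebraMap_surjective_zero : Function.Surjective (algebraMap R (Cyc r 0 q v)) := by
  intro y
  induction y using induction with
  | hc c => exact ⟨c, rfl⟩
  | hg z => exact z.elim_zero.elim
  | hm a b iha ihb =>
    obtain ⟨a, rfl⟩ := iha
    obtain ⟨b, rfl⟩ := ihb
    exact ⟨a * b, map_mul _ _ _⟩
  | ha a b iha ihb =>
    obtain ⟨a, rfl⟩ := iha
    obtain ⟨b, rfl⟩ := ihb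
    exact ⟨a + b, map_add _ _ _⟩

/-- A functional on `Y_{r,1}^d` with the values of the coefficient of `1` on the monomials. The
algebra maps to `R[t, x]` modulo `t^r - 1` and the polynomial in `x` with roots `v_1, …, v_d`, and
the functional is the constant coefficient of the remainder. -/
theorem exists_functional (hr : 1 ≤ r) (hd : 1 ≤ d) [Nontrivial R] : ∃ φ : Cyc r 1 q v →ₗ[R] R,
    (∀ i < d, ∀ j < r, φ (lastX r 0 q v ^ i * lastT r 0 q v ^ j) = if i = 0 ∧ j = 0 then 1 else 0) ∧
    ∀ j < r, φ (lastX r 0 q v ^ d * lastT r 0 q v ^ j) =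
      if j = 0 then -(paramPoly v).coeff 0 else 0 := by
  have hf : (Polynomial.X ^ r - Polynomial.C 1 : Polynomial R).Monic :=
    Polynomial.monic_X_pow_sub_C 1 (by omega)
  have hfr : (Polynomial.X ^ r - Polynomial.C 1 : Polynomial R).natDegree = r :=
    Polynomial.natDegree_X_pow_sub_C
  set f : Polynomial R := Polynomial.X ^ r - Polynomial.C 1 with hfdef
  set K := AdjoinRoot f
  have : Nontrivial K := by
    by_contra h
    rw [not_nontrivial_iff_subsingleton] at h
    have h1 := remainderCoeffZero_root_pow hf (i := 0) (by omega)
    rw [Subsingleton.elim (_ ^ 0) (0 : K), map_zero, if_pos rfl] at h1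
    exact zero_ne_one h1
  let v' : Fin d → Kˣ := fun k => Units.map (algebraMap R K) (v k)
  have hg : (paramPoly v').Monic := paramPoly_monic v'
  have hgd : (paramPoly v').natDegree = d := natDegree_paramPoly v'
  have hg0 : (paramPoly v').coeff 0 = algebraMap R K ((paramPoly v).coeff 0) := by
    simp only [Polynomial.coeff_zero_eq_eval_zero, paramPoly, Polynomial.eval_prod, map_prod,
      Polynomial.eval_sub, Polynomial.eval_X, Polynomial.eval_C,
      map_sub, map_zero]
    rfl
  set g := paramPoly v' with hgdef
  set S := AdjoinRoot g
  have hroot : Polynomial.aeval (AdjoinRoot.root g) g = 0 := by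
    rw [AdjoinRoot.aeval_eq, AdjoinRoot.mk_self]
  obtain ⟨x, hx⟩ : IsUnit (AdjoinRoot.root g) := by
    refine isUnit_of_mul_isUnit_right (x := Polynomial.aeval (AdjoinRoot.root g) g.divX) ?_
    have h1 := congrArg (Polynomial.aeval (AdjoinRoot.root g)) (Polynomial.divX_mul_X_add g)
    rw [hroot, map_add, map_mul, Polynomial.aeval_X, Polynomial.aeval_C] at h1
    rw [eq_neg_of_add_eq_zero_left h1]
    exact ((paramPoly_coeff_zero v').map _).neg
  have ht : algebraMap K S (AdjoinRoot.root f) ^ r = 1 := by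
    have h1 : AdjoinRoot.root f ^ r = 1 := by
      have h2 : Polynomial.aeval (AdjoinRoot.root f) f = 0 := by
        rw [AdjoinRoot.aeval_eq, AdjoinRoot.mk_self]
      rw [hfdef, map_sub, map_pow, Polynomial.aeval_X, Polynomial.aeval_C, map_one,
        sub_eq_zero] at h2
      exact h2
    rw [← map_pow, h1, map_one]
  let z : Gen 1 → S := fun z => match z with
    | .t _ => algebraMap K S (AdjoinRoot.root f)
    | .g _ _ => 1
    | .x _ => x
    | .xinv _ => ((x⁻¹ : Sˣ) : S)
  obtain ⟨F, hF⟩ := exists_lift (r := r) (q := q) (v := v) z (fun a b hab => by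
    cases hab with
    | g_g i hi => omega
    | g_g_g i hi => omega
    | t_t i j => simp only [map_mul, FreeAlgebra.lift_ι_apply]; exact mul_comm _ _
    | g_t i hi => omega
    | t_pow i => simp only [map_pow, map_one, FreeAlgebra.lift_ι_apply]; exact ht
    | g_sq i hi => omega
    | x_xinv h => simp only [map_mul, map_one, FreeAlgebra.lift_ι_apply]; exact x.mul_inv
    | xinv_x h => simp only [map_mul, map_one, FreeAlgebra.lift_ι_apply]; exact x.inv_mul
    | g_x_g_x h h' => omega
    | g_x h i hi => omega
    | t_x h j => simp only [map_mul, FreeAlgebra.lift_ι_apply]; exact mul_comm _ _) fun h => by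
      refine Eq.trans ?_ ((aeval_paramPoly v' (AdjoinRoot.root g)).symm.trans hroot)
      congr 2
      funext k
      change (x : S) - _ = _
      rw [hx]
      rfl
  have hFX : F (lastX r 0 q v) = AdjoinRoot.root g := (hF _).trans hx
  have hFt : F (lastT r 0 q v) = algebraMap K S (AdjoinRoot.root f) := hF _
  have hFXt (i j : ℕ) : F (lastX r 0 q v ^ i * lastT r 0 q v ^ j) =
      (AdjoinRoot.root f ^ j) • AdjoinRoot.root g ^ i := by
    rw [map_mul, map_pow, map_pow, hFX, hFt, ← map_pow, mul_comm, ← Algebra.smul_def]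
  refine ⟨remainderCoeffZero hf ∘ₗ (remainderCoeffZero hg).restrictScalars R ∘ₗ F.toLinearMap,
    fun i hi j hj => ?_, fun j hj => ?_⟩
  · simp only [LinearMap.comp_apply, AlgHom.toLinearMap_apply, LinearMap.coe_restrictScalars]
    rw [hFXt, map_smul, remainderCoeffZero_root_pow hg (by omega)]
    by_cases h0 : i = 0
    · simp only [h0, if_true, smul_eq_mul, mul_one, true_and]
      exact remainderCoeffZero_root_pow hf (by omega)
    · simp [h0]
  · simp only [LinearMap.comp_apply, AlgHom.toLinearMap_apply, LinearMap.coe_restrictScalars]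
    have h1 := remainderCoeffZero_root_pow_natDegree hg (by omega)
    rw [hgd] at h1
    rw [hFXt, map_smul, h1, hg0, smul_eq_mul, mul_comm, ← map_neg, ← Algebra.smul_def, map_smul,
      remainderCoeffZero_root_pow hf (by omega)]
    split_ifs <;> simp

theorem exists_frobeniusForm_zero (hr : 1 ≤ r) (hd : 1 ≤ d) :
    ∃ θ : Cyc r 1 q v →ₗ[R] Cyc r 0 q v, FrobeniusForm θ := by
  have : NeZero r := ⟨by omega⟩
  obtain ⟨φ, h1, h2⟩ : ∃ φ : Cyc r 1 q v →ₗ[R] R,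
      (∀ i < d, ∀ j < r, φ (lastX r 0 q v ^ i * lastT r 0 q v ^ j) =
        if i = 0 ∧ j = 0 then 1 else 0) ∧
      ∀ j < r, φ (lastX r 0 q v ^ d * lastT r 0 q v ^ j) =
        if j = 0 then -(paramPoly v).coeff 0 else 0 := by
    rcases subsingleton_or_nontrivial R with _ | _
    · exact ⟨0, fun _ _ _ _ => Subsingleton.elim _ _, fun _ _ => Subsingleton.elim _ _⟩
    · exact exists_functional hr hd
  refine ⟨Algebra.linearMap R (Cyc r 0 q v) ∘ₗ φ, FrobeniusForm.of_zero hd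
    { t_pow := lastT_pow
      t_X := commute_lastT_lastX
      t_ι := commute_lastT_incl
      X_ι := commute_lastX_incl
      map_left := fun a y => ?_
      map_right := fun y a => ?_
      map_pow := fun i hi j hj => ?_
      map_top := fun j hj => ?_ }⟩
  · obtain ⟨c, rfl⟩ := algebraMap_surjective_zero a
    rw [AlgHom.commutes, ← Algebra.smul_def, map_smul, Algebra.smul_def]
  · obtain ⟨c, rfl⟩ := algebraMap_surjective_zero a
    rw [AlgHom.commutes, ← Algebra.commutes, ← Algebra.smul_def, map_smul, Algebra.smul_def,
      Algebra.commutes]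
  · rw [LinearMap.comp_apply, h1 i hi j hj]
    split_ifs <;> simp
  · rw [LinearMap.comp_apply, h2 j hj]
    split_ifs <;> simp

/-- `Y_{r,n+1}^d` is a Frobenius extension of `Y_{r,n}^d`. -/
theorem exists_frobeniusForm (hr : 1 ≤ r) (hd : 1 ≤ d) (n : ℕ) :
    ∃ θ : Cyc r (n + 1) q v →ₗ[R] Cyc r n q v, FrobeniusForm θ := by
  have : NeZero r := ⟨by omega⟩
  induction n with
  | zero => exact exists_frobeniusForm_zero hr hd
  | succ n ih =>
    obtain ⟨θ, hθ⟩ := ih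
    exact hθ.exists_succ hd

end Cyc

/-! ### Induction and coinduction -/

namespace Ind

variable {A B : Type u} [Ring A] [Ring B] {φ : A →+* B} {M : Type w} [AddCommGroup M] [Module A M]

@[elab_as_elim]
theorem induction {motive : Ind φ M → Prop} (h0 : motive 0) (ht : ∀ b m, motive (tmul φ b m))
    (ha : ∀ x y, motive x → motive y → motive (x + y)) (z : Ind φ M) : motive z := by
  obtain ⟨z, rfl⟩ := Submodule.Quotient.mk_surjective _ z
  induction z using TensorProduct.induction_on with
  | zero => exact h0
  | tmul b m => exact ht b m
  | add x y hx hy => exact ha _ _ hx hy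

theorem tmul_add (b : B) (m m' : M) : tmul φ b (m + m') = tmul φ b m + tmul φ b m' :=
  congrArg Submodule.Quotient.mk (TensorProduct.tmul_add b m m')

theorem tmul_zero (b : B) : tmul φ b (0 : M) = 0 :=
  congrArg Submodule.Quotient.mk (TensorProduct.tmul_zero M b)

theorem sum_tmul {I : Type*} (s : Finset I) (b : I → B) (m : M) :
    ∑ i ∈ s, tmul φ (b i) m = tmul φ (∑ i ∈ s, b i) m := by
  simp only [tmul, TensorProduct.sum_tmul]
  exact (map_sum (Submodule.mkQ (balancingRelations φ M)) _ s).symm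

variable (φ M) in
/-- A bimodule map `θ : B → A` gives the map `b ⊗ m ↦ (x ↦ θ (x b) m)` from induction to
coinduction. -/
def toCoind (θ : B →+ A) (hl : ∀ a x, θ (φ a * x) = a * θ x) (hr : ∀ x a, θ (x * φ a) = θ x * a) :
    Ind φ M →ₗ[B] Coind φ M :=
  Submodule.liftQ _ (TensorProduct.AlgebraTensorModule.lift
    (LinearMap.toSpanSingleton B (M →ₗ[ℤ] Coind φ M) (AddMonoidHom.toIntLinearMap
      { toFun := fun m => Coind.mk φ (fun x => θ x • m)
          (fun x y => by rw [map_add, add_smul]) (fun a x => by rw [hl, mul_smul])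
        map_zero' := Coind.ext fun x => smul_zero _
        map_add' := fun m m' => Coind.ext fun x => smul_add _ _ _ }))) (by
    rw [balancingRelations, Submodule.span_le]
    rintro _ ⟨b, a, m, rfl⟩
    rw [SetLike.mem_coe, LinearMap.mem_ker, map_sub, sub_eq_zero]
    refine Coind.ext fun x => ?_
    change θ (x * (b * φ a)) • m = θ (x * b) • a • m
    rw [← mul_assoc, hr, mul_smul])

theorem toCoind_tmul (θ : B →+ A) (hl : ∀ a x, θ (φ a * x) = a * θ x)
    (hr : ∀ x a, θ (x * φ a) = θ x * a) (b x : B) (m : M) :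
    toCoind φ M θ hl hr (tmul φ b m) x = θ (x * b) • m := rfl

variable (φ M) in
/-- If the bimodule map `θ` has dual bases `x`, `y`, then `f ↦ ∑ i, x i ⊗ f (y i)` is inverse to
`Ind.toCoind`. -/
def equivCoind (θ : B →+ A) (hl : ∀ a x, θ (φ a * x) = a * θ x)
    (hr : ∀ x a, θ (x * φ a) = θ x * a) {I : Type} [Fintype I] (x y : I → B)
    (hxy : ∀ b, ∑ i, x i * φ (θ (y i * b)) = b) (hyx : ∀ b, ∑ i, φ (θ (b * x i)) * y i = b) :
    Ind φ M ≃ₗ[B] Coind φ M :=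
  { toCoind φ M θ hl hr with
    invFun := fun f => ∑ i, tmul φ (x i) (f (y i))
    left_inv := fun z => by
      change ∑ i, tmul φ (x i) (toCoind φ M θ hl hr z (y i)) = z
      induction z using induction with
      | h0 => simp only [map_zero, Coind.zero_apply, tmul_zero, Finset.sum_const_zero]
      | ht b m =>
        simp only [toCoind_tmul, ← tmul_balanced]
        rw [sum_tmul, hxy]
      | ha z z' h h' =>
        simp only [map_add, Coind.add_apply, tmul_add, Finset.sum_add_distrib, h, h']
    right_inv := fun f => by
      refine Coind.ext fun b => ?_
      change toCoind φ M θ hl hr (∑ i, tmul φ (x i) (f (y i))) b = f b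
      have h1 : ∀ s : Finset I, toCoind φ M θ hl hr (∑ i ∈ s, tmul φ (x i) (f (y i))) b =
          f (∑ i ∈ s, φ (θ (b * x i)) * y i) := by
        classical
        intro s
        induction s using Finset.induction_on with
        | empty => simp
        | insert i s hi ih =>
          rw [Finset.sum_insert hi, Finset.sum_insert hi, map_add, Coind.add_apply, ih,
            Coind.apply_add, toCoind_tmul, Coind.apply_left]
      rw [h1, hyx] }

/-- `toCoind` is natural in the module. -/
theorem toCoind_map {N : Type w} [AddCommGroup N] [Module A N] (θ : B →+ A)
    (hl : ∀ a x, θ (φ a * x) = a * θ x) (hr : ∀ x a, θ (x * φ a) = θ x * a) (f : M →ₗ[A] N)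
    (z : Ind φ M) :
    toCoind φ N θ hl hr (map φ f z) = Coind.map φ f (toCoind φ M θ hl hr z) := by
  induction z using induction with
  | h0 => simp
  | ht b m =>
    refine Coind.ext fun x => ?_
    rw [map_tmul, toCoind_tmul, Coind.map_apply, toCoind_tmul, f.map_smul]
  | ha z z' h h' => rw [map_add, map_add, map_add, map_add, h, h']

end Ind

theorem Cyc.FrobeniusForm.isFirstProjection {R : Type u} [CommRing R] {d r n : ℕ}
    [Invertible (r : R)] {q : Rˣ} {v : Fin d → Rˣ} (hr : 1 ≤ r) (hd : 1 ≤ d)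
    {θ : Cyc r (n + 1) q v →ₗ[R] Cyc r n q v} (h : FrobeniusForm θ) :
    IsFirstProjection r n q v θ where
  map_left_right a b y := by rw [h.map_right, h.map_left]
  map_incl y := by
    have h1 := h.map_pow 0 hd 0 hr
    rw [pow_zero, pow_zero, mul_one, if_pos ⟨rfl, rfl⟩] at h1
    have h2 := h.map_left y 1
    rwa [h1, mul_one, mul_one] at h2
  map_X_t a b ha hb hab y := by
    rw [h.map_right, h.map_pow a ha b hb, if_neg (by simpa using hab), zero_mul]
  map_g i hi y z := by
    subst hi
    have h1 : θ (gen r (i + 1 + 1) q v (.g i (by omega))) = 0 := h.map_lastG _ rfl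
    rw [h.map_right, h.map_left, h1, mul_zero, zero_mul]

end YokonumaHecke

open YokonumaHecke in
theorem theorem4p4 {R : Type u} [CommRing R] (r d n : ℕ) (hr : 1 ≤ r) (hd : 1 ≤ d)
    [Invertible (r : R)] (q : Rˣ) (v : Fin d → Rˣ) :
    ∃ θ : Cyc r (n + 1) q v →ₗ[R] Cyc r n q v,
      IsFirstProjection r n q v θ ∧
      -- the kernel of `θ` contains no nonzero left ideal
      (∀ L : Submodule (Cyc r (n + 1) q v) (Cyc r (n + 1) q v), (∀ y ∈ L, θ y = 0) → L = ⊥) ∧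
      -- `θ` induces an isomorphism from induction to coinduction, natural in the module
      ∃ e : ∀ (M : Type w) [AddCommGroup M] [Module (Cyc r n q v) M],
          Ind (Cyc.inclHom r n q v) M ≃ₗ[Cyc r (n + 1) q v] Coind (Cyc.inclHom r n q v) M,
        (∀ (M : Type w) [AddCommGroup M] [Module (Cyc r n q v) M]
            (h x : Cyc r (n + 1) q v) (m : M),
          e M (Ind.tmul (Cyc.inclHom r n q v) h m) x = θ (x * h) • m) ∧
        (∀ (M N : Type w) [AddCommGroup M] [Module (Cyc r n q v) M]
            [AddCommGroup N] [Module (Cyc r n q v) N] (f : M →ₗ[Cyc r n q v] N)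
            (z : Ind (Cyc.inclHom r n q v) M),
          e N (Ind.map (Cyc.inclHom r n q v) f z) =
            Coind.map (Cyc.inclHom r n q v) f (e M z)) := by
  obtain ⟨θ, h⟩ := Cyc.exists_frobeniusForm (r := r) (q := q) (v := v) hr hd n
  obtain ⟨I, _, x, y, hxy, hyx⟩ := h.exists_dual_bases
  refine ⟨θ, h.isFirstProjection hr hd, fun L hL => ?_,
    fun M _ _ => Ind.equivCoind (Cyc.inclHom r n q v) M θ.toAddMonoidHom h.map_left h.map_right x y
      hxy hyx, fun M _ _ b z m => rfl, fun M N _ _ _ _ f z => Ind.toCoind_map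
      (φ := Cyc.inclHom r n q v) θ.toAddMonoidHom h.map_left h.map_right f z⟩
  refine (Submodule.eq_bot_iff L).2 fun z hz => ?_
  rw [← hxy z]
  refine Finset.sum_eq_zero fun i _ => ?_
  rw [hL (y i * z) (L.smul_mem (y i) hz), map_zero, mul_zero]
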